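/- Let $n\ge 0$, $\lambda\in\mathbb R\setminus\{0\}$ and $1\le p\le 2$. On $\mathbb R^{2n}$ write $[(x,u),(y,v)]=u\cdot y-v\cdot x$. For $\xi\in\mathbb R^{2n}$, $\eta=(a,b)\in\mathbb R^{2n}$ and $g\in\mathcal S(\mathbb R^{2n})$ put $$\tau_\lambda(\xi)g(\zeta)=g(\zeta-\xi)\,e^{-i\frac\lambda2[\zeta,\xi]},$$ $$e_\lambda(\eta)g(x,u)=g\big(x-(\tanh\tfrac\lambda2)b,\;u+(\tanh\tfrac\lambda2)a\big)\,e^{-i\frac\lambda2(\coth\frac\lambda2)(x\cdot a+u\cdot b)},$$ $$\Pi_\lambda(\xi,\eta)=e^{i\frac\lambda2(\coth\lambda)\,\xi\cdot\eta}\,e_\lambda(\eta)\,\tau_\lambda(\xi).$$ The twisted modulation space $M^{p,p}_\lambda(\mathbb R^{2n})$ is the set of tempered distributions $f$ on $\mathbb R^{2n}$ such that $$\|f\|_{\lambda,h}=\Big(\int_{\mathbb R^{2n}}\int_{\mathbb R^{2n}}|\langle f,\Pi_\lambda(\xi,\eta)h\rangle|^p\,d\xi\,d\eta\Big)^{1/p}<\infty$$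 for some non-zero window $h\in\mathcal S(\mathbb R^{2n})$, where $\langle f,h\rangle=f(\overline h)$. The classical modulation space $M^{p,p}(\mathbb R^{2n})$ and its norm $\|f\|_{g}$ are defined in the same way with $\langle f,e(y)\tau(x)g\rangle$ in place of $\langle f,\Pi_\lambda(\xi,\eta)h\rangle$, where $\tau(x)g(t)=g(t-x)$ and $e(y)g(t)=e^{iy\cdot t}g(t)$. The $\lambda$-twisted convolution of two functions is $$F*_\lambda G(\xi)=\int_{\mathbb R^{2n}}F(\eta)\,\tau_\lambda(\eta)G(\xi)\,d\eta .$$ **Theorem.** (i) $M^{p,p}_\lambda(\mathbb R^{2n})=M^{p,p}(\mathbb R^{2n})$ as sets, and for all non-zero windows $g,h\in\mathcal S(\mathbb R^{2n})$ the norms $\|\cdot\|_{g}$ and $\|\cdot\|_{\lambda,h}$ are equivalent. (ii) Every element of this space is given by a function in $L^p(\mathbb R^{2n})$; if $F$ and $G$ are functions giving elements of the space, then the integral defining $F*_\lambda G(\xi)$ converges absolutely for every $\xi$. (iii) With the product $*_\lambda$ the space is a (non-unital, complex) Banach algebra: for every non-zero window $h$ there is a constant $C>0$ such that, with the norm $C\|\cdot\|_{\lambda,h}$,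 the space is complete, it is closed under $*_\lambda$, the product $*_\lambda$ is bilinear and associative, and the norm is submultiplicative, that is, $$\|f*_\lambda g\|_{\lambda,h}\le C\,\|f\|_{\lambda,h}\,\|g\|_{\lambda,h}\qquad\text{for all } f,g\in M^{p,p}_\lambda(\mathbb R^{2n}).$$ -/

import Mathlib

open MeasureTheory Complex
open scoped ENNReal SchwartzMap

noncomputable section

/-! ### Classical modulation spaces -/

theorem hasTemperateGrowth_exp_I :
    Function.HasTemperateGrowth (fun t : ℝ => cexp (I * (t : ℂ))) := by
  have hder : ∀ t : ℝ, HasDerivAt (fun t : ℝ => cexp (I * (t : ℂ))) (I * cexp (I * (t : ℂ))) t := by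
    intro t
    have h1 : HasDerivAt (fun t : ℝ => I * (t : ℂ)) I t := by
      simpa using (Complex.ofRealCLM.hasDerivAt (x := t)).const_mul I
    simpa [mul_comm] using h1.cexp
  have hit : ∀ k : ℕ, iteratedDeriv k (fun t : ℝ => cexp (I * (t : ℂ))) =
      fun t : ℝ => I ^ k * cexp (I * (t : ℂ)) := by
    intro k
    induction k with
    | zero => simp
    | succ k ih =>
      rw [iteratedDeriv_succ, ih]
      funext t
      rw [((hder t).const_mul (I ^ k)).deriv, pow_succ, mul_assoc]
  refine ⟨?_, fun k => ⟨0, 1, fun t => ?_⟩⟩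
  · exact (contDiff_const.mul Complex.ofRealCLM.contDiff).cexp
  · rw [norm_iteratedFDeriv_eq_norm_iteratedDeriv, hit]
    simp [mul_comm I, Complex.norm_exp_ofReal_mul_I]

section Classical

variable {E : Type*} [NormedAddCommGroup E] [NormedSpace ℝ E]

theorem hasTemperateGrowth_character (L : E →L[ℝ] ℝ) :
    Function.HasTemperateGrowth (fun x : E => cexp (I * (L x : ℂ))) :=
  hasTemperateGrowth_exp_I.comp L.hasTemperateGrowth

/-- Multiplication of a Schwartz function by the character `x ↦ exp (i L x)`. -/
def schwartzModulate (L : E →L[ℝ] ℝ) (g : 𝓢(E, ℂ)) : 𝓢(E, ℂ) :=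
  SchwartzMap.smulLeftCLM ℂ (fun x : E => cexp (I * (L x : ℂ))) g

theorem schwartzModulate_apply (L : E →L[ℝ] ℝ) (g : 𝓢(E, ℂ)) (x : E) :
    schwartzModulate L g x = cexp (I * (L x : ℂ)) * g x := by
  simp [schwartzModulate, SchwartzMap.smulLeftCLM_apply_apply (hasTemperateGrowth_character L)]

/-- The translation `τ(a) g (x) = g (x - a)` of a Schwartz function. -/
def schwartzTranslate (a : E) (g : 𝓢(E, ℂ)) : 𝓢(E, ℂ) := g.compSubConstCLM ℂ a

theorem schwartzTranslate_apply (a : E) (g : 𝓢(E, ℂ)) (x : E) :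
    schwartzTranslate a g x = g (x - a) := rfl

/-- Complex conjugation of a Schwartz function. -/
def schwartzConj (g : 𝓢(E, ℂ)) : 𝓢(E, ℂ) :=
  g.postcompCLM (𝕜 := ℝ) Complex.conjCLE.toContinuousLinearMap

theorem schwartzConj_apply (g : 𝓢(E, ℂ)) (x : E) :
    schwartzConj g x = (starRingEnd ℂ) (g x) := rfl

/-- The sesquilinear pairing `⟨f, g⟩`, antilinear in the Schwartz function `g`. -/
def sesqPairing (f : 𝓢'(E, ℂ)) (g : 𝓢(E, ℂ)) : ℂ := f (schwartzConj g)

/-- The tempered distribution `f` is given by integration against the function `F`. -/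
def IsGivenBy [MeasureSpace E] (f : 𝓢'(E, ℂ)) (F : E → ℂ) : Prop :=
  LocallyIntegrable F ∧
    ∀ φ : 𝓢(E, ℂ), Integrable (fun x => φ x * F x) ∧ f φ = ∫ x, φ x * F x

/-- The mixed norm of `L^{p,q}`: the `L^p` norm in the first variable, followed by the `L^q` norm
in the second one. -/
def mixedNorm [MeasureSpace E] (p q : ℝ≥0∞) (F : E → E → ℂ) : ℝ≥0∞ :=
  eLpNorm (fun η => eLpNorm (fun ξ => F ξ η) p volume) q volume

end Classical

section ClassicalInner

variable {E : Type*} [NormedAddCommGroup E] [InnerProductSpace ℝ E] [MeasureSpace E]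

/-- The short-time Fourier transform `V_g f (x, y) = ⟨f, e(y) τ(x) g⟩`, where
`e(y) g (t) = exp (i y · t) g (t)`. -/
def stft (g : 𝓢(E, ℂ)) (f : 𝓢'(E, ℂ)) (x y : E) : ℂ :=
  sesqPairing f (schwartzModulate (innerSL ℝ y) (schwartzTranslate x g))

def modulationNorm (p q : ℝ≥0∞) (g : 𝓢(E, ℂ)) (f : 𝓢'(E, ℂ)) : ℝ≥0∞ :=
  mixedNorm p q (stft g f)

variable (E) in
/-- The modulation space `M^{p,q}(E)`. -/
def modulationSpace (p q : ℝ≥0∞) : Set 𝓢'(E, ℂ) :=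
  {f | ∃ g : 𝓢(E, ℂ), g ≠ 0 ∧ modulationNorm p q g f < ∞}

end ClassicalInner

/-! ### Twisted translations, twisted modulations, twisted convolution -/

/-- `ℝ^{2n}`: a point `ξ = (x, u)` has the coordinates `x i = ξ (Sum.inl i)` and
`u i = ξ (Sum.inr i)`. -/
abbrev PhaseSpace (n : ℕ) : Type := EuclideanSpace ℝ (Fin n ⊕ Fin n)

namespace PhaseSpace

variable {n : ℕ}

/-- The symplectic form `[(x, u), (y, v)] = u · y - v · x`. -/
def symp (ξ η : PhaseSpace n) : ℝ :=
  ∑ i : Fin n, (ξ (Sum.inr i) * η (Sum.inl i) - η (Sum.inr i) * ξ (Sum.inl i))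

/-- `J (a, b) = (b, -a)`. -/
def J (η : PhaseSpace n) : PhaseSpace n :=
  WithLp.toLp 2 (Sum.elim (fun i => η (Sum.inr i)) (fun i => -η (Sum.inl i)))

theorem symp_eq_inner (ξ η : PhaseSpace n) : symp ξ η = -inner ℝ (J η) ξ := by
  simp [symp, J, PiLp.inner_apply, Fintype.sum_sum_type, Finset.sum_sub_distrib, mul_comm]
  ring

/-- The twisted translation `τ_λ(η) g (ξ) = g (ξ - η) exp (-i (λ/2) [ξ, η])` of a function. -/
def twistedTranslate (lam : ℝ) (η : PhaseSpace n) (g : PhaseSpace n → ℂ) : PhaseSpace n → ℂ :=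
  fun ξ => g (ξ - η) * cexp (-I * (lam / 2 * symp ξ η : ℝ))

/-- The twisted modulation
`e_λ(a, b) g (x, u) = g (x - tanh (λ/2) b, u + tanh (λ/2) a) exp (-i (λ/2) coth (λ/2) (x·a + u·b))`
of a function. -/
def twistedModulate (lam : ℝ) (η : PhaseSpace n) (g : PhaseSpace n → ℂ) : PhaseSpace n → ℂ :=
  fun ξ => g (ξ - Real.tanh (lam / 2) • J η) *
    cexp (-I * (lam / 2 * (Real.cosh (lam / 2) / Real.sinh (lam / 2)) * inner ℝ ξ η : ℝ))

/-- The operator `Π_λ(ξ, η) = exp (i (λ/2) coth λ (ξ · η)) e_λ(η) τ_λ(ξ)` on functions. -/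
def twistedRep (lam : ℝ) (ξ η : PhaseSpace n) (g : PhaseSpace n → ℂ) : PhaseSpace n → ℂ :=
  fun x => cexp (I * (lam / 2 * (Real.cosh lam / Real.sinh lam) * inner ℝ ξ η : ℝ)) *
    twistedModulate lam η (twistedTranslate lam ξ g) x

/-- The operator `Π_λ(ξ, η)` on Schwartz functions. -/
def twistedRepSchwartz (lam : ℝ) (ξ η : PhaseSpace n) (g : 𝓢(PhaseSpace n, ℂ)) :
    𝓢(PhaseSpace n, ℂ) :=
  cexp (I * (lam / 2 * (Real.cosh lam / Real.sinh lam) * inner ℝ ξ η : ℝ)) •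
    schwartzModulate
      (-(lam / 2 * (Real.cosh (lam / 2) / Real.sinh (lam / 2))) • innerSL ℝ η)
      (schwartzTranslate (Real.tanh (lam / 2) • J η)
        (schwartzModulate ((lam / 2) • innerSL ℝ (J ξ)) (schwartzTranslate ξ g)))

theorem twistedRepSchwartz_coe (lam : ℝ) (ξ η : PhaseSpace n) (g : 𝓢(PhaseSpace n, ℂ)) :
    ⇑(twistedRepSchwartz lam ξ η g) = twistedRep lam ξ η g := by
  funext x
  simp only [twistedRepSchwartz, twistedRep, twistedModulate, twistedTranslate, symp_eq_inner,
    schwartzModulate_apply, schwartzTranslate_apply, smul_apply, innerSL_apply_apply, smul_eq_mul,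
    real_inner_comm x η]
  have h1 : ∀ a b c d : ℂ, a * (b * (c * d)) = a * (d * c * b) := by intros; ring
  rw [h1]
  congr 3
  · congr 1
    push_cast
    ring
  · push_cast
    ring_nf

/-- The matrix coefficient `⟨f, Π_λ(ξ, η) g⟩`. -/
def matrixCoeff (lam : ℝ) (g : 𝓢(PhaseSpace n, ℂ)) (f : 𝓢'(PhaseSpace n, ℂ))
    (ξ η : PhaseSpace n) : ℂ :=
  sesqPairing f (twistedRepSchwartz lam ξ η g)

/-- The norm of the twisted modulation space with respect to the window `g`. -/
def twistedModulationNorm (lam : ℝ) (p q : ℝ≥0∞) (g : 𝓢(PhaseSpace n, ℂ))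
    (f : 𝓢'(PhaseSpace n, ℂ)) : ℝ≥0∞ :=
  mixedNorm p q (matrixCoeff lam g f)

variable (n) in
/-- The twisted modulation space `M_λ^{p,q}(ℝ^{2n})`. -/
def twistedModulationSpace (lam : ℝ) (p q : ℝ≥0∞) : Set 𝓢'(PhaseSpace n, ℂ) :=
  {f | ∃ g : 𝓢(PhaseSpace n, ℂ), g ≠ 0 ∧ twistedModulationNorm lam p q g f < ∞}

/-- The `λ`-twisted convolution `F ∗_λ G (ξ) = ∫ F(η) τ_λ(η)G(ξ) dη`. -/
def twistedConv (lam : ℝ) (F G : PhaseSpace n → ℂ) (ξ : PhaseSpace n) : ℂ :=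
  ∫ η, F η * twistedTranslate lam η G ξ

end PhaseSpace

end

/-! The operator $\Pi_\lambda(\xi,\eta)$ is, up to a phase, the classical time-frequency shift
$e(y)\tau(x)$ at a point $(x,y)$ that depends linearly and injectively on $(\xi,\eta)$
(`exists_twistedRepSchwartz_eq`, `twistLinearMap_injective`). For one window the twisted norm is
therefore a constant multiple of the classical one, and (i) reduces to changing the window of a
classical modulation norm.

Everything classical rests on one estimate, `exists_enorm_stft_le`: $|V_hf|$ is bounded pointwise by
the convolution of $|V_gf|$ with $(1+\|z\|)^{-N}$. It comes from the inversion formula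
`stft_inversion`, which holds for all tempered distributions because they commute with integrals of
Schwartz-valued families (`exists_schwartz_integral`). The estimate gives independence of the
window. Applied with $h=g$ it also shows that, for $p\le 2$, the $L^p$ norm of $V_gf$ controls its
$L^2$ norm and its mixed norm $L^p(L^2)$ (`DecayDominated.lintegral_sq_le`,
`DecayDominated.lintegral_mixed_le`). The $L^2$ bound makes the elements $L^2$ functions, so twisted
convolutions converge by Cauchy–Schwarz. The mixed bound with Plancherel's theorem in the frequency
variable makes them $L^p$ functions (`exists_lintegral_rpow_le`).

For the product, `twistedStft` uses coordinates $(\alpha,\beta)$ in which short-time Fourier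
transforms multiply like integral kernels: $T_{\varphi*\psi}(F*G)(\alpha,\beta)=\int T_\varphi
F(\alpha,\gamma)\,T_\psi G(\gamma,\beta)\,d\gamma$ (`twistedStft_twistedConv`). Cauchy–Schwarz in
$\gamma$ separates $\alpha$ from $\beta$, and the mixed norms bound the two factors, as for products
of Hilbert–Schmidt operators. Given $\varphi$, a window $\psi$ with $\varphi*_\lambda\psi\ne0$
always exists, so the estimate returns to the original window.

The case $p=2$ makes $*_\lambda$ a bounded product on $L^2$. It is associative by Fubini when the
first factor is Schwartz, and in general by density. Completeness holds because $f\mapsto V_hf$ has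
closed range in $L^p$: the modulation norm dominates the $L^2$ norm, and each value of $V_hf$ is
continuous on $L^2$. -/

noncomputable section

set_option maxSynthPendingDepth 3

/-! ### Integrals of families of Schwartz functions -/

section SchwartzIntegral

open BoundedContinuousFunction

variable {E : Type*} [NormedAddCommGroup E] [NormedSpace ℝ E]

variable (E) in
/-- The Banach space of bounded continuous functions with values in the `l`-linear forms. -/
def BoundedForms (l : ℕ) : Type _ := E →ᵇ (E [×l]→L[ℝ] ℂ)

instance (l : ℕ) : NormedAddCommGroup (BoundedForms E l) :=
  inferInstanceAs (NormedAddCommGroup (E →ᵇ (E [×l]→L[ℝ] ℂ)))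

instance (l : ℕ) : NormedSpace ℂ (BoundedForms E l) :=
  inferInstanceAs (NormedSpace ℂ (E →ᵇ (E [×l]→L[ℝ] ℂ)))

instance (l : ℕ) : CompleteSpace (BoundedForms E l) :=
  inferInstanceAs (CompleteSpace (E →ᵇ (E [×l]→L[ℝ] ℂ)))

/-- Evaluation at a point. -/
def BoundedForms.eval (l : ℕ) (t : E) : BoundedForms E l →L[ℂ] (E [×l]→L[ℝ] ℂ) :=
  BoundedContinuousFunction.evalCLM ℂ t

theorem BoundedForms.norm_eval_le {l : ℕ} (F : BoundedForms E l) (t : E) :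
    ‖BoundedForms.eval l t F‖ ≤ ‖F‖ :=
  BoundedContinuousFunction.norm_coe_le_norm (β := E [×l]→L[ℝ] ℂ) F t

theorem BoundedForms.ext {l : ℕ} {F G : BoundedForms E l}
    (h : ∀ t, BoundedForms.eval l t F = BoundedForms.eval l t G) : F = G :=
  BoundedContinuousFunction.ext h

/-- The bounded function `t ↦ ‖t‖ ^ k • D^l φ t` attached to a Schwartz function `φ`. -/
def weightedDeriv (k l : ℕ) (φ : 𝓢(E, ℂ)) : BoundedForms E l :=
  BoundedContinuousFunction.ofNormedAddCommGroup (fun t => (‖t‖ ^ k : ℝ) • iteratedFDeriv ℝ l φ t)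
    ((continuous_norm.pow k).smul ((φ.smooth l).continuous_iteratedFDeriv le_rfl))
    (SchwartzMap.seminorm ℂ k l φ)
    (fun t => by
      rw [norm_smul, norm_pow, norm_norm]
      exact SchwartzMap.le_seminorm ℂ k l φ t)

theorem weightedDeriv_apply (k l : ℕ) (φ : 𝓢(E, ℂ)) (t : E) :
    BoundedForms.eval l t (weightedDeriv k l φ) = (‖t‖ ^ k : ℝ) • iteratedFDeriv ℝ l φ t := rfl

theorem norm_weightedDeriv_le (k l : ℕ) (φ : 𝓢(E, ℂ)) :
    ‖weightedDeriv k l φ‖ ≤ SchwartzMap.seminorm ℂ k l φ :=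
  BoundedContinuousFunction.norm_ofNormedAddCommGroup_le _ (apply_nonneg _ _) _

/-- With the previous bound this identifies each Schwartz seminorm with a Banach space norm, so that
Bochner integrals can stand in for integrals in the Schwartz space. -/
theorem seminorm_le_norm_weightedDeriv (k l : ℕ) (φ : 𝓢(E, ℂ)) :
    SchwartzMap.seminorm ℂ k l φ ≤ ‖weightedDeriv k l φ‖ := by
  refine SchwartzMap.seminorm_le_bound ℂ k l φ (norm_nonneg (weightedDeriv k l φ)) fun t => ?_
  have h := BoundedForms.norm_eval_le (weightedDeriv k l φ) t
  rwa [weightedDeriv_apply, norm_smul, norm_pow, norm_norm] at h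

theorem iteratedFDeriv_schwartz_add (l : ℕ) (φ ψ : 𝓢(E, ℂ)) (t : E) :
    iteratedFDeriv ℝ l (φ + ψ : 𝓢(E, ℂ)) t = iteratedFDeriv ℝ l φ t + iteratedFDeriv ℝ l ψ t :=
  iteratedFDeriv_add_apply (φ.smooth l).contDiffAt (ψ.smooth l).contDiffAt

theorem iteratedFDeriv_schwartz_smul (l : ℕ) (c : ℂ) (φ : 𝓢(E, ℂ)) (t : E) :
    iteratedFDeriv ℝ l (c • φ : 𝓢(E, ℂ)) t = c • iteratedFDeriv ℝ l φ t :=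
  iteratedFDeriv_const_smul_apply (φ.smooth l).contDiffAt

/-- `weightedDeriv` as a continuous linear map. -/
def weightedDerivCLM (k l : ℕ) : 𝓢(E, ℂ) →L[ℂ] BoundedForms E l :=
  SchwartzMap.mkCLMtoNormedSpace (σ := RingHom.id ℂ) (G := BoundedForms E l)
    (fun φ : 𝓢(E, ℂ) => weightedDeriv k l φ)
    (fun φ ψ => by
      refine BoundedForms.ext fun t => ?_
      rw [map_add]
      simp only [weightedDeriv_apply, iteratedFDeriv_schwartz_add, smul_add])
    (fun c φ => by
      refine BoundedForms.ext fun t => ?_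
      rw [map_smul]
      simp only [weightedDeriv_apply, iteratedFDeriv_schwartz_smul, RingHom.id_apply]
      rw [smul_comm])
    ⟨{(k, l)}, 1, zero_le_one, fun φ => by
      simpa using norm_weightedDeriv_le k l φ⟩

theorem weightedDerivCLM_apply (k l : ℕ) (φ : 𝓢(E, ℂ)) :
    weightedDerivCLM k l φ = weightedDeriv k l φ := rfl

theorem continuous_iteratedFDeriv_schwartz (l : ℕ) (t : E) :
    Continuous fun φ : 𝓢(E, ℂ) => iteratedFDeriv ℝ l φ t := by
  have h : (fun φ : 𝓢(E, ℂ) => iteratedFDeriv ℝ l φ t) =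
      fun φ => BoundedForms.eval l t (weightedDerivCLM 0 l φ) := by
    funext φ
    simp [weightedDerivCLM_apply, weightedDeriv_apply]
  rw [h]
  fun_prop

theorem continuous_schwartz_apply (t : E) : Continuous fun φ : 𝓢(E, ℂ) => φ t := by
  have h : (fun φ : 𝓢(E, ℂ) => φ t) = fun φ : 𝓢(E, ℂ) => iteratedFDeriv ℝ 0 φ t 0 := by
    funext φ; simp
  rw [h]
  exact (continuous_iteratedFDeriv_schwartz 0 t).eval_const _

theorem continuous_schwartz_seminorm (k l : ℕ) :
    Continuous fun φ : 𝓢(E, ℂ) => SchwartzMap.seminorm ℂ k l φ :=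
  (schwartz_withSeminorms ℂ E ℂ).continuous_seminorm (k, l)

/-- A tempered distribution factors through finitely many bounded functions `weightedDeriv`. -/
theorem exists_factor_weightedDeriv (f : 𝓢'(E, ℂ)) :
    ∃ (s : Finset (ℕ × ℕ)) (L : (∀ i : s, BoundedForms E i.1.2) →L[ℂ] ℂ),
      ∀ φ : 𝓢(E, ℂ), f φ = L fun i => weightedDerivCLM i.1.1 i.1.2 φ := by
  obtain ⟨s0, C, -, hC⟩ := Seminorm.bound_of_continuous (schwartz_withSeminorms ℂ E ℂ)
    ((normSeminorm ℂ ℂ).comp (f : 𝓢(E, ℂ) →ₗ[ℂ] ℂ))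
    (by exact continuous_norm.comp f.continuous)
  have hC' : ∀ φ, ‖f φ‖ ≤ C * (s0.sup (schwartzSeminormFamily ℂ E ℂ)) φ := fun φ => hC φ
  -- The index `(0, 0)` is added so that `j` records the function itself and is injective.
  set s := insert (0, 0) s0 with hs
  let j : 𝓢(E, ℂ) →ₗ[ℂ] (∀ i : s, BoundedForms E i.1.2) :=
    LinearMap.pi fun i => (weightedDerivCLM (E := E) i.1.1 i.1.2).toLinearMap
  have hj : ∀ φ i, j φ i = weightedDeriv i.1.1 i.1.2 φ := fun _ _ => rfl
  have hnorm : ∀ φ, (s0.sup (schwartzSeminormFamily ℂ E ℂ)) φ ≤ ‖j φ‖ := by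
    intro φ
    refine Seminorm.finset_sup_apply_le (norm_nonneg _) fun i hi => ?_
    refine (seminorm_le_norm_weightedDeriv i.1 i.2 φ).trans ?_
    exact norm_le_pi_norm (j φ) ⟨i, Finset.mem_insert_of_mem hi⟩
  have hinj : Function.Injective j := by
    intro φ ψ h
    ext t
    have h1 := congrArg (BoundedForms.eval 0 t) (congrFun h ⟨(0, 0), Finset.mem_insert_self _ _⟩)
    simp only [hj, weightedDeriv_apply, pow_zero, one_smul] at h1
    simpa using congrArg (fun m => m 0) h1
  let e := LinearEquiv.ofInjective j hinj
  let F0 : StrongDual ℂ (LinearMap.range j) :=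
    LinearMap.mkContinuous ((f : 𝓢(E, ℂ) →ₗ[ℂ] ℂ) ∘ₗ (e.symm : _ →ₗ[ℂ] 𝓢(E, ℂ))) C (by
      intro y
      obtain ⟨φ, rfl⟩ := e.surjective y
      have h1 : ‖e φ‖ = ‖j φ‖ := rfl
      rw [h1]
      simp only [LinearMap.comp_apply, LinearEquiv.coe_coe, LinearEquiv.symm_apply_apply]
      refine (hC' φ).trans ?_
      gcongr
      exact hnorm φ)
  -- Hahn–Banach, from the range of `j` to the whole finite product of Banach spaces.
  obtain ⟨L, hL, -⟩ := exists_extension_norm_eq _ F0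
  refine ⟨s, L, fun φ => ?_⟩
  have h1 := hL (e φ)
  have h2 : F0 (e φ) = f φ := by
    simp [F0]
  rw [h2] at h1
  exact h1.symm

variable {Z : Type*} [TopologicalSpace Z] [SecondCountableTopology Z] [MeasurableSpace Z]
  [OpensMeasurableSpace Z] {μ : Measure Z}

theorem integrable_iteratedFDeriv_schwartz {Φ : Z → 𝓢(E, ℂ)} (hΦ : Continuous Φ) {l : ℕ}
    (hint : Integrable (fun z => SchwartzMap.seminorm ℂ 0 l (Φ z)) μ) (t : E) :
    Integrable (fun z => iteratedFDeriv ℝ l (Φ z) t) μ :=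
  hint.mono' ((continuous_iteratedFDeriv_schwartz l t).comp hΦ).aestronglyMeasurable
    (.of_forall fun z => SchwartzMap.norm_iteratedFDeriv_le_seminorm ℂ (Φ z) l t)

/-- Differentiation under the integral sign: the seminorm of index `(0, l + 1)` dominates the
derivative of order `l + 1` uniformly in the point, and it is integrable by assumption. -/
theorem hasFTaylorSeriesUpTo_integral_schwartz {Φ : Z → 𝓢(E, ℂ)} (hΦ : Continuous Φ)
    (hint : ∀ l, Integrable (fun z => SchwartzMap.seminorm ℂ 0 l (Φ z)) μ) :
    HasFTaylorSeriesUpTo (⊤ : ℕ∞) (fun t => ∫ z, Φ z t ∂μ)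
      (fun t l => ∫ z, iteratedFDeriv ℝ l (Φ z) t ∂μ) := by
  have hder : ∀ (l : ℕ) (t : E), HasFDerivAt (fun t => ∫ z, iteratedFDeriv ℝ l (Φ z) t ∂μ)
      (∫ z, iteratedFDeriv ℝ (l + 1) (Φ z) t ∂μ).curryLeft t := by
    intro l t
    have hcurry : ∀ z x, fderiv ℝ (iteratedFDeriv ℝ l (Φ z)) x =
        (iteratedFDeriv ℝ (l + 1) (Φ z) x).curryLeft := fun z x => by
      rw [fderiv_iteratedFDeriv]; rfl
    have hmeas : AEStronglyMeasurable (fun z => fderiv ℝ (iteratedFDeriv ℝ l (Φ z)) t) μ := by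
      simp_rw [hcurry]
      exact (((continuousMultilinearCurryLeftEquiv ℝ (fun _ : Fin (l + 1) => E)
        ℂ).continuous.comp (continuous_iteratedFDeriv_schwartz (l + 1) t)).comp
          hΦ).aestronglyMeasurable
    have hbound : ∀ z x, ‖fderiv ℝ (iteratedFDeriv ℝ l (Φ z)) x‖ ≤
        SchwartzMap.seminorm ℂ 0 (l + 1) (Φ z) := fun z x => by
      rw [norm_fderiv_iteratedFDeriv]
      exact SchwartzMap.norm_iteratedFDeriv_le_seminorm ℂ (Φ z) (l + 1) x
    have hcomm : (∫ z, iteratedFDeriv ℝ (l + 1) (Φ z) t ∂μ).curryLeft =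
        ∫ z, fderiv ℝ (iteratedFDeriv ℝ l (Φ z)) t ∂μ := by
      have hi : Integrable (fun z => fderiv ℝ (iteratedFDeriv ℝ l (Φ z)) t) μ :=
        (hint (l + 1)).mono' hmeas (.of_forall fun z => hbound z t)
      ext v m
      rw [ContinuousMultilinearMap.curryLeft_apply, ContinuousMultilinearMap.integral_apply
        (integrable_iteratedFDeriv_schwartz hΦ (hint (l + 1)) t), ContinuousLinearMap.integral_apply
        hi, ContinuousMultilinearMap.integral_apply (hi.apply_continuousLinearMap v)]
      simp_rw [hcurry]
      rfl
    rw [hcomm]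
    exact hasFDerivAt_integral_of_dominated_of_fderiv_le (𝕜 := ℝ) (s := Set.univ)
      (F := fun t z => iteratedFDeriv ℝ l (Φ z) t)
      (F' := fun t z => fderiv ℝ (iteratedFDeriv ℝ l (Φ z)) t)
      (bound := fun z => SchwartzMap.seminorm ℂ 0 (l + 1) (Φ z)) Filter.univ_mem
      (.of_forall fun x => (integrable_iteratedFDeriv_schwartz hΦ (hint l) x).1)
      (integrable_iteratedFDeriv_schwartz hΦ (hint l) t) hmeas
      (.of_forall fun z x _ => hbound z x) (hint (l + 1))
      (.of_forall fun z x _ => (((Φ z).smooth (l + 1)).differentiable_iteratedFDeriv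
        (m := l) (by exact_mod_cast Nat.lt_succ_self l) x).hasFDerivAt)
  refine ⟨fun t => ?_, fun l _ t => hder l t, fun l _ => ?_⟩
  · rw [ContinuousMultilinearMap.curry0_apply]
    rw [ContinuousMultilinearMap.integral_apply (integrable_iteratedFDeriv_schwartz hΦ (hint 0) t)]
    simp
  · exact continuous_iff_continuousAt.2 fun t => (hder l t).continuousAt

/-- The integral of a continuous family of Schwartz functions whose seminorms are integrable is a
Schwartz function, and tempered distributions commute with it. -/
theorem exists_schwartz_integral {Φ : Z → 𝓢(E, ℂ)} (hΦ : Continuous Φ)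
    (hint : ∀ k l, Integrable (fun z => SchwartzMap.seminorm ℂ k l (Φ z)) μ) :
    ∃ Ψ : 𝓢(E, ℂ), (∀ t, Ψ t = ∫ z, Φ z t ∂μ) ∧
      ∀ f : 𝓢'(E, ℂ), Integrable (fun z => f (Φ z)) μ ∧ f Ψ = ∫ z, f (Φ z) ∂μ := by
  have hT := hasFTaylorSeriesUpTo_integral_schwartz hΦ (hint 0)
  have hD : ∀ l t, iteratedFDeriv ℝ l (fun t => ∫ z, Φ z t ∂μ) t =
      ∫ z, iteratedFDeriv ℝ l (Φ z) t ∂μ := fun l t =>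
    (hT.eq_iteratedFDeriv (by exact_mod_cast le_top) t).symm
  let Ψ : 𝓢(E, ℂ) :=
    { toFun := fun t => ∫ z, Φ z t ∂μ
      smooth' := hT.contDiff
      decay' := fun k l => ⟨∫ z, SchwartzMap.seminorm ℂ k l (Φ z) ∂μ, fun t => by
        rw [hD, ← norm_norm t, ← norm_pow, ← norm_smul, ← integral_smul]
        refine norm_integral_le_of_norm_le (hint k l) (.of_forall fun z => ?_)
        rw [norm_smul, norm_pow, norm_norm]
        exact SchwartzMap.le_seminorm ℂ k l (Φ z) t⟩ }
  refine ⟨Ψ, fun t => rfl, fun f => ?_⟩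
  -- After this factorisation `f` acts through a continuous functional on a Banach space, which
  -- commutes with Bochner integrals. It remains to identify the integral there, by evaluation at
  -- points.
  obtain ⟨s, L, hL⟩ := exists_factor_weightedDeriv f
  have hi : ∀ k l, Integrable (fun z => weightedDerivCLM k l (Φ z)) μ := fun k l =>
    (hint k l).mono' ((weightedDerivCLM k l).continuous.comp hΦ).aestronglyMeasurable
      (.of_forall fun z => norm_weightedDeriv_le k l (Φ z))
  have hpi : Integrable (fun z => fun i : s => weightedDerivCLM i.1.1 i.1.2 (Φ z)) μ :=
    Integrable.of_eval fun i => hi i.1.1 i.1.2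
  have hΨ : (fun i : s => weightedDerivCLM i.1.1 i.1.2 Ψ) =
      ∫ z, (fun i : s => weightedDerivCLM i.1.1 i.1.2 (Φ z)) ∂μ := by
    funext i
    rw [eval_integral fun i => hi i.1.1 i.1.2]
    refine BoundedForms.ext fun t => ?_
    have h1 := (BoundedForms.eval i.1.2 t).integral_comp_comm (hi i.1.1 i.1.2)
    rw [← h1]
    simp only [weightedDerivCLM_apply, weightedDeriv_apply]
    rw [integral_smul, ← hD]
    rfl
  refine ⟨?_, ?_⟩
  · simp_rw [hL]
    exact L.integrable_comp hpi
  · simp_rw [hL]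
    rw [hΨ, L.integral_comp_comm hpi]

end SchwartzIntegral
end

noncomputable section

set_option maxSynthPendingDepth 3

/-! ### Time-frequency shifts of Schwartz functions -/

section Translate

variable {E : Type*} [NormedAddCommGroup E] [NormedSpace ℝ E]

/-- The finite supremum of Schwartz seminorms which controls weighted derivatives. -/
def supSeminorm (k l : ℕ) : Seminorm ℂ 𝓢(E, ℂ) :=
  (Finset.Iic (k, l)).sup fun m => SchwartzMap.seminorm ℂ m.1 m.2

theorem continuous_supSeminorm (k l : ℕ) : Continuous fun φ : 𝓢(E, ℂ) => supSeminorm k l φ :=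
  Finset.sup_induction (p := fun q : Seminorm ℂ 𝓢(E, ℂ) => Continuous q) continuous_zero
    (fun _ h _ h' => h.sup h') fun m _ => continuous_schwartz_seminorm m.1 m.2

theorem one_add_pow_mul_iteratedFDeriv_le (k l : ℕ) (g : 𝓢(E, ℂ)) (t : E) :
    (1 + ‖t‖) ^ k * ‖iteratedFDeriv ℝ l g t‖ ≤ 2 ^ k * supSeminorm k l g :=
  SchwartzMap.one_add_le_sup_seminorm_apply (𝕜 := ℂ) (m := (k, l)) le_rfl le_rfl g t

theorem one_add_pow_mul_norm_le (k : ℕ) (g : 𝓢(E, ℂ)) (t : E) :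
    (1 + ‖t‖) ^ k * ‖g t‖ ≤ 2 ^ k * supSeminorm k 0 g := by
  simpa using one_add_pow_mul_iteratedFDeriv_le k 0 g t

theorem iteratedFDeriv_schwartzTranslate (l : ℕ) (a : E) (g : 𝓢(E, ℂ)) (t : E) :
    iteratedFDeriv ℝ l (schwartzTranslate a g) t = iteratedFDeriv ℝ l g (t - a) :=
  iteratedFDeriv_comp_sub l a t

theorem seminorm_schwartzTranslate_le (k l : ℕ) (a : E) (g : 𝓢(E, ℂ)) :
    SchwartzMap.seminorm ℂ k l (schwartzTranslate a g) ≤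
      (1 + ‖a‖) ^ k * (2 ^ k * supSeminorm k l g) := by
  refine SchwartzMap.seminorm_le_bound ℂ k l _ (by positivity) fun t => ?_
  rw [iteratedFDeriv_schwartzTranslate]
  have h1 : ‖t‖ ≤ (1 + ‖a‖) * (1 + ‖t - a‖) := by
    have h := norm_add_le (t - a) a
    rw [sub_add_cancel] at h
    nlinarith [norm_nonneg a, norm_nonneg (t - a)]
  calc ‖t‖ ^ k * ‖iteratedFDeriv ℝ l g (t - a)‖
      ≤ ((1 + ‖a‖) * (1 + ‖t - a‖)) ^ k * ‖iteratedFDeriv ℝ l g (t - a)‖ := by gcongr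
    _ = (1 + ‖a‖) ^ k * ((1 + ‖t - a‖) ^ k * ‖iteratedFDeriv ℝ l g (t - a)‖) := by
      rw [mul_pow, mul_assoc]
    _ ≤ _ := mul_le_mul_of_nonneg_left (one_add_pow_mul_iteratedFDeriv_le k l g (t - a))
      (by positivity)

/-- Mean value inequality on the segment from `t - b` to `t - a`, at the cost of one derivative. The
weight `‖t‖ ^ k` stays fixed and is absorbed by the decay of `g`, since `‖t‖ ≤ (1 + ‖a‖ + ‖b‖) * (1
+ ‖s‖)` for `s` on the segment. -/
theorem seminorm_schwartzTranslate_sub_le (k l : ℕ) (a b : E) (g : 𝓢(E, ℂ)) :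
    SchwartzMap.seminorm ℂ k l (schwartzTranslate a g - schwartzTranslate b g) ≤
      (1 + ‖a‖ + ‖b‖) ^ k * (2 ^ k * supSeminorm k (l + 1) g) * ‖a - b‖ := by
  refine SchwartzMap.seminorm_le_bound ℂ k l _ (by positivity) fun t => ?_
  have hsub : iteratedFDeriv ℝ l (schwartzTranslate a g - schwartzTranslate b g : 𝓢(E, ℂ)) t =
      iteratedFDeriv ℝ l g (t - a) - iteratedFDeriv ℝ l g (t - b) := by
    rw [← iteratedFDeriv_schwartzTranslate, ← iteratedFDeriv_schwartzTranslate]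
    exact iteratedFDeriv_sub_apply ((schwartzTranslate a g).smooth l).contDiffAt
      ((schwartzTranslate b g).smooth l).contDiffAt
  rw [hsub]
  have hdiff : Differentiable ℝ (iteratedFDeriv ℝ l g) :=
    (g.smooth (l + 1)).differentiable_iteratedFDeriv (m := l)
      (by exact_mod_cast Nat.lt_succ_self l)
  have key := (convex_segment (𝕜 := ℝ) (t - b) (t - a)).norm_image_sub_le_of_norm_hasFDerivWithin_le
    (𝕜 := ℝ) (f := fun s => (‖t‖ ^ k : ℝ) • iteratedFDeriv ℝ l g s)
    (f' := fun s => (‖t‖ ^ k : ℝ) • fderiv ℝ (iteratedFDeriv ℝ l g) s)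
    (C := (1 + ‖a‖ + ‖b‖) ^ k * (2 ^ k * supSeminorm k (l + 1) g))
    (fun s _ => ((hdiff s).hasFDerivAt.const_smul (‖t‖ ^ k : ℝ)).hasFDerivWithinAt)
    (fun s hs => by
      rw [norm_smul, norm_pow, norm_norm, norm_fderiv_iteratedFDeriv]
      obtain ⟨c, d, hc, hd, hcd, rfl⟩ := hs
      set s := c • (t - b) + d • (t - a) with hs
      have h1 : ‖t‖ ≤ (1 + ‖a‖ + ‖b‖) * (1 + ‖s‖) := by
        have ht : t = s + (c • b + d • a) := by
          have h2 : t = (c + d) • t := by rw [hcd, one_smul]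
          rw [hs]
          nth_rewrite 1 [h2]
          module
        have h3 : ‖c • b + d • a‖ ≤ ‖b‖ + ‖a‖ := by
          refine (norm_add_le _ _).trans (add_le_add ?_ ?_) <;>
            rw [norm_smul, Real.norm_of_nonneg (by assumption)] <;>
            exact mul_le_of_le_one_left (norm_nonneg _) (by linarith)
        have h4 : ‖t‖ ≤ ‖s‖ + ‖c • b + d • a‖ := by
          nth_rewrite 1 [ht]
          exact norm_add_le _ _
        nlinarith [norm_nonneg a, norm_nonneg b, norm_nonneg s]
      calc ‖t‖ ^ k * ‖iteratedFDeriv ℝ (l + 1) g s‖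
          ≤ ((1 + ‖a‖ + ‖b‖) * (1 + ‖s‖)) ^ k * ‖iteratedFDeriv ℝ (l + 1) g s‖ := by gcongr
        _ = (1 + ‖a‖ + ‖b‖) ^ k * ((1 + ‖s‖) ^ k * ‖iteratedFDeriv ℝ (l + 1) g s‖) := by
          rw [mul_pow, mul_assoc]
        _ ≤ _ := mul_le_mul_of_nonneg_left (one_add_pow_mul_iteratedFDeriv_le k (l + 1) g s)
          (by positivity))
    (left_mem_segment ℝ _ _) (right_mem_segment ℝ _ _)
  simp only [← smul_sub, norm_smul, norm_pow, norm_norm, sub_sub_sub_cancel_left] at key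
  rwa [norm_sub_rev b a] at key

/-- Joint continuity is needed because a time-frequency shift translates, on the Fourier side, a
function that itself varies with the parameter. -/
theorem continuous_schwartzTranslate :
    Continuous fun p : E × 𝓢(E, ℂ) => schwartzTranslate p.1 p.2 := by
  rw [continuous_iff_continuousAt]
  rintro ⟨a, g⟩
  rw [ContinuousAt, (schwartz_withSeminorms ℂ E ℂ).tendsto_nhds]
  rintro ⟨k, l⟩ ε hε
  have hc : Continuous fun p : E × 𝓢(E, ℂ) =>
      (1 + ‖p.1‖) ^ k * (2 ^ k * supSeminorm k l (p.2 - g)) +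
      (1 + ‖p.1‖ + ‖a‖) ^ k * (2 ^ k * supSeminorm k (l + 1) g) * ‖p.1 - a‖ := by
    have h1 := (continuous_supSeminorm (E := E) k l).comp
      (continuous_snd.sub continuous_const : Continuous fun p : E × 𝓢(E, ℂ) => p.2 - g)
    simp only [Function.comp_def] at h1
    fun_prop
  have h0 := hc.tendsto (a, g)
  simp only [sub_self, map_zero, mul_zero, norm_zero, add_zero] at h0
  filter_upwards [h0.eventually (gt_mem_nhds hε)] with p hp
  refine lt_of_le_of_lt ?_ hp
  have h1 : schwartzTranslate p.1 p.2 - schwartzTranslate a g =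
      schwartzTranslate p.1 (p.2 - g) + (schwartzTranslate p.1 g - schwartzTranslate a g) := by
    ext t
    simp [schwartzTranslate_apply]
  rw [SchwartzMap.schwartzSeminormFamily_apply, h1]
  exact (map_add_le_add _ _ _).trans (add_le_add (seminorm_schwartzTranslate_le k l _ _)
    (seminorm_schwartzTranslate_sub_le k l _ _ _))

/-- The seminorms of the family `F` of Schwartz functions grow at most polynomially. -/
def PolyBounded {Z : Type*} [Norm Z] (F : Z → 𝓢(E, ℂ)) : Prop :=
  ∀ k l, ∃ (C : ℝ) (N : ℕ), 0 ≤ C ∧ ∀ z, SchwartzMap.seminorm ℂ k l (F z) ≤ C * (1 + ‖z‖) ^ N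

theorem PolyBounded.const {Z : Type*} [SeminormedAddCommGroup Z] (g : 𝓢(E, ℂ)) :
    PolyBounded fun _ : Z => g :=
  fun k l => ⟨SchwartzMap.seminorm ℂ k l g, 0, apply_nonneg _ _, fun z => by simp⟩

/-- A continuous seminorm is bounded by finitely many Schwartz seminorms. This makes polynomial
growth stable under continuous linear maps such as the Fourier transform. -/
theorem PolyBounded.seminorm_le {Z : Type*} [SeminormedAddCommGroup Z] {F : Z → 𝓢(E, ℂ)}
    (hF : PolyBounded F) (q : Seminorm ℂ 𝓢(E, ℂ)) (hq : Continuous q) :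
    ∃ (C : ℝ) (N : ℕ), 0 ≤ C ∧ ∀ z, q (F z) ≤ C * (1 + ‖z‖) ^ N := by
  obtain ⟨s, C0, -, h0⟩ := Seminorm.bound_of_continuous (schwartz_withSeminorms ℂ E ℂ) q hq
  choose C N hC hCN using hF
  refine ⟨C0 * ∑ i ∈ s, C i.1 i.2, s.sup fun i => N i.1 i.2,
    mul_nonneg C0.2 (Finset.sum_nonneg fun i _ => hC _ _), fun z => ?_⟩
  refine (h0 (F z)).trans ?_
  change C0 * (s.sup (schwartzSeminormFamily ℂ E ℂ)) (F z) ≤ _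
  rw [mul_assoc, Finset.sum_mul]
  refine mul_le_mul_of_nonneg_left ?_ C0.2
  refine Seminorm.finset_sup_apply_le (Finset.sum_nonneg fun i _ => mul_nonneg (hC _ _)
    (by positivity)) fun i hi => ?_
  refine ((hCN i.1 i.2 z).trans ?_).trans (Finset.single_le_sum
    (f := fun i : ℕ × ℕ => C i.1 i.2 * (1 + ‖z‖) ^ (s.sup fun i => N i.1 i.2))
    (fun i _ => mul_nonneg (hC _ _) (by positivity)) hi)
  exact mul_le_mul_of_nonneg_left (pow_le_pow_right₀ (by linarith [norm_nonneg z])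
    (Finset.le_sup (f := fun i : ℕ × ℕ => N i.1 i.2) hi)) (hC _ _)

theorem PolyBounded.clm_comp {Z : Type*} [SeminormedAddCommGroup Z] {F : Z → 𝓢(E, ℂ)}
    (hF : PolyBounded F) (T : 𝓢(E, ℂ) →L[ℂ] 𝓢(E, ℂ)) : PolyBounded fun z => T (F z) := by
  intro k l
  have hc : Continuous ((SchwartzMap.seminorm ℂ k l).comp (T : 𝓢(E, ℂ) →ₗ[ℂ] 𝓢(E, ℂ))) :=
    (continuous_schwartz_seminorm k l).comp T.continuous
  exact hF.seminorm_le _ hc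

theorem PolyBounded.translate {Z : Type*} [SeminormedAddCommGroup Z] {F : Z → 𝓢(E, ℂ)}
    (hF : PolyBounded F) {a : Z → E} (ha : ∀ z, ‖a z‖ ≤ ‖z‖) :
    PolyBounded fun z => schwartzTranslate (a z) (F z) := by
  intro k l
  obtain ⟨C, N, hC, h⟩ := hF.seminorm_le (supSeminorm k l) (continuous_supSeminorm k l)
  refine ⟨2 ^ k * C, k + N, by positivity, fun z => ?_⟩
  refine (seminorm_schwartzTranslate_le k l (a z) (F z)).trans ?_
  calc (1 + ‖a z‖) ^ k * (2 ^ k * supSeminorm k l (F z))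
      ≤ (1 + ‖z‖) ^ k * (2 ^ k * (C * (1 + ‖z‖) ^ N)) := by
        gcongr
        · exact ha z
        · exact h z
    _ = 2 ^ k * C * (1 + ‖z‖) ^ (k + N) := by rw [pow_add]; ring

end Translate

theorem integrable_one_add_norm_pow_inv {V : Type*} [NormedAddCommGroup V] [NormedSpace ℝ V]
    [FiniteDimensional ℝ V] [MeasurableSpace V] [BorelSpace V] (μ : Measure V)
    [μ.IsAddHaarMeasure] {N : ℕ} (hN : Module.finrank ℝ V < N) :
    Integrable (fun z : V => ((1 + ‖z‖) ^ N)⁻¹) μ := by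
  have h := integrable_one_add_norm (E := V) (μ := μ) (r := N) (by exact_mod_cast hN)
  refine h.congr (.of_forall fun z => ?_)
  simp only
  rw [Real.rpow_neg (by positivity), Real.rpow_natCast]

section TimeFrequency

open scoped FourierTransform

variable {E : Type*} [NormedAddCommGroup E] [InnerProductSpace ℝ E] [FiniteDimensional ℝ E]
  [MeasurableSpace E] [BorelSpace E]

/-- The time-frequency shift `e(y) τ(x) g`. -/
def tfShift (z : E × E) (g : 𝓢(E, ℂ)) : 𝓢(E, ℂ) :=
  schwartzModulate (innerSL ℝ z.2) (schwartzTranslate z.1 g)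

theorem tfShift_apply (z : E × E) (g : 𝓢(E, ℂ)) (t : E) :
    tfShift z g t = cexp (I * (inner ℝ z.2 t : ℝ)) * g (t - z.1) := by
  rw [tfShift, schwartzModulate_apply, schwartzTranslate_apply, innerSL_apply_apply]

theorem norm_tfShift_apply (z : E × E) (g : 𝓢(E, ℂ)) (t : E) :
    ‖tfShift z g t‖ = ‖g (t - z.1)‖ := by
  rw [tfShift_apply, norm_mul, mul_comm I, norm_exp_ofReal_mul_I, one_mul]

theorem fourierInv_schwartzTranslate (a : E) (g : 𝓢(E, ℂ)) :
    𝓕⁻ (schwartzTranslate a g) = schwartzModulate (innerSL ℝ ((2 * Real.pi) • a)) (𝓕⁻ g) := by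
  ext t
  rw [schwartzModulate_apply, SchwartzMap.fourierInv_coe, SchwartzMap.fourierInv_coe,
    Real.fourierInv_eq', Real.fourierInv_eq']
  rw [← integral_add_right_eq_self _ a, ← integral_const_mul]
  refine integral_congr_ae (.of_forall fun v => ?_)
  simp only [schwartzTranslate_apply, add_sub_cancel_right, smul_eq_mul, innerSL_apply_apply]
  rw [← mul_assoc, ← Complex.exp_add]
  congr 2
  rw [inner_add_left, inner_smul_left]
  push_cast
  simp
  ring

/-- This reduces continuity and growth of modulations to those of translations. The factor $2\pi$
reconciles the characters $e^{iy\cdot t}$ with the normalisation $e^{2\pi i w\cdot t}$ of the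
Fourier transform. -/
theorem schwartzModulate_eq_fourier (y : E) (g : 𝓢(E, ℂ)) :
    schwartzModulate (innerSL ℝ y) g = 𝓕⁻ (schwartzTranslate ((2 * Real.pi)⁻¹ • y) (𝓕 g)) := by
  rw [fourierInv_schwartzTranslate, smul_inv_smul₀ (by positivity), FourierTransform.fourierInv_fourier_eq]

theorem tfShift_eq_fourier (z : E × E) (g : 𝓢(E, ℂ)) :
    tfShift z g =
      𝓕⁻ (schwartzTranslate ((2 * Real.pi)⁻¹ • z.2) (𝓕 (schwartzTranslate z.1 g))) :=
  schwartzModulate_eq_fourier _ _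

theorem continuous_tfShift (g : 𝓢(E, ℂ)) : Continuous fun z : E × E => tfShift z g := by
  simp_rw [tfShift_eq_fourier]
  refine (FourierTransform.fourierInvCLM ℂ 𝓢(E, ℂ)).continuous.comp
    (continuous_schwartzTranslate.comp ((by fun_prop : Continuous fun z : E × E =>
      (2 * Real.pi)⁻¹ • z.2).prodMk ?_))
  exact (FourierTransform.fourierCLM ℂ 𝓢(E, ℂ)).continuous.comp
    (continuous_schwartzTranslate.comp (continuous_fst.prodMk continuous_const))

theorem polyBounded_tfShift (g : 𝓢(E, ℂ)) : PolyBounded fun z : E × E => tfShift z g := by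
  simp_rw [tfShift_eq_fourier]
  refine PolyBounded.clm_comp (PolyBounded.translate (PolyBounded.clm_comp
    (PolyBounded.translate (PolyBounded.const g) fun z : E × E => norm_fst_le z)
    (FourierTransform.fourierCLM ℂ 𝓢(E, ℂ))) fun z => ?_) (FourierTransform.fourierInvCLM ℂ 𝓢(E, ℂ))
  rw [norm_smul, norm_inv, Real.norm_of_nonneg (by positivity)]
  refine (mul_le_of_le_one_left (norm_nonneg _) ?_).trans (norm_snd_le z)
  exact inv_le_one_of_one_le₀ (by linarith [Real.pi_gt_three])

theorem norm_fourier_schwartzTranslate (a : E) (g : 𝓢(E, ℂ)) (w : E) :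
    ‖𝓕 (schwartzTranslate a g) w‖ = ‖𝓕 g w‖ := by
  have h : ∀ φ : 𝓢(E, ℂ), 𝓕 φ w = 𝓕⁻ φ (-w) := fun φ => by
    rw [SchwartzMap.fourierInv_coe, SchwartzMap.fourier_coe, Real.fourierInv_eq_fourier_neg,
      neg_neg]
  rw [h, h, fourierInv_schwartzTranslate, schwartzModulate_apply, norm_mul, mul_comm I,
    norm_exp_ofReal_mul_I, one_mul]

theorem norm_fourier_tfShift (z : E × E) (g : 𝓢(E, ℂ)) (w : E) :
    ‖𝓕 (tfShift z g) w‖ = ‖𝓕 g (w - (2 * Real.pi)⁻¹ • z.2)‖ := by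
  rw [tfShift_eq_fourier, FourierTransform.fourier_fourierInv_eq, schwartzTranslate_apply,
    norm_fourier_schwartzTranslate]

theorem integrable_one_add_norm_pow_mul (N : ℕ) (φ : 𝓢(E, ℂ)) :
    Integrable fun t => (1 + ‖t‖) ^ N * ‖φ t‖ := by
  set M := Module.finrank ℝ E + 1
  refine ((integrable_one_add_norm_pow_inv (volume : Measure E) (N := M)
    (Nat.lt_succ_self _)).const_mul (2 ^ (M + N) * supSeminorm (M + N) 0 φ)).mono'
    (by fun_prop) (.of_forall fun t => ?_)
  rw [Real.norm_of_nonneg (by positivity), ← div_eq_mul_inv, le_div_iff₀ (by positivity)]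
  refine le_trans (le_of_eq ?_) (one_add_pow_mul_norm_le (M + N) φ t)
  rw [pow_add]
  ring

/-- The convolution of two Schwartz functions decays rapidly. -/
theorem exists_integral_norm_mul_translate_le (N : ℕ) (φ ψ : 𝓢(E, ℂ)) :
    ∃ C : ℝ, 0 ≤ C ∧ ∀ x : E, (1 + ‖x‖) ^ N * ∫ t, ‖φ t‖ * ‖ψ (t - x)‖ ≤ C := by
  have hi := integrable_one_add_norm_pow_mul N φ
  set D : ℝ := 2 ^ N * supSeminorm N 0 ψ
  have hi0 : 0 ≤ ∫ t, (1 + ‖t‖) ^ N * ‖φ t‖ := integral_nonneg fun t => by positivity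
  refine ⟨(∫ t, (1 + ‖t‖) ^ N * ‖φ t‖) * D, by positivity, fun x => ?_⟩
  rw [← integral_const_mul, ← integral_mul_const]
  refine integral_mono_of_nonneg (.of_forall fun t => by positivity) (hi.mul_const D)
    (.of_forall fun t => ?_)
  have h1 : 1 + ‖x‖ ≤ (1 + ‖t‖) * (1 + ‖t - x‖) := by
    have h := norm_sub_le t (t - x)
    rw [sub_sub_cancel] at h
    nlinarith [norm_nonneg t, norm_nonneg (t - x)]
  calc (1 + ‖x‖) ^ N * (‖φ t‖ * ‖ψ (t - x)‖)
      ≤ ((1 + ‖t‖) * (1 + ‖t - x‖)) ^ N * (‖φ t‖ * ‖ψ (t - x)‖) := by gcongr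
    _ = ((1 + ‖t‖) ^ N * ‖φ t‖) * ((1 + ‖t - x‖) ^ N * ‖ψ (t - x)‖) := by rw [mul_pow]; ring
    _ ≤ _ := mul_le_mul_of_nonneg_left (one_add_pow_mul_norm_le N ψ (t - x)) (by positivity)

/-- The short-time Fourier transform of a Schwartz function. -/
def schwartzStft (g h : 𝓢(E, ℂ)) (z : E × E) : ℂ := ∫ t, h t * (starRingEnd ℂ) (tfShift z g t)

theorem norm_schwartzStft_le (g h : 𝓢(E, ℂ)) (z : E × E) :
    ‖schwartzStft g h z‖ ≤ ∫ t, ‖h t‖ * ‖g (t - z.1)‖ := by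
  refine (norm_integral_le_integral_norm _).trans (le_of_eq ?_)
  simp only [norm_mul, RCLike.norm_conj, norm_tfShift_apply]

/-- By Parseval, modulation becomes translation on the Fourier side. This yields decay in frequency,
as the preceding bound yields decay in position. -/
theorem norm_schwartzStft_le_fourier (g h : 𝓢(E, ℂ)) (z : E × E) :
    ‖schwartzStft g h z‖ ≤ ∫ t, ‖𝓕 h t‖ * ‖𝓕 g (t - (2 * Real.pi)⁻¹ • z.2)‖ := by
  have h1 : schwartzStft g h z = ∫ t, 𝓕 h t * (starRingEnd ℂ) (𝓕 (tfShift z g) t) := by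
    have h2 := SchwartzMap.integral_inner_fourier_fourier (tfShift z g) h
    simp only [RCLike.inner_apply] at h2
    exact h2.symm
  rw [h1]
  refine (norm_integral_le_integral_norm _).trans (le_of_eq ?_)
  simp only [norm_mul, RCLike.norm_conj, norm_fourier_tfShift]

theorem exists_norm_schwartzStft_le (N : ℕ) (g h : 𝓢(E, ℂ)) :
    ∃ C : ℝ, 0 ≤ C ∧ ∀ z, ‖schwartzStft g h z‖ ≤ C * ((1 + ‖z‖) ^ N)⁻¹ := by
  obtain ⟨C1, h1, hC1⟩ := exists_integral_norm_mul_translate_le N h g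
  obtain ⟨C2, h2, hC2⟩ := exists_integral_norm_mul_translate_le N (𝓕 h) (𝓕 g)
  have hpi : 0 < 2 * Real.pi := by positivity
  refine ⟨C1 + (2 * Real.pi) ^ N * C2, by positivity, fun z => ?_⟩
  rw [← div_eq_mul_inv, le_div_iff₀ (by positivity), mul_comm]
  have e1 : (1 + ‖z.1‖) ^ N * ‖schwartzStft g h z‖ ≤ C1 :=
    (mul_le_mul_of_nonneg_left (norm_schwartzStft_le g h z) (by positivity)).trans (hC1 z.1)
  have e2 : (1 + ‖z.2‖) ^ N * ‖schwartzStft g h z‖ ≤ (2 * Real.pi) ^ N * C2 := by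
    have h3 : 1 + ‖z.2‖ ≤ 2 * Real.pi * (1 + ‖(2 * Real.pi)⁻¹ • z.2‖) := by
      rw [norm_smul, norm_inv, Real.norm_of_nonneg hpi.le, mul_add, mul_inv_cancel_left₀ hpi.ne']
      linarith [Real.pi_gt_three]
    calc (1 + ‖z.2‖) ^ N * ‖schwartzStft g h z‖
        ≤ (2 * Real.pi * (1 + ‖(2 * Real.pi)⁻¹ • z.2‖)) ^ N *
          ∫ t, ‖𝓕 h t‖ * ‖𝓕 g (t - (2 * Real.pi)⁻¹ • z.2)‖ := by
          gcongr
          exact norm_schwartzStft_le_fourier g h z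
      _ = (2 * Real.pi) ^ N * ((1 + ‖(2 * Real.pi)⁻¹ • z.2‖) ^ N *
          ∫ t, ‖𝓕 h t‖ * ‖𝓕 g (t - (2 * Real.pi)⁻¹ • z.2)‖) := by rw [mul_pow, mul_assoc]
      _ ≤ _ := mul_le_mul_of_nonneg_left (hC2 _) (by positivity)
  -- The norm on the product is the maximum, so the bound in the larger coordinate suffices.
  rcases le_total ‖z.1‖ ‖z.2‖ with h3 | h3
  · rw [Prod.norm_def, max_eq_right h3]
    linarith
  · rw [Prod.norm_def, max_eq_left h3]
    have : 0 ≤ (2 * Real.pi) ^ N * C2 := by positivity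
    linarith

end TimeFrequency
end

/-! ### Inversion, Moyal identity and change of window for the short-time Fourier transform -/

noncomputable section

set_option maxSynthPendingDepth 3

section Inversion

open scoped FourierTransform

variable {E : Type*} [NormedAddCommGroup E] [InnerProductSpace ℝ E] [FiniteDimensional ℝ E]
  [MeasurableSpace E] [BorelSpace E]

instance isAddHaarMeasure_volume_prod : (volume : Measure (E × E)).IsAddHaarMeasure :=
  inferInstanceAs ((volume : Measure E).prod (volume : Measure E)).IsAddHaarMeasure

theorem stft_eq (f : 𝓢'(E, ℂ)) (g : 𝓢(E, ℂ)) (x y : E) :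
    stft g f x y = f (schwartzConj (tfShift (x, y) g)) := rfl

theorem continuous_schwartzConj : Continuous fun g : 𝓢(E, ℂ) => schwartzConj g :=
  (SchwartzMap.postcompCLM (𝕜 := ℝ) (E := E) Complex.conjCLE.toContinuousLinearMap).continuous

theorem continuous_stft (g : 𝓢(E, ℂ)) (f : 𝓢'(E, ℂ)) :
    Continuous fun z : E × E => stft g f z.1 z.2 :=
  f.continuous.comp (continuous_schwartzConj.comp (continuous_tfShift g))

theorem stft_toTemperedDistribution (g h : 𝓢(E, ℂ)) (z : E × E) :
    stft g (SchwartzMap.toTemperedDistributionCLM E ℂ volume h) z.1 z.2 = schwartzStft g h z := by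
  have h1 : stft g (SchwartzMap.toTemperedDistributionCLM E ℂ volume h) z.1 z.2 =
    SchwartzMap.toTemperedDistributionCLM E ℂ volume h (schwartzConj (tfShift z g)) := rfl
  rw [h1]
  refine (SchwartzMap.toTemperedDistributionCLM_apply_apply volume h
    (schwartzConj (tfShift z g))).trans ?_
  simp only [schwartzStft, schwartzConj_apply, smul_eq_mul, mul_comm]

theorem continuous_schwartzStft (g h : 𝓢(E, ℂ)) : Continuous (schwartzStft g h) := by
  simp_rw [funext fun z => (stft_toTemperedDistribution g h z).symm]
  exact continuous_stft g _

/-- The product of a Schwartz function with the conjugate of a translated one. -/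
def windowedProduct (g h : 𝓢(E, ℂ)) (x : E) : 𝓢(E, ℂ) :=
  SchwartzMap.smulLeftCLM ℂ (schwartzConj (schwartzTranslate x g)) h

theorem windowedProduct_apply (g h : 𝓢(E, ℂ)) (x t : E) :
    windowedProduct g h x t = (starRingEnd ℂ) (g (t - x)) * h t := by
  rw [windowedProduct, SchwartzMap.smulLeftCLM_apply_apply (SchwartzMap.hasTemperateGrowth _),
    schwartzConj_apply, schwartzTranslate_apply, smul_eq_mul]

theorem schwartzStft_eq_fourier (g h : 𝓢(E, ℂ)) (x y : E) :
    schwartzStft g h (x, y) = 𝓕 (windowedProduct g h x) ((2 * Real.pi)⁻¹ • y) := by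
  rw [SchwartzMap.fourier_coe, Real.fourier_eq', schwartzStft]
  refine integral_congr_ae (.of_forall fun t => ?_)
  simp only [tfShift_apply, windowedProduct_apply, map_mul, ← Complex.exp_conj, smul_eq_mul,
    Complex.conj_I, Complex.conj_ofReal]
  rw [mul_comm (h t), mul_assoc]
  congr 2
  rw [inner_smul_right, real_inner_comm]
  push_cast
  have : (Real.pi : ℂ) ≠ 0 := by exact_mod_cast Real.pi_ne_zero
  field_simp

/-- Fourier inversion after rescaling the frequency by $2\pi$, whose Jacobian is the factor
$(2\pi)^d$. -/
theorem integral_fourier_smul_exp (φ : 𝓢(E, ℂ)) (t : E) :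
    ∫ y : E, 𝓕 φ ((2 * Real.pi)⁻¹ • y) * cexp (I * (inner ℝ y t : ℝ)) =
      ((2 * Real.pi) ^ Module.finrank ℝ E : ℝ) * φ t := by
  have h1 := Measure.integral_comp_inv_smul (volume : Measure E)
    (fun w => 𝓕 φ w * cexp (I * (2 * Real.pi * inner ℝ w t : ℝ))) (2 * Real.pi)
  have h2 : ∫ w, 𝓕 φ w * cexp (I * (2 * Real.pi * inner ℝ w t : ℝ)) = φ t := by
    have h3 : 𝓕⁻ (𝓕 φ) t = φ t := by rw [FourierTransform.fourierInv_fourier_eq]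
    rw [SchwartzMap.fourierInv_coe, Real.fourierInv_eq'] at h3
    rw [← h3]
    refine integral_congr_ae (.of_forall fun w => ?_)
    simp only [smul_eq_mul]
    rw [mul_comm, mul_comm I]
  rw [h2, abs_of_pos (by positivity), Complex.real_smul] at h1
  rw [← h1]
  refine integral_congr_ae (.of_forall fun y => ?_)
  simp only
  rw [inner_smul_left, RCLike.conj_to_real, mul_inv_cancel_left₀ (by positivity)]

theorem integrable_schwartzStft_mul (g h : 𝓢(E, ℂ)) (t : E) :
    Integrable fun z : E × E => schwartzStft g h z * tfShift z g t := by
  obtain ⟨C, hC, h1⟩ := exists_norm_schwartzStft_le (Module.finrank ℝ (E × E) + 1) g h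
  refine (((integrable_one_add_norm_pow_inv (volume : Measure (E × E))
    (Nat.lt_succ_self _)).const_mul C).mul_const (SchwartzMap.seminorm ℂ 0 0 g)).mono' ?_
      (.of_forall fun z => ?_)
  · exact ((continuous_schwartzStft g h).mul
      ((continuous_schwartz_apply t).comp (continuous_tfShift g))).aestronglyMeasurable
  · rw [norm_mul, norm_tfShift_apply]
    exact mul_le_mul (h1 z) (SchwartzMap.norm_le_seminorm ℂ g _) (norm_nonneg _) (by positivity)

/-- The constant `(2π)^d ‖g‖²` of the inversion formula. -/
def stftConst (g : 𝓢(E, ℂ)) : ℝ := (2 * Real.pi) ^ Module.finrank ℝ E * ∫ t, ‖g t‖ ^ 2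

theorem integrable_norm_sq (g : 𝓢(E, ℂ)) : Integrable fun t => ‖g t‖ ^ 2 :=
  (g.memLp 2).integrable_norm_pow two_ne_zero

theorem integral_norm_sq_pos {g : 𝓢(E, ℂ)} (hg : g ≠ 0) : 0 < ∫ t, ‖g t‖ ^ 2 := by
  have hc : Continuous fun t => ‖g t‖ ^ 2 := g.continuous.norm.pow 2
  rw [integral_pos_iff_support_of_nonneg (fun t => by positivity) (integrable_norm_sq g)]
  refine hc.isOpen_support.measure_pos volume ?_
  by_contra h
  refine hg (DFunLike.ext _ _ fun t => ?_)
  by_contra h1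
  exact h ⟨t, by simpa using h1⟩

theorem stftConst_pos {g : 𝓢(E, ℂ)} (hg : g ≠ 0) : 0 < stftConst g :=
  mul_pos (by positivity) (integral_norm_sq_pos hg)

/-- For fixed `x`, Fourier inversion of the windowed product turns the integral over `y` into
$(2\pi)^d\,h(t)\,|g(t-x)|^2$. Integrating over `x` produces $\|g\|_2^2$. -/
theorem schwartzStft_inversion (g h : 𝓢(E, ℂ)) (t : E) :
    ∫ z, schwartzStft g h z * tfShift z g t = stftConst g * h t := by
  have h0 : (volume : Measure (E × E)) = volume.prod volume := rfl
  rw [h0, integral_prod _ (integrable_schwartzStft_mul g h t)]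
  have h1 : ∀ x : E, ∫ y, schwartzStft g h (x, y) * tfShift (x, y) g t =
      ((2 * Real.pi) ^ Module.finrank ℝ E : ℝ) * h t * (‖g (t - x)‖ ^ 2 : ℝ) := by
    intro x
    simp_rw [schwartzStft_eq_fourier, tfShift_apply, ← mul_assoc]
    rw [integral_mul_const, integral_fourier_smul_exp, windowedProduct_apply]
    rw [Complex.ofReal_pow ‖g (t - x)‖ 2, ← Complex.conj_mul']
    ring
  simp_rw [h1]
  rw [integral_const_mul, integral_complex_ofReal]
  have h2 : ∫ x, ‖g (t - x)‖ ^ 2 = ∫ x, ‖g x‖ ^ 2 :=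
    integral_sub_left_eq_self (fun x => ‖g x‖ ^ 2) volume t
  rw [h2, stftConst]
  push_cast
  ring

theorem seminorm_schwartzConj_le (k l : ℕ) (φ : 𝓢(E, ℂ)) :
    SchwartzMap.seminorm ℂ k l (schwartzConj φ) ≤ SchwartzMap.seminorm ℂ k l φ := by
  refine SchwartzMap.seminorm_le_bound ℂ k l _ (apply_nonneg _ _) fun t => ?_
  have h : ‖iteratedFDeriv ℝ l (schwartzConj φ) t‖ = ‖iteratedFDeriv ℝ l φ t‖ :=
    Complex.conjLIE.norm_iteratedFDeriv_comp_left (f := φ) t l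
  rw [h]
  exact SchwartzMap.le_seminorm ℂ k l φ t

/-- Tempered distributions can be recovered from their short-time Fourier transforms. -/
theorem stft_inversion (f : 𝓢'(E, ℂ)) (g φ : 𝓢(E, ℂ)) :
    Integrable (fun z : E × E => (starRingEnd ℂ) (schwartzStft g φ z) * stft g f z.1 z.2) ∧
    stftConst g * f (schwartzConj φ) =
      ∫ z : E × E, (starRingEnd ℂ) (schwartzStft g φ z) * stft g f z.1 z.2 := by
  set Φ : E × E → 𝓢(E, ℂ) := fun z =>
    (starRingEnd ℂ) (schwartzStft g φ z) • schwartzConj (tfShift z g) with hΦ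
  have hcont : Continuous Φ :=
    (Complex.continuous_conj.comp (continuous_schwartzStft g φ)).smul
      (continuous_schwartzConj.comp (continuous_tfShift g))
  have hint : ∀ k l, Integrable fun z => SchwartzMap.seminorm ℂ k l (Φ z) := by
    intro k l
    obtain ⟨C, N, hC, h1⟩ := polyBounded_tfShift g k l
    -- The seminorms of the shifted windows grow with exponent `N`. The extra decay cancels this
    -- growth and leaves an integrable power.
    obtain ⟨D, hD, h2⟩ := exists_norm_schwartzStft_le (Module.finrank ℝ (E × E) + 1 + N) g φ
    refine ((integrable_one_add_norm_pow_inv (volume : Measure (E × E))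
      (Nat.lt_succ_self _)).const_mul (D * C)).mono'
        ((continuous_schwartz_seminorm k l).comp hcont).aestronglyMeasurable
        (.of_forall fun z => ?_)
    rw [Real.norm_of_nonneg (apply_nonneg _ _), hΦ, map_smul_eq_mul, RCLike.norm_conj]
    calc ‖schwartzStft g φ z‖ * SchwartzMap.seminorm ℂ k l (schwartzConj (tfShift z g))
        ≤ (D * ((1 + ‖z‖) ^ (Module.finrank ℝ (E × E) + 1 + N))⁻¹) * (C * (1 + ‖z‖) ^ N) :=
          mul_le_mul (h2 z) ((seminorm_schwartzConj_le k l _).trans (h1 z)) (apply_nonneg _ _)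
            (by positivity)
      _ = D * C * ((1 + ‖z‖) ^ (Module.finrank ℝ (E × E) + 1))⁻¹ := by
          rw [pow_add]
          have : (1 + ‖z‖) ^ N ≠ 0 := by positivity
          field_simp
  obtain ⟨Ψ, hΨ, hf⟩ := exists_schwartz_integral hcont hint
  have hΨ' : Ψ = (stftConst g : ℂ) • schwartzConj φ := by
    ext t
    rw [hΨ, smul_apply, schwartzConj_apply, smul_eq_mul,
      ← Complex.conj_ofReal (stftConst g), ← map_mul, ← schwartzStft_inversion, ← integral_conj]
    simp only [hΦ, smul_apply, schwartzConj_apply, smul_eq_mul, map_mul]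
  have h1 : ∀ z, f (Φ z) = (starRingEnd ℂ) (schwartzStft g φ z) * stft g f z.1 z.2 := fun z => by
    rw [hΦ, map_smul, smul_eq_mul]
    rfl
  obtain ⟨h2, h3⟩ := hf f
  simp_rw [h1] at h2 h3
  refine ⟨h2, ?_⟩
  rw [← h3, hΨ', map_smul, smul_eq_mul]

/-- Moyal's identity: the inversion formula for the distribution given by `φ` itself, tested against
the conjugate of `φ`. -/
theorem integral_norm_sq_schwartzStft (g φ : 𝓢(E, ℂ)) :
    Integrable (fun z => ‖schwartzStft g φ z‖ ^ 2) ∧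
      ∫ z, ‖schwartzStft g φ z‖ ^ 2 = stftConst g * ∫ t, ‖φ t‖ ^ 2 := by
  obtain ⟨h1, h2⟩ := stft_inversion (SchwartzMap.toTemperedDistributionCLM E ℂ volume φ) g φ
  simp_rw [stft_toTemperedDistribution, Complex.conj_mul', ← Complex.ofReal_pow] at h1 h2
  refine ⟨by simpa only [RCLike.re_eq_complex_re, Complex.ofReal_re] using h1.re, ?_⟩
  have h3 : (SchwartzMap.toTemperedDistributionCLM E ℂ volume φ) (schwartzConj φ) =
      ((∫ t, ‖φ t‖ ^ 2 : ℝ) : ℂ) := by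
    refine (SchwartzMap.toTemperedDistributionCLM_apply_apply volume φ (schwartzConj φ)).trans ?_
    simp_rw [schwartzConj_apply, smul_eq_mul, Complex.conj_mul', ← Complex.ofReal_pow]
    exact integral_complex_ofReal
  rw [h3, integral_complex_ofReal] at h2
  exact_mod_cast h2.symm

/-- Composing two time-frequency shifts gives another one up to a phase, which the norm forgets. -/
theorem norm_schwartzStft_tfShift (g h : 𝓢(E, ℂ)) (w z : E × E) :
    ‖schwartzStft g (tfShift w h) z‖ = ‖schwartzStft g h (z - w)‖ := by
  have h1 : schwartzStft g (tfShift w h) z =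
      cexp (((inner ℝ (w.2 - z.2) w.1 : ℝ) : ℂ) * I) * schwartzStft g h (z - w) := by
    rw [schwartzStft, schwartzStft, ← integral_const_mul,
      ← integral_add_right_eq_self _ w.1]
    refine integral_congr_ae (.of_forall fun t => ?_)
    simp only [tfShift_apply, map_mul, ← Complex.exp_conj, Complex.conj_I, Complex.conj_ofReal,
      add_sub_cancel_right, Prod.fst_sub, Prod.snd_sub]
    have h2 : t + w.1 - z.1 = t - (z.1 - w.1) := by abel
    rw [h2]
    have h3 : ∀ a b c d e x y : ℂ, a * c = d * e → a * x * (c * y) = d * (x * (e * y)) := by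
      intro a b c d e x y h
      linear_combination x * y * h
    refine h3 _ 0 _ _ _ _ _ ?_
    rw [← Complex.exp_add, ← Complex.exp_add]
    congr 1
    simp only [inner_add_right, inner_sub_left]
    push_cast
    ring
  rw [h1, norm_mul, norm_exp_ofReal_mul_I, one_mul]

/-- The kernel `(1 + ‖z‖) ^ (-N)`. -/
def decayKernel {V : Type*} [Norm V] (N : ℕ) (z : V) : ℝ≥0∞ := ENNReal.ofReal ((1 + ‖z‖) ^ N)⁻¹

/-- The short-time Fourier transforms with two windows are related by a convolution. -/
theorem exists_enorm_stft_le (N : ℕ) {g : 𝓢(E, ℂ)} (hg : g ≠ 0) (h : 𝓢(E, ℂ)) :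
    ∃ C : NNReal, ∀ (f : 𝓢'(E, ℂ)) (w : E × E), ‖stft h f w.1 w.2‖ₑ ≤
      C * ∫⁻ z : E × E, ‖stft g f z.1 z.2‖ₑ * decayKernel N (w - z) := by
  obtain ⟨D, hD, h1⟩ := exists_norm_schwartzStft_le N g h
  have hc := stftConst_pos hg
  refine ⟨(D / stftConst g).toNNReal, fun f w => ?_⟩
  -- The test function is the shifted window `tfShift w h`: pairing with it gives the transform of
  -- `f` with window `h` at `w`, and by covariance its own transform decays away from `w`.
  have h2 := (stft_inversion f g (tfShift w h)).2
  have h3 : stft h f w.1 w.2 = ((stftConst g)⁻¹ : ℝ) *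
      ∫ z : E × E, (starRingEnd ℂ) (schwartzStft g (tfShift w h) z) * stft g f z.1 z.2 := by
    rw [← h2, stft_eq, ← mul_assoc, ← Complex.ofReal_mul, inv_mul_cancel₀ hc.ne',
      Complex.ofReal_one, one_mul]
  rw [h3, enorm_mul]
  have h4 : ∀ z : E × E,
      ‖(starRingEnd ℂ) (schwartzStft g (tfShift w h) z) * stft g f z.1 z.2‖ₑ ≤
        ENNReal.ofReal D * (‖stft g f z.1 z.2‖ₑ * decayKernel N (w - z)) := by
    intro z
    rw [enorm_mul, mul_comm, mul_left_comm]
    gcongr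
    rw [decayKernel, ← ENNReal.ofReal_mul hD, ← ofReal_norm, RCLike.norm_conj,
      norm_schwartzStft_tfShift, norm_sub_rev w z]
    exact ENNReal.ofReal_le_ofReal (h1 _)
  calc ‖(((stftConst g)⁻¹ : ℝ) : ℂ)‖ₑ *
      ‖∫ z : E × E, (starRingEnd ℂ) (schwartzStft g (tfShift w h) z) * stft g f z.1 z.2‖ₑ
      ≤ ENNReal.ofReal (stftConst g)⁻¹ *
        (ENNReal.ofReal D * ∫⁻ z : E × E, ‖stft g f z.1 z.2‖ₑ * decayKernel N (w - z)) := by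
        gcongr
        · rw [← ofReal_norm, Complex.norm_real, Real.norm_of_nonneg (by positivity)]
        · rw [← lintegral_const_mul' _ _ ENNReal.ofReal_ne_top]
          exact (enorm_integral_le_lintegral_enorm _).trans (lintegral_mono h4)
    _ = _ := by
        rw [← mul_assoc, ← ENNReal.ofReal_mul (by positivity), ← div_eq_inv_mul]
        rfl

end Inversion
end

noncomputable section

set_option maxSynthPendingDepth 3

/-! ### Functions dominated by a convolution with a decaying kernel -/

section Dominated

/-- Hölder's inequality between $L^1$ and $L^r$ for the measure with density `k`; the total mass of
this measure enters with the power `r - 1`. -/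
theorem rpow_lintegral_mul_le {α : Type*} [MeasurableSpace α] {μ : Measure α} {r : ℝ} (hr : 1 ≤ r)
    {H k : α → ℝ≥0∞} (hH : Measurable H) (hk : Measurable k) :
    (∫⁻ a, H a * k a ∂μ) ^ r ≤ (∫⁻ a, k a ∂μ) ^ (r - 1) * ∫⁻ a, H a ^ r * k a ∂μ := by
  have hr0 : 0 < r := by linarith
  have h := eLpNorm'_le_eLpNorm'_mul_rpow_measure_univ (f := H) (μ := μ.withDensity k) zero_lt_one hr
    hH.aestronglyMeasurable
  simp only [eLpNorm', enorm_eq_self, ENNReal.rpow_one, div_one, withDensity_apply _ .univ,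
    Measure.restrict_univ] at h
  rw [lintegral_withDensity_eq_lintegral_mul _ hk hH,
    lintegral_withDensity_eq_lintegral_mul _ hk (hH.pow_const r)] at h
  simp only [Pi.mul_apply, mul_comm (k _)] at h
  refine (ENNReal.rpow_le_rpow h hr0.le).trans (le_of_eq ?_)
  rw [ENNReal.mul_rpow_of_nonneg _ _ hr0.le, ← ENNReal.rpow_mul, ← ENNReal.rpow_mul,
    one_div_mul_cancel hr0.ne', ENNReal.rpow_one, mul_comm]
  congr 2
  field_simp

theorem measurable_decayKernel {V : Type*} [NormedAddCommGroup V] [MeasurableSpace V]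
    [BorelSpace V] (N : ℕ) : Measurable (decayKernel N : V → ℝ≥0∞) := by
  unfold decayKernel
  exact (by fun_prop : Measurable fun z : V => ((1 + ‖z‖) ^ N)⁻¹).ennreal_ofReal

theorem decayKernel_le_one {V : Type*} [NormedAddCommGroup V] (N : ℕ) (z : V) :
    decayKernel N z ≤ 1 := by
  rw [decayKernel, ← ENNReal.ofReal_one]
  refine ENNReal.ofReal_le_ofReal (inv_le_one_of_one_le₀ (one_le_pow₀ ?_))
  linarith [norm_nonneg z]

/-- Forgetting the second coordinate gives bounds that are uniform in it, which the mixed norm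
estimate needs. -/
theorem decayKernel_prod_le {V W : Type*} [NormedAddCommGroup V] [NormedAddCommGroup W] (N : ℕ)
    (z : V × W) : decayKernel N z ≤ decayKernel N z.1 := by
  refine ENNReal.ofReal_le_ofReal (inv_anti₀ (by positivity) ?_)
  gcongr
  exact norm_fst_le z

theorem lintegral_decayKernel_lt_top {V : Type*} [NormedAddCommGroup V] [NormedSpace ℝ V]
    [FiniteDimensional ℝ V] [MeasurableSpace V] [BorelSpace V] (μ : Measure V)
    [μ.IsAddHaarMeasure] {N : ℕ} (hN : Module.finrank ℝ V < N) :
    ∫⁻ z, decayKernel N z ∂μ < ∞ := by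
  have h := (integrable_one_add_norm_pow_inv μ hN).hasFiniteIntegral
  rw [hasFiniteIntegral_iff_ofReal (.of_forall fun z => by positivity)] at h
  exact h

variable {V : Type*} [NormedAddCommGroup V] [NormedSpace ℝ V] [FiniteDimensional ℝ V]
  [MeasurableSpace V] [BorelSpace V] {μ : Measure V} [μ.IsAddHaarMeasure]

theorem lintegral_lintegral_mul_decayKernel {N : ℕ} {m : V → ℝ≥0∞} (hm : Measurable m) :
    ∫⁻ x, ∫⁻ z, m z * decayKernel N (x - z) ∂μ ∂μ =
      (∫⁻ z, decayKernel N z ∂μ) * ∫⁻ z, m z ∂μ := by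
  have hq : Measurable fun q : V × V => m q.2 * decayKernel N (q.1 - q.2) :=
    (hm.comp measurable_snd).mul
      ((measurable_decayKernel N).comp (measurable_fst.sub measurable_snd))
  rw [lintegral_lintegral_swap (f := fun x z => m z * decayKernel N (x - z)) hq.aemeasurable,
    ← lintegral_const_mul _ hm]
  refine lintegral_congr fun z => ?_
  rw [lintegral_const_mul _
    (by exact (measurable_decayKernel N).comp (measurable_id.sub measurable_const)), mul_comm]
  congr 1
  exact lintegral_sub_right_eq_self (μ := μ) (decayKernel N) z

theorem measurable_lintegral_mul_decayKernel {N : ℕ} {m : V → ℝ≥0∞} (hm : Measurable m) :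
    Measurable fun x => ∫⁻ z, m z * decayKernel N (x - z) ∂μ :=
  Measurable.lintegral_prod_right' (f := fun q : V × V => m q.2 * decayKernel N (q.1 - q.2))
    ((hm.comp measurable_snd).mul
      ((measurable_decayKernel N).comp (measurable_fst.sub measurable_snd)))

/-- `H` is bounded by a convolution of `G` with a multiple of the kernel `(1 + ‖z‖) ^ (-N)`. -/
def DecayDominated (μ : Measure V) (N : ℕ) (C : NNReal) (H G : V → ℝ≥0∞) : Prop :=
  ∀ w, H w ≤ C * ∫⁻ z, G z * decayKernel N (w - z) ∂μ

theorem DecayDominated.rpow_le {N : ℕ} {C : NNReal} {H G : V → ℝ≥0∞}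
    (h : DecayDominated μ N C H G) (hG : Measurable G) {r : ℝ} (hr : 1 ≤ r) (w : V) :
    H w ^ r ≤ C ^ r * (∫⁻ z, decayKernel N z ∂μ) ^ (r - 1) *
      ∫⁻ z, G z ^ r * decayKernel N (w - z) ∂μ := by
  have hr0 : 0 ≤ r := by linarith
  refine (ENNReal.rpow_le_rpow (h w) hr0).trans ?_
  rw [ENNReal.mul_rpow_of_nonneg _ _ hr0, mul_assoc]
  gcongr
  refine (rpow_lintegral_mul_le hr hG
    ((measurable_decayKernel N).comp (measurable_const.sub measurable_id))).trans (le_of_eq ?_)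
  congr 2
  exact lintegral_sub_left_eq_self (μ := μ) (decayKernel N) w

theorem DecayDominated.lintegral_rpow_le {N : ℕ} {C : NNReal} {H G : V → ℝ≥0∞}
    (h : DecayDominated μ N C H G) (hG : Measurable G) {r : ℝ} (hr : 1 ≤ r) :
    ∫⁻ w, H w ^ r ∂μ ≤ C ^ r * (∫⁻ z, decayKernel N z ∂μ) ^ (r - 1) *
      (∫⁻ z, decayKernel N z ∂μ) * ∫⁻ z, G z ^ r ∂μ := by
  refine (lintegral_mono fun w => h.rpow_le hG hr w).trans (le_of_eq ?_)
  rw [lintegral_const_mul _ (measurable_lintegral_mul_decayKernel (hG.pow_const r)),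
    lintegral_lintegral_mul_decayKernel (hG.pow_const r), mul_assoc (C ^ r * _ : ℝ≥0∞)]

/-- Interpolation with the supremum: $H^2=(H^r)^{(2-r)/r}H^r$, where the first exponent is
nonnegative because $r\le2$. -/
theorem lintegral_sq_le_of_rpow_le {α : Type*} [MeasurableSpace α] {μ : Measure α} {r : ℝ}
    (hr : 1 ≤ r) (hr2 : r ≤ 2) {H : α → ℝ≥0∞} (hH : Measurable H) {S : ℝ≥0∞}
    (hS : ∀ a, H a ^ r ≤ S) :
    ∫⁻ a, H a ^ 2 ∂μ ≤ S ^ ((2 - r) / r) * ∫⁻ a, H a ^ r ∂μ := by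
  rw [← lintegral_const_mul _ (hH.pow_const r)]
  refine lintegral_mono fun a => ?_
  have hr0 : 0 < r := by linarith
  calc H a ^ 2 = (H a ^ r) ^ ((2 - r) / r) * H a ^ r := by
        rw [← ENNReal.rpow_mul, ← ENNReal.rpow_add_of_nonneg _ _ (by
          rw [mul_div_cancel₀ _ hr0.ne']; linarith) hr0.le, mul_div_cancel₀ _ hr0.ne',
          sub_add_cancel]
        norm_cast
    _ ≤ _ := by
        have he : 0 ≤ (2 - r) / r := div_nonneg (by linarith) hr0.le
        gcongr
        exact hS a

/-- The embedding of the dominated `L^r` functions into `L^2`. -/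
theorem DecayDominated.lintegral_sq_le {N : ℕ} {C : NNReal} {H : V → ℝ≥0∞}
    (h : DecayDominated μ N C H H) (hH : Measurable H) {r : ℝ} (hr : 1 ≤ r) (hr2 : r ≤ 2) :
    ∫⁻ w, H w ^ 2 ∂μ ≤ (C ^ r * (∫⁻ z, decayKernel N z ∂μ) ^ (r - 1)) ^ ((2 - r) / r) *
      (∫⁻ z, H z ^ r ∂μ) ^ (2 / r) := by
  have hr0 : 0 < r := by linarith
  have he : 0 ≤ (2 - r) / r := div_nonneg (by linarith) hr0.le
  refine (lintegral_sq_le_of_rpow_le (S := C ^ r * (∫⁻ z, decayKernel N z ∂μ) ^ (r - 1) *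
    ∫⁻ z, H z ^ r ∂μ) hr hr2 hH fun w => (h.rpow_le hH hr w).trans ?_).trans (le_of_eq ?_)
  -- Dropping the kernel, which is at most `1`, leaves a bound on `H ^ r` that is independent of the
  -- point.
  · gcongr with z
    exact mul_le_of_le_one_right' (decayKernel_le_one N _)
  · rw [ENNReal.mul_rpow_of_nonneg _ _ he, mul_assoc]
    congr 1
    nth_rewrite 2 [← ENNReal.rpow_one (∫⁻ z, H z ^ r ∂μ)]
    rw [← ENNReal.rpow_add_of_nonneg _ _ he zero_le_one]
    congr 1
    field_simp
    ring

end Dominated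

section Mixed

variable {V W : Type*} [NormedAddCommGroup V] [NormedSpace ℝ V] [FiniteDimensional ℝ V]
  [MeasurableSpace V] [BorelSpace V] {μ : Measure V} [μ.IsAddHaarMeasure]
  [NormedAddCommGroup W] [NormedSpace ℝ W] [FiniteDimensional ℝ W]
  [MeasurableSpace W] [BorelSpace W] {ν : Measure W} [ν.IsAddHaarMeasure]

/-- The embedding of the dominated `L^r` functions into the mixed space `L^r(L^2)`. -/
theorem DecayDominated.lintegral_mixed_le {N : ℕ} {C : NNReal} {H : V × W → ℝ≥0∞}
    (h : DecayDominated (μ.prod ν) N C H H) (hH : Measurable H) {r : ℝ} (hr : 1 ≤ r)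
    (hr2 : r ≤ 2) :
    ∫⁻ x, (∫⁻ y, H (x, y) ^ 2 ∂ν) ^ (r / 2) ∂μ ≤
      (C ^ r * (∫⁻ z, decayKernel N z ∂(μ.prod ν)) ^ (r - 1) * (∫⁻ x, decayKernel N x ∂μ) + 1) *
        ∫⁻ z, H z ^ r ∂(μ.prod ν) := by
  have hr0 : 0 < r := by linarith
  set K : ℝ≥0∞ := C ^ r * (∫⁻ z, decayKernel N z ∂(μ.prod ν)) ^ (r - 1)
  set m : V → ℝ≥0∞ := fun x => ∫⁻ y, H (x, y) ^ r ∂ν with hm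
  have hmm : Measurable m := (hH.pow_const r).lintegral_prod_right'
  -- `s x` will bound `H (x, y) ^ r` uniformly in `y`, while its integral stays a multiple of the
  -- integral of `H ^ r`.
  set s : V → ℝ≥0∞ := fun x => K * ∫⁻ x', m x' * decayKernel N (x - x') ∂μ with hs
  have hHr := hH.pow_const r
  have htot : ∫⁻ x, m x ∂μ = ∫⁻ z, H z ^ r ∂(μ.prod ν) := (lintegral_prod _ hHr.aemeasurable).symm
  have hsup : ∀ x y, H (x, y) ^ r ≤ s x := by
    intro x y
    refine (h.rpow_le hH hr (x, y)).trans ?_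
    refine mul_le_mul_right ?_ K
    calc ∫⁻ z, H z ^ r * decayKernel N ((x, y) - z) ∂(μ.prod ν)
        ≤ ∫⁻ z, H z ^ r * decayKernel N (x - z.1) ∂(μ.prod ν) := by
          gcongr with z
          exact decayKernel_prod_le N _
      _ = ∫⁻ x', ∫⁻ y', H (x', y') ^ r * decayKernel N (x - x') ∂ν ∂μ :=
          lintegral_prod _ (hHr.mul ((measurable_decayKernel N).comp
            (measurable_const.sub measurable_fst))).aemeasurable
      _ = _ := by
          refine lintegral_congr fun x' => ?_
          exact lintegral_mul_const _ (hHr.comp measurable_prodMk_left)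
  have hsm : Measurable s := (measurable_lintegral_mul_decayKernel hmm).const_mul K
  have hstot : ∫⁻ x, s x ∂μ = K * (∫⁻ x, decayKernel N x ∂μ) * ∫⁻ x, m x ∂μ := by
    rw [hs, lintegral_const_mul _ (measurable_lintegral_mul_decayKernel hmm),
      lintegral_lintegral_mul_decayKernel hmm, ← mul_assoc]
  calc ∫⁻ x, (∫⁻ y, H (x, y) ^ 2 ∂ν) ^ (r / 2) ∂μ ≤ ∫⁻ x, (s x + m x) ∂μ := by
        refine lintegral_mono fun x => ?_
        have h1 : ∫⁻ y, H (x, y) ^ 2 ∂ν ≤ s x ^ ((2 - r) / r) * m x :=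
          lintegral_sq_le_of_rpow_le hr hr2 (hH.comp measurable_prodMk_left) (hsup x)
        -- Bounding both factors by `s x + m x` makes the total exponent `2 / r`, so the power `r /
        -- 2` becomes linear. The summand `m` is the source of the `+ 1` in the constant.
        have h2 : s x ^ ((2 - r) / r) * m x ≤ (s x + m x) ^ (2 / r) := by
          calc s x ^ ((2 - r) / r) * m x
              ≤ (s x + m x) ^ ((2 - r) / r) * (s x + m x) ^ (1 : ℝ) := by
                rw [ENNReal.rpow_one]
                have he : 0 ≤ (2 - r) / r := div_nonneg (by linarith) hr0.le
                gcongr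
                · exact le_self_add
                · exact le_add_self
            _ = _ := by
                rw [← ENNReal.rpow_add_of_nonneg _ _ (div_nonneg (by linarith) hr0.le) zero_le_one]
                congr 1
                field_simp
                ring
        refine (ENNReal.rpow_le_rpow (h1.trans h2) (by positivity)).trans (le_of_eq ?_)
        rw [← ENNReal.rpow_mul]
        have : 2 / r * (r / 2) = 1 := by field_simp
        rw [this, ENNReal.rpow_one]
    _ = _ := by
        rw [lintegral_add_left hsm, hstot, htot, add_mul, one_mul]

end Mixed

section LinearChange

variable {V : Type*} [NormedAddCommGroup V] [NormedSpace ℝ V] [FiniteDimensional ℝ V]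
  [MeasurableSpace V] [BorelSpace V] (μ : Measure V) [μ.IsAddHaarMeasure]

/-- Uniqueness of Haar measure. No measurability of `F` is needed, since `L` is a homeomorphism and
the image measure is a multiple of `μ`. -/
theorem exists_lintegral_comp_linearEquiv (L : V ≃L[ℝ] V) :
    ∃ c : NNReal, 0 < c ∧ ∀ F : V → ℝ≥0∞, ∫⁻ z, F (L z) ∂μ = c * ∫⁻ z, F z ∂μ := by
  have : (μ.map L).IsAddHaarMeasure := L.isAddHaarMeasure_map μ
  refine ⟨Measure.addHaarScalarFactor (μ.map L) μ,
    Measure.addHaarScalarFactor_pos_of_isAddHaarMeasure _ _, fun F => ?_⟩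
  have h1 : ∫⁻ z, F (L z) ∂μ = ∫⁻ z, F z ∂(μ.map L) :=
    (lintegral_map_equiv F L.toHomeomorph.toMeasurableEquiv).symm
  rw [h1]
  conv_lhs => rw [Measure.isAddLeftInvariant_eq_smul (μ.map L) μ, lintegral_smul_measure]
  rfl

theorem exists_decayKernel_comp_le (N : ℕ) (L : V ≃L[ℝ] V) :
    ∃ M : NNReal, ∀ z, decayKernel N (L z) ≤ M * decayKernel N z := by
  set M : ℝ := 1 + ‖(L.symm : V →L[ℝ] V)‖ with hM
  refine ⟨(M ^ N).toNNReal, fun z => ?_⟩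
  have hM0 : 0 < M := by positivity
  change decayKernel N (L z) ≤ ENNReal.ofReal (M ^ N) * _
  rw [decayKernel, decayKernel, ← ENNReal.ofReal_mul (by positivity)]
  refine ENNReal.ofReal_le_ofReal ?_
  rw [← div_eq_mul_inv, inv_eq_one_div, div_le_div_iff₀ (by positivity) (by positivity), one_mul,
    ← mul_pow]
  gcongr
  have h := (L.symm : V →L[ℝ] V).le_opNorm (L z)
  simp only [ContinuousLinearEquiv.coe_coe, ContinuousLinearEquiv.symm_apply_apply] at h
  nlinarith [norm_nonneg (L z), norm_nonneg (L.symm : V →L[ℝ] V)]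

variable {μ}

/-- Domination survives a linear change of variables because `L` distorts norms by bounded factors.
This transports the mixed norm estimate to the coordinates of `twistedStft`. -/
theorem exists_decayDominated_comp (N : ℕ) (C : NNReal) (L : V ≃L[ℝ] V) :
    ∃ C' : NNReal, ∀ H G : V → ℝ≥0∞, DecayDominated μ N C H G →
      DecayDominated μ N C' (H ∘ L) (G ∘ L) := by
  obtain ⟨c, hc, h1⟩ := exists_lintegral_comp_linearEquiv μ L
  obtain ⟨M, h2⟩ := exists_decayKernel_comp_le N L
  refine ⟨C * c⁻¹ * M, fun H G h w => ?_⟩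
  refine (h (L w)).trans ?_
  have h3 : ∫⁻ z, G z * decayKernel N (L w - z) ∂μ =
      (c⁻¹ : NNReal) * ∫⁻ z, G (L z) * decayKernel N (L w - L z) ∂μ := by
    rw [h1 fun z => G z * decayKernel N (L w - z), ← mul_assoc, ← ENNReal.coe_mul,
      inv_mul_cancel₀ hc.ne', ENNReal.coe_one, one_mul]
  rw [h3, ENNReal.coe_mul, ENNReal.coe_mul, mul_assoc (C : ℝ≥0∞), mul_assoc (C : ℝ≥0∞),
    mul_assoc ((c⁻¹ : NNReal) : ℝ≥0∞)]
  gcongr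
  rw [← lintegral_const_mul' _ _ ENNReal.coe_ne_top]
  refine lintegral_mono fun z => ?_
  rw [← map_sub, mul_left_comm]
  gcongr
  · rfl
  · exact h2 _

end LinearChange
end

noncomputable section

set_option maxSynthPendingDepth 3

/-! ### Embedding of modulation spaces into `L^2` -/

section ModulationL2

variable {E : Type*} [NormedAddCommGroup E] [InnerProductSpace ℝ E] [FiniteDimensional ℝ E]
  [MeasurableSpace E] [BorelSpace E]

theorem mixedNorm_self {p : ℝ≥0∞} (hp0 : p ≠ 0) (hp : p ≠ ∞) {F : E → E → ℂ}
    (hF : Continuous fun z : E × E => F z.1 z.2) :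
    mixedNorm p p F = eLpNorm (fun z : E × E => F z.1 z.2) p volume := by
  have hm : Measurable fun z : E × E => ‖F z.1 z.2‖ₑ ^ p.toReal := hF.measurable.enorm.pow_const _
  rw [mixedNorm, eLpNorm_eq_lintegral_rpow_enorm_toReal hp0 hp,
    eLpNorm_eq_lintegral_rpow_enorm_toReal hp0 hp]
  congr 1
  rw [show (volume : Measure (E × E)) = volume.prod volume from rfl,
    lintegral_prod_symm' _ hm]
  refine lintegral_congr fun y => ?_
  rw [eLpNorm_eq_lintegral_rpow_enorm_toReal hp0 hp, enorm_eq_self, ← ENNReal.rpow_mul,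
    one_div_mul_cancel (ENNReal.toReal_pos hp0 hp).ne', ENNReal.rpow_one]

theorem modulationNorm_eq {p : ℝ≥0∞} (hp0 : p ≠ 0) (hp : p ≠ ∞) (g : 𝓢(E, ℂ)) (f : 𝓢'(E, ℂ)) :
    modulationNorm p p g f =
      (∫⁻ z : E × E, ‖stft g f z.1 z.2‖ₑ ^ p.toReal) ^ (1 / p.toReal) := by
  rw [modulationNorm, mixedNorm_self hp0 hp (continuous_stft g f),
    eLpNorm_eq_lintegral_rpow_enorm_toReal hp0 hp]

theorem measurable_enorm_stft (g : 𝓢(E, ℂ)) (f : 𝓢'(E, ℂ)) :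
    Measurable fun z : E × E => ‖stft g f z.1 z.2‖ₑ :=
  (continuous_stft g f).measurable.enorm

variable (E) in
/-- An exponent for which `decayKernel` is integrable on `E × E` and on `E`. -/
def decayOrder : ℕ := Module.finrank ℝ (E × E) + 1

theorem lintegral_decayKernel_prod_ne_top :
    ∫⁻ z : E × E, decayKernel (decayOrder E) z ≠ ∞ :=
  (lintegral_decayKernel_lt_top (volume : Measure (E × E)) (Nat.lt_succ_self _)).ne

theorem lintegral_decayKernel_ne_top : ∫⁻ z : E, decayKernel (decayOrder E) z ≠ ∞ := by
  refine (lintegral_decayKernel_lt_top (volume : Measure E) ?_).ne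
  rw [decayOrder, Module.finrank_prod]
  omega

theorem exists_decayDominated_stft {g : 𝓢(E, ℂ)} (hg : g ≠ 0) (h : 𝓢(E, ℂ)) :
    ∃ C : NNReal, ∀ f : 𝓢'(E, ℂ), DecayDominated volume (decayOrder E) C
      (fun z : E × E => ‖stft h f z.1 z.2‖ₑ) fun z => ‖stft g f z.1 z.2‖ₑ :=
  exists_enorm_stft_le (decayOrder E) hg h

/-- Modulation norms with different windows are comparable. -/
theorem exists_modulationNorm_le {p : ℝ≥0∞} (hp1 : 1 ≤ p) (hp : p ≠ ∞) {g : 𝓢(E, ℂ)} (hg : g ≠ 0)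
    (h : 𝓢(E, ℂ)) : ∃ C : NNReal, ∀ f : 𝓢'(E, ℂ),
      modulationNorm p p h f ≤ C * modulationNorm p p g f := by
  have hp0 : p ≠ 0 := (zero_lt_one.trans_le hp1).ne'
  have hr : 1 ≤ p.toReal := by
    rw [← ENNReal.toReal_one]; exact ENNReal.toReal_mono hp hp1
  have hr0 : 0 ≤ 1 / p.toReal := by positivity
  obtain ⟨C, hC⟩ := exists_decayDominated_stft hg h
  set B := ∫⁻ z : E × E, decayKernel (decayOrder E) z
  have hB : B ≠ ∞ := lintegral_decayKernel_prod_ne_top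
  have hK : ((C : ℝ≥0∞) ^ p.toReal * B ^ (p.toReal - 1) * B) ^ (1 / p.toReal) ≠ ∞ := by
    refine ENNReal.rpow_ne_top_of_nonneg hr0 (ENNReal.mul_ne_top (ENNReal.mul_ne_top ?_ ?_) hB)
    · exact ENNReal.rpow_ne_top_of_nonneg (by linarith) ENNReal.coe_ne_top
    · exact ENNReal.rpow_ne_top_of_nonneg (by linarith) hB
  refine ⟨(((C : ℝ≥0∞) ^ p.toReal * B ^ (p.toReal - 1) * B) ^ (1 / p.toReal)).toNNReal,
    fun f => ?_⟩
  rw [ENNReal.coe_toNNReal hK, modulationNorm_eq hp0 hp, modulationNorm_eq hp0 hp,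
    ← ENNReal.mul_rpow_of_nonneg _ _ hr0]
  exact ENNReal.rpow_le_rpow ((hC f).lintegral_rpow_le (measurable_enorm_stft g f) hr) hr0

/-- The inclusion of `M^{p,p}` into `M^{2,2}`. -/
theorem exists_lintegral_sq_stft_le {p : ℝ≥0∞} (hp1 : 1 ≤ p) (hp2 : p ≤ 2) {g : 𝓢(E, ℂ)}
    (hg : g ≠ 0) : ∃ C : NNReal, ∀ f : 𝓢'(E, ℂ),
      ∫⁻ z : E × E, ‖stft g f z.1 z.2‖ₑ ^ 2 ≤ C * modulationNorm p p g f ^ 2 := by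
  have hp : p ≠ ∞ := (hp2.trans_lt ENNReal.ofNat_lt_top).ne
  have hp0 : p ≠ 0 := (zero_lt_one.trans_le hp1).ne'
  have hr : 1 ≤ p.toReal := by
    rw [← ENNReal.toReal_one]; exact ENNReal.toReal_mono hp hp1
  have hr2 : p.toReal ≤ 2 := by
    have := ENNReal.toReal_mono ENNReal.ofNat_ne_top hp2
    simpa using this
  obtain ⟨C, hC⟩ := exists_decayDominated_stft hg g
  set B := ∫⁻ z : E × E, decayKernel (decayOrder E) z
  have hB : B ≠ ∞ := lintegral_decayKernel_prod_ne_top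
  have hK : ((C : ℝ≥0∞) ^ p.toReal * B ^ (p.toReal - 1)) ^ ((2 - p.toReal) / p.toReal) ≠ ∞ := by
    refine ENNReal.rpow_ne_top_of_nonneg (div_nonneg (by linarith) (by linarith))
      (ENNReal.mul_ne_top ?_ ?_)
    · exact ENNReal.rpow_ne_top_of_nonneg (by linarith) ENNReal.coe_ne_top
    · exact ENNReal.rpow_ne_top_of_nonneg (by linarith) hB
  refine ⟨(((C : ℝ≥0∞) ^ p.toReal * B ^ (p.toReal - 1)) ^
    ((2 - p.toReal) / p.toReal)).toNNReal, fun f => ?_⟩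
  rw [ENNReal.coe_toNNReal hK, modulationNorm_eq hp0 hp]
  refine ((hC f).lintegral_sq_le (measurable_enorm_stft g f) hr hr2).trans (le_of_eq ?_)
  congr 1
  rw [← ENNReal.rpow_natCast, ← ENNReal.rpow_mul]
  congr 1
  push_cast
  ring

/-- The tempered distribution given by an `L^2` function. -/
abbrev lpDist (F : Lp ℂ 2 (volume : Measure E)) : 𝓢'(E, ℂ) := Lp.toTemperedDistribution F

theorem integrable_schwartz_mul_of_memLp {F : E → ℂ} {q : ℝ≥0∞} (hq : 1 ≤ q)
    (hF : MemLp F q) (φ : 𝓢(E, ℂ)) : Integrable fun x => φ x * F x := by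
  have := ENNReal.HolderConjugate.inv_one_sub_inv' hq
  have : ENNReal.HolderTriple (1 - q⁻¹)⁻¹ q 1 := ENNReal.HolderTriple.symm
  rw [← memLp_one_iff_integrable]
  exact hF.mul (φ.memLp (1 - q⁻¹)⁻¹)

theorem isGivenBy_lpDist (F : Lp ℂ 2 (volume : Measure E)) : IsGivenBy (lpDist F) F :=
  ⟨(Lp.memLp F).locallyIntegrable one_le_two, fun φ =>
    ⟨integrable_schwartz_mul_of_memLp one_le_two (Lp.memLp F) φ, by
      rw [lpDist, Lp.toTemperedDistribution_apply]; rfl⟩⟩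

/-- Compactly supported smooth functions are Schwartz and already separate locally integrable
functions. Constructions that ignore null sets may thus use any representing function. -/
theorem IsGivenBy.ae_eq {f : 𝓢'(E, ℂ)} {F G : E → ℂ} (hF : IsGivenBy f F) (hG : IsGivenBy f G) :
    F =ᵐ[volume] G := by
  refine ae_eq_of_integral_contDiff_smul_eq hF.1 hG.1 fun φ hφ hc => ?_
  have h1 : HasCompactSupport (Complex.ofRealCLM ∘ φ) := hc.comp_left rfl
  have h2 : ContDiff ℝ ((⊤ : ℕ∞) : WithTop ℕ∞) (Complex.ofRealCLM ∘ φ) := by fun_prop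
  have h3 := (hF.2 (h1.toSchwartzMap h2)).2.symm.trans (hG.2 (h1.toSchwartzMap h2)).2
  simpa using h3

/-- A distribution which is bounded for the `L^2` norm is given by an `L^2` function. -/
theorem exists_lpDist_eq_of_norm_le {f : 𝓢'(E, ℂ)} {M : ℝ} (hM : 0 ≤ M)
    (hf : ∀ φ : 𝓢(E, ℂ), ‖f φ‖ ≤ M * ‖φ.toLp 2‖) :
    ∃ F : Lp ℂ 2 (volume : Measure E), lpDist F = f ∧ ‖F‖ ≤ M := by
  set e : 𝓢(E, ℂ) →ₗ[ℂ] Lp ℂ 2 (volume : Measure E) :=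
    (SchwartzMap.toLpCLM ℂ ℂ 2 (volume : Measure E)).toLinearMap
  have hd : DenseRange e := SchwartzMap.denseRange_toLpCLM ENNReal.ofNat_ne_top
  have hf' : ∀ φ, ‖(f : 𝓢(E, ℂ) →ₗ[ℂ] ℂ) φ‖ ≤ M * ‖e φ‖ := hf
  set l := LinearMap.extendOfNorm (f : 𝓢(E, ℂ) →ₗ[ℂ] ℂ) e
  have hl : ∀ φ, l (e φ) = f φ := fun φ => LinearMap.extendOfNorm_eq hd ⟨M, hf'⟩ φ
  have hln : ‖l‖ ≤ M := LinearMap.opNorm_extendOfNorm_le hd hM hf'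
  set G := (InnerProductSpace.toDual ℂ (Lp ℂ 2 (volume : Measure E))).symm l
  -- The Riesz representative enters the inner product conjugated, whereas a distribution given by a
  -- function pairs with it bilinearly.
  refine ⟨star G, ?_, ?_⟩
  · ext φ
    rw [← hl φ, lpDist, Lp.toTemperedDistribution_apply, ← InnerProductSpace.toDual_symm_apply,
      L2.inner_def]
    refine integral_congr_ae ?_
    filter_upwards [Lp.coeFn_star G, φ.coeFn_toLp 2 volume] with x h1 h2
    have h3 : (e φ : E → ℂ) x = φ x := h2
    rw [h1, RCLike.inner_apply, h3]
    rfl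
  · have h1 : ‖star G‖ = ‖G‖ := by
      rw [Lp.norm_def, Lp.norm_def]
      congr 1
      refine eLpNorm_congr_norm_ae ?_
      filter_upwards [Lp.coeFn_star G] with x h1
      rw [h1, Pi.star_apply, norm_star]
    rw [h1]
    simpa [G] using hln

theorem norm_sq_toLp_two (φ : 𝓢(E, ℂ)) : ‖φ.toLp 2‖ ^ 2 = ∫ t, ‖φ t‖ ^ 2 := by
  have h := SchwartzMap.inner_toL2_toL2_eq φ φ volume
  rw [inner_self_eq_norm_sq_to_K] at h
  have h2 : ∫ t, inner ℂ (φ t) (φ t) = ((∫ t, ‖φ t‖ ^ 2 : ℝ) : ℂ) := by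
    rw [← integral_complex_ofReal]
    refine integral_congr_ae (.of_forall fun t => ?_)
    simp
  rw [h2] at h
  exact Complex.ofReal_injective (by simpa using h)

/-- A distribution with square integrable short-time Fourier transform is an `L^2` function. -/
theorem exists_lpDist_eq_of_stft {g : 𝓢(E, ℂ)} (hg : g ≠ 0) :
    ∃ C : NNReal, ∀ f : 𝓢'(E, ℂ), ∫⁻ z : E × E, ‖stft g f z.1 z.2‖ₑ ^ 2 ≠ ∞ →
      ∃ F : Lp ℂ 2 (volume : Measure E), lpDist F = f ∧
        ‖F‖ₑ ^ 2 ≤ C * ∫⁻ z : E × E, ‖stft g f z.1 z.2‖ₑ ^ 2 := by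
  have hc := stftConst_pos hg
  refine ⟨((stftConst g)⁻¹).toNNReal, fun f hf => ?_⟩
  set S := ∫⁻ z : E × E, ‖stft g f z.1 z.2‖ₑ ^ 2
  have hSl : MemLp (fun z : E × E => stft g f z.1 z.2) 2 volume := by
    refine ⟨(continuous_stft g f).aestronglyMeasurable, ?_⟩
    rw [eLpNorm_eq_lintegral_rpow_enorm_toReal two_ne_zero ENNReal.ofNat_ne_top]
    refine ENNReal.rpow_lt_top_of_nonneg (by positivity) ?_
    simpa using hf
  have hS : ∫ z : E × E, ‖stft g f z.1 z.2‖ ^ 2 = S.toReal := by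
    have hm : AEStronglyMeasurable (fun z : E × E => ‖stft g f z.1 z.2‖ ^ 2) volume :=
      ((continuous_stft g f).norm.pow 2).aestronglyMeasurable
    rw [integral_eq_lintegral_of_nonneg_ae (.of_forall fun z => by positivity) hm]
    congr 1
    refine lintegral_congr fun z => ?_
    rw [ENNReal.ofReal_pow (norm_nonneg _), ofReal_norm]
  -- Cauchy–Schwarz in the inversion formula; Moyal's identity evaluates the factor coming from `φ`.
  have key : ∀ φ : 𝓢(E, ℂ), ‖f φ‖ ≤ √((stftConst g)⁻¹ * S.toReal) * ‖φ.toLp 2‖ := by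
    intro φ
    obtain ⟨h1, h2⟩ := stft_inversion f g (schwartzConj φ)
    obtain ⟨h3, h4⟩ := integral_norm_sq_schwartzStft g (schwartzConj φ)
    have h5 : schwartzConj (schwartzConj φ) = φ := by
      ext t; simp [schwartzConj_apply]
    have h6 : ∫ t, ‖schwartzConj φ t‖ ^ 2 = ‖φ.toLp 2‖ ^ 2 := by
      rw [norm_sq_toLp_two]
      simp [schwartzConj_apply]
    rw [h5] at h2
    rw [h6] at h4
    have hvl : MemLp (schwartzStft g (schwartzConj φ)) 2 volume :=
      (memLp_two_iff_integrable_sq_norm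
        (continuous_schwartzStft g _).aestronglyMeasurable).2 h3
    have h7 := integral_mul_norm_le_Lp_mul_Lq Real.HolderConjugate.two_two
      (by simpa using hvl) (by simpa using hSl)
    simp only [Real.rpow_two, ← Real.sqrt_eq_rpow] at h7
    rw [h4, hS] at h7
    have h8 : stftConst g * ‖f φ‖ ≤ √(stftConst g * ‖φ.toLp 2‖ ^ 2) * √S.toReal := by
      calc stftConst g * ‖f φ‖ = ‖(stftConst g : ℂ) * f φ‖ := by
            rw [norm_mul, Complex.norm_real, Real.norm_of_nonneg hc.le]
        _ ≤ _ := by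
            rw [h2]
            refine (norm_integral_le_integral_norm _).trans (le_trans (le_of_eq ?_) h7)
            simp only [norm_mul, RCLike.norm_conj]
    rw [Real.sqrt_mul hc.le, Real.sqrt_sq (norm_nonneg _)] at h8
    rw [Real.sqrt_mul (by positivity), Real.sqrt_inv]
    have h9 : 0 < √(stftConst g) := Real.sqrt_pos.2 hc
    have h10 : stftConst g = √(stftConst g) * √(stftConst g) := (Real.mul_self_sqrt hc.le).symm
    rw [mul_assoc, ← div_eq_inv_mul, le_div_iff₀ h9]
    refine le_of_mul_le_mul_left ?_ h9
    calc √(stftConst g) * (‖f φ‖ * √(stftConst g))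
        = √(stftConst g) * √(stftConst g) * ‖f φ‖ := by ring
      _ ≤ √(stftConst g) * ‖φ.toLp 2‖ * √S.toReal := by rw [← h10]; exact h8
      _ = _ := by ring
  obtain ⟨F, hF, hFn⟩ := exists_lpDist_eq_of_norm_le (Real.sqrt_nonneg _) key
  refine ⟨F, hF, ?_⟩
  have h1 : ‖F‖ ^ 2 ≤ (stftConst g)⁻¹ * S.toReal := by
    rw [← Real.sq_sqrt (show 0 ≤ (stftConst g)⁻¹ * S.toReal by positivity)]
    gcongr
  calc ‖F‖ₑ ^ 2 = ENNReal.ofReal (‖F‖ ^ 2) := by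
        rw [ENNReal.ofReal_pow (norm_nonneg _), ofReal_norm]
    _ ≤ ENNReal.ofReal ((stftConst g)⁻¹ * S.toReal) := ENNReal.ofReal_le_ofReal h1
    _ = _ := by
        rw [ENNReal.ofReal_mul (by positivity), ENNReal.ofReal_toReal hf]
        rfl

/-- The elements of `M^{p,p}` are `L^2` functions. -/
theorem exists_lpDist_eq_of_modulationNorm {p : ℝ≥0∞} (hp1 : 1 ≤ p) (hp2 : p ≤ 2) {g : 𝓢(E, ℂ)}
    (hg : g ≠ 0) : ∃ C : NNReal, ∀ f : 𝓢'(E, ℂ), modulationNorm p p g f ≠ ∞ →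
      ∃ F : Lp ℂ 2 (volume : Measure E), lpDist F = f ∧ ‖F‖ₑ ≤ C * modulationNorm p p g f := by
  obtain ⟨C1, h1⟩ := exists_lintegral_sq_stft_le hp1 hp2 hg
  obtain ⟨C2, h2⟩ := exists_lpDist_eq_of_stft hg
  refine ⟨NNReal.sqrt (C2 * C1), fun f hf => ?_⟩
  obtain ⟨F, hF, hn⟩ := h2 f (ne_top_of_le_ne_top (by finiteness) (h1 f))
  refine ⟨F, hF, ?_⟩
  have h3 : ‖F‖ₑ ^ 2 ≤ (NNReal.sqrt (C2 * C1) * modulationNorm p p g f) ^ 2 := by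
    refine hn.trans ?_
    rw [mul_pow, ← ENNReal.coe_pow, NNReal.sq_sqrt, ENNReal.coe_mul, mul_assoc]
    gcongr
    exact h1 f
  exact (ENNReal.pow_right_strictMono two_ne_zero).le_iff_le.1 h3

end ModulationL2
end

noncomputable section

set_option maxSynthPendingDepth 3

/-! ### Elements of modulation spaces are `L^p` functions -/

section ModulationLp

open scoped FourierTransform

variable {E : Type*} [NormedAddCommGroup E] [InnerProductSpace ℝ E] [FiniteDimensional ℝ E]
  [MeasurableSpace E] [BorelSpace E]

theorem lp_enorm_sq (F : Lp ℂ 2 (volume : Measure E)) : ‖F‖ₑ ^ 2 = ∫⁻ t, ‖F t‖ₑ ^ 2 := by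
  rw [Lp.enorm_def, eLpNorm_eq_lintegral_rpow_enorm_toReal two_ne_zero ENNReal.ofNat_ne_top,
    ← ENNReal.rpow_natCast, ← ENNReal.rpow_mul]
  simp

/-- Plancherel's theorem for the Fourier integral itself. Moving the transform onto Schwartz
functions shows that the integral and the abstract $L^2$ transform define the same distribution,
hence agree almost everywhere. -/
theorem lintegral_enorm_fourier_sq {u : E → ℂ} (h1 : Integrable u) (h2 : MemLp u 2) :
    ∫⁻ w, ‖𝓕 u w‖ₑ ^ 2 = ∫⁻ t, ‖u t‖ₑ ^ 2 := by
  set U : Lp ℂ 2 (volume : Measure E) := h2.toLp u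
  have hcont : Continuous (𝓕 u) := VectorFourier.fourierIntegral_continuous
    Real.continuous_fourierChar (by exact continuous_inner) h1
  have hbound : ∀ w, ‖𝓕 u w‖ ≤ ∫ t, ‖u t‖ := fun w =>
    VectorFourier.norm_fourierIntegral_le_integral_norm _ _ _ _ w
  have hg : IsGivenBy (lpDist (𝓕 U)) (𝓕 u) := by
    refine ⟨hcont.locallyIntegrable, fun φ => ⟨?_, ?_⟩⟩
    · exact Integrable.mul_bdd (c := ∫ t, ‖u t‖) φ.integrable hcont.aestronglyMeasurable (.of_forall hbound)
    · rw [lpDist, ← Lp.fourier_toTemperedDistribution_eq, TemperedDistribution.fourier_apply,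
        Lp.toTemperedDistribution_apply]
      have h3 := VectorFourier.integral_bilin_fourierIntegral_eq_flip
        (ContinuousLinearMap.mul ℂ ℂ) (L := innerₗ E) Real.continuous_fourierChar
        (by exact continuous_inner) (μ := volume) (ν := volume) φ.integrable h1
      have h4 : ∫ w, 𝓕 φ w * u w = ∫ w, φ w * 𝓕 u w := by
        simpa using! h3
      rw [← h4]
      refine integral_congr_ae ?_
      filter_upwards [h2.coeFn_toLp] with t ht
      rw [ht, smul_eq_mul]
  have h5 := (isGivenBy_lpDist (𝓕 U)).ae_eq hg
  calc ∫⁻ w, ‖𝓕 u w‖ₑ ^ 2 = ∫⁻ w, ‖(𝓕 U : Lp ℂ 2 (volume : Measure E)) w‖ₑ ^ 2 := by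
        refine lintegral_congr_ae ?_
        filter_upwards [h5] with w hw
        rw [hw]
    _ = ∫⁻ t, ‖U t‖ₑ ^ 2 := by
        rw [← lp_enorm_sq, ← lp_enorm_sq, ← ofReal_norm, ← ofReal_norm, Lp.norm_fourier_eq]
    _ = _ := by
        refine lintegral_congr_ae ?_
        filter_upwards [h2.coeFn_toLp] with w hw
        rw [hw]

theorem IsGivenBy.stft_eq {f : 𝓢'(E, ℂ)} {F : E → ℂ} (hF : IsGivenBy f F) (g : 𝓢(E, ℂ))
    (x y : E) : stft g f x y = ∫ t, (starRingEnd ℂ) (tfShift (x, y) g t) * F t :=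
  (hF.2 (schwartzConj (tfShift (x, y) g))).2

theorem IsGivenBy.stft_eq_fourier {f : 𝓢'(E, ℂ)} {F : E → ℂ} (hF : IsGivenBy f F) (g : 𝓢(E, ℂ))
    (x y : E) : stft g f x y =
      𝓕 (fun t => (starRingEnd ℂ) (g (t - x)) * F t) ((2 * Real.pi)⁻¹ • y) := by
  rw [hF.stft_eq, Real.fourier_eq']
  refine integral_congr_ae (.of_forall fun t => ?_)
  simp only [tfShift_apply, map_mul, ← Complex.exp_conj, smul_eq_mul, Complex.conj_I,
    Complex.conj_ofReal]
  rw [mul_assoc]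
  congr 2
  rw [inner_smul_right, real_inner_comm]
  push_cast
  have : (Real.pi : ℂ) ≠ 0 := by exact_mod_cast Real.pi_ne_zero
  field_simp

variable (E) in
/-- Plancherel's theorem for the short-time Fourier transform at a fixed position. -/
theorem exists_lintegral_stft_sq_eq : ∃ c : NNReal, 0 < c ∧ ∀ (F : Lp ℂ 2 (volume : Measure E))
    (g : 𝓢(E, ℂ)) (x : E), ∫⁻ y, ‖stft g (lpDist F) x y‖ₑ ^ 2 =
      c * ∫⁻ t, ‖F t‖ₑ ^ 2 * ‖g (t - x)‖ₑ ^ 2 := by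
  obtain ⟨c, hc, h1⟩ := exists_lintegral_comp_linearEquiv (volume : Measure E)
    (ContinuousLinearEquiv.smulLeft (Units.mk0 ((2 * Real.pi)⁻¹ : ℝ) (by positivity)))
  refine ⟨c, hc, fun F g x => ?_⟩
  set u : E → ℂ := fun t => (starRingEnd ℂ) (g (t - x)) * F t
  have hu1 : Integrable u := integrable_schwartz_mul_of_memLp one_le_two (Lp.memLp F)
    (schwartzConj (schwartzTranslate x g))
  have hu2 : MemLp u 2 := by
    have h3 : MemLp (schwartzConj (schwartzTranslate x g)) ∞ (volume : Measure E) :=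
      SchwartzMap.memLp _ _ volume
    exact (Lp.memLp F).mul h3
  have h2 := h1 fun w => ‖𝓕 u w‖ₑ ^ 2
  rw [lintegral_enorm_fourier_sq hu1 hu2] at h2
  calc ∫⁻ y, ‖stft g (lpDist F) x y‖ₑ ^ 2 = ∫⁻ y, ‖𝓕 u ((2 * Real.pi)⁻¹ • y)‖ₑ ^ 2 := by
        simp_rw [(isGivenBy_lpDist F).stft_eq_fourier g x]
        rfl
    _ = c * ∫⁻ t, ‖u t‖ₑ ^ 2 := h2
    _ = _ := by
        congr 1
        refine lintegral_congr fun t => ?_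
        rw [enorm_mul, mul_pow, mul_comm]
        congr 2
        rw [← ofReal_norm, RCLike.norm_conj, ofReal_norm]

theorem measurable_enorm_lp (F : Lp ℂ 2 (volume : Measure E)) : Measurable fun t => ‖F t‖ₑ :=
  (Lp.stronglyMeasurable F).measurable.enorm

theorem measurable_enorm_schwartz (g : 𝓢(E, ℂ)) : Measurable fun t => ‖g t‖ₑ :=
  g.continuous.measurable.enorm

theorem lintegral_enorm_schwartz_sq_ne_top (g : 𝓢(E, ℂ)) : ∫⁻ t, ‖g t‖ₑ ^ 2 ≠ ∞ := by
  have h := (integrable_norm_sq g).hasFiniteIntegral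
  simp only [HasFiniteIntegral, enorm_pow, enorm_norm] at h
  exact h.ne

theorem lintegral_enorm_schwartz_sq_ne_zero {g : 𝓢(E, ℂ)} (hg : g ≠ 0) :
    ∫⁻ t, ‖g t‖ₑ ^ 2 ≠ 0 := by
  intro h
  refine (integral_norm_sq_pos hg).ne' ?_
  rw [integral_eq_lintegral_of_nonneg_ae (.of_forall fun z => by positivity)
    (integrable_norm_sq g).1]
  simp_rw [ENNReal.ofReal_pow (norm_nonneg _), ofReal_norm, h]
  rfl

theorem lintegral_lintegral_mul_translate {H k : E → ℝ≥0∞} (hH : Measurable H)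
    (hk : Measurable k) :
    ∫⁻ x, ∫⁻ t, H t * k (t - x) = (∫⁻ t, k t) * ∫⁻ t, H t := by
  have hq : Measurable fun q : E × E => H q.2 * k (q.2 - q.1) :=
    (hH.comp measurable_snd).mul (hk.comp (measurable_snd.sub measurable_fst))
  rw [lintegral_lintegral_swap (f := fun x t => H t * k (t - x)) hq.aemeasurable,
    ← lintegral_const_mul _ hH]
  refine lintegral_congr fun t => ?_
  rw [lintegral_const_mul _ (by exact hk.comp (measurable_const.sub measurable_id)),
    lintegral_sub_left_eq_self, mul_comm]

/-- Plancherel at each position, integrated over positions. This is the inclusion of $L^2$ in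
$M^{2,2}$, converse to `exists_lpDist_eq_of_stft`. -/
theorem exists_lintegral_stft_sq_le (g : 𝓢(E, ℂ)) : ∃ C : NNReal,
    ∀ F : Lp ℂ 2 (volume : Measure E),
      ∫⁻ z : E × E, ‖stft g (lpDist F) z.1 z.2‖ₑ ^ 2 ≤ C * ‖F‖ₑ ^ 2 := by
  obtain ⟨c, -, hc⟩ := exists_lintegral_stft_sq_eq E
  refine ⟨c * (∫⁻ t, ‖g t‖ₑ ^ 2).toNNReal, fun F => le_of_eq ?_⟩
  rw [show (volume : Measure (E × E)) = volume.prod volume from rfl,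
    lintegral_prod _ ((measurable_enorm_stft g _).pow_const 2).aemeasurable]
  simp_rw [hc]
  have hm : Measurable fun x => ∫⁻ t, ‖F t‖ₑ ^ 2 * ‖g (t - x)‖ₑ ^ 2 := by
    refine Measurable.lintegral_prod_right'
      (f := fun q : E × E => ‖F q.2‖ₑ ^ 2 * ‖g (q.2 - q.1)‖ₑ ^ 2) ?_
    exact (((measurable_enorm_lp F).pow_const 2).comp measurable_snd).mul
      (((measurable_enorm_schwartz g).pow_const 2).comp (measurable_snd.sub measurable_fst))
  rw [lintegral_const_mul _ hm, lintegral_lintegral_mul_translate (k := fun t => ‖g t‖ₑ ^ 2)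
    ((measurable_enorm_lp F).pow_const 2) ((measurable_enorm_schwartz g).pow_const 2),
    lp_enorm_sq, ENNReal.coe_mul, ENNReal.coe_toNNReal (lintegral_enorm_schwartz_sq_ne_top g),
    mul_assoc]

/-- At fixed `x`, Hölder with weight $|g(t-x)|^2$ passes from $|F|^r$ to $|F|^2$, and Plancherel
turns the result into $\int|V_gF(x,y)|^2\,dy$ to the power $r/2$. Integration over `x` leaves
$\|g\|_2^2\int|F|^r$ on one side and a mixed norm on the other. -/
theorem exists_lintegral_rpow_le {r : ℝ} (hr : 1 ≤ r) (hr2 : r ≤ 2) {g : 𝓢(E, ℂ)} (hg : g ≠ 0) :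
    ∃ C : NNReal, ∀ F : Lp ℂ 2 (volume : Measure E),
      ∫⁻ t, ‖F t‖ₑ ^ r ≤ C * ∫⁻ z : E × E, ‖stft g (lpDist F) z.1 z.2‖ₑ ^ r := by
  have hr0 : 0 < r := by linarith
  obtain ⟨c, hc0, hc⟩ := exists_lintegral_stft_sq_eq E
  obtain ⟨C, hC⟩ := exists_decayDominated_stft hg g
  set B := ∫⁻ z : E × E, decayKernel (decayOrder E) z
  set B' := ∫⁻ z : E, decayKernel (decayOrder E) z
  have hB : B ≠ ∞ := lintegral_decayKernel_prod_ne_top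
  have hB' : B' ≠ ∞ := lintegral_decayKernel_ne_top
  set K : ℝ≥0∞ := (C : ℝ≥0∞) ^ r * B ^ (r - 1) * B' + 1 with hK
  have hKt : K ≠ ∞ := by
    refine ENNReal.add_ne_top.2 ⟨ENNReal.mul_ne_top (ENNReal.mul_ne_top ?_ ?_) hB', by simp⟩
    · exact ENNReal.rpow_ne_top_of_nonneg (by linarith) ENNReal.coe_ne_top
    · exact ENNReal.rpow_ne_top_of_nonneg (by linarith) hB
  set A := ∫⁻ t, ‖g t‖ₑ ^ 2
  have hA : A ≠ ∞ := lintegral_enorm_schwartz_sq_ne_top g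
  have hA0 : A ≠ 0 := lintegral_enorm_schwartz_sq_ne_zero hg
  -- The power of `A` comes from Hölder with exponent `2 / r`, and `c` from Plancherel.
  set D : ℝ≥0∞ := (A ^ (2 / r - 1) * (c : ℝ≥0∞)⁻¹) ^ (r / 2)
  have hD : D ≠ ∞ := by
    refine ENNReal.rpow_ne_top_of_nonneg (by positivity) (ENNReal.mul_ne_top ?_ ?_)
    · refine ENNReal.rpow_ne_top_of_nonneg ?_ hA
      rw [sub_nonneg, le_div_iff₀ hr0]
      linarith
    · simpa using hc0.ne'
  have hfin : A⁻¹ * D * K ≠ ∞ :=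
    ENNReal.mul_ne_top (ENNReal.mul_ne_top (ENNReal.inv_ne_top.2 hA0) hD) hKt
  refine ⟨(A⁻¹ * D * K).toNNReal, fun F => ?_⟩
  rw [ENNReal.coe_toNNReal hfin]
  have hFm := measurable_enorm_lp F
  have hgm := measurable_enorm_schwartz g
  have h1 : ∀ x, ∫⁻ t, ‖F t‖ₑ ^ r * ‖g (t - x)‖ₑ ^ 2 ≤
      D * (∫⁻ y, ‖stft g (lpDist F) x y‖ₑ ^ 2) ^ (r / 2) := by
    intro x
    have h2 := rpow_lintegral_mul_le (μ := volume) (r := 2 / r)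
      (by rw [le_div_iff₀ hr0]; linarith) (hFm.pow_const r)
      (k := fun t => ‖g (t - x)‖ₑ ^ 2)
      (by exact (hgm.pow_const 2).comp (measurable_id.sub measurable_const))
    rw [lintegral_sub_right_eq_self (fun t => ‖g t‖ₑ ^ 2) x] at h2
    simp_rw [← ENNReal.rpow_mul, mul_div_cancel₀ _ hr0.ne', ENNReal.rpow_two] at h2
    have h3 := ENNReal.rpow_le_rpow h2 (show 0 ≤ r / 2 by positivity)
    rw [← ENNReal.rpow_mul, show 2 / r * (r / 2) = 1 by field_simp,
      ENNReal.rpow_one] at h3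
    refine h3.trans (le_of_eq ?_)
    rw [← ENNReal.mul_rpow_of_nonneg _ _ (by positivity), hc, mul_assoc, ← mul_assoc _ (c : ℝ≥0∞),
      ENNReal.inv_mul_cancel (by simpa using hc0.ne') ENNReal.coe_ne_top, one_mul]
  have h4 : A * ∫⁻ t, ‖F t‖ₑ ^ r ≤ D * (K * ∫⁻ z : E × E, ‖stft g (lpDist F) z.1 z.2‖ₑ ^ r) := by
    rw [← lintegral_lintegral_mul_translate (hFm.pow_const r) (hgm.pow_const 2)]
    refine (lintegral_mono h1).trans ?_
    rw [lintegral_const_mul' _ _ hD]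
    gcongr
    exact (hC (lpDist F)).lintegral_mixed_le (μ := volume) (ν := volume)
      (measurable_enorm_stft g _) hr hr2
  calc ∫⁻ t, ‖F t‖ₑ ^ r = A⁻¹ * (A * ∫⁻ t, ‖F t‖ₑ ^ r) := by
        rw [← mul_assoc, ENNReal.inv_mul_cancel hA0 hA, one_mul]
    _ ≤ A⁻¹ * (D * (K * ∫⁻ z : E × E, ‖stft g (lpDist F) z.1 z.2‖ₑ ^ r)) := by gcongr
    _ = _ := by ring

theorem memLp_of_modulationNorm {p : ℝ≥0∞} (hp1 : 1 ≤ p) (hp2 : p ≤ 2) {g : 𝓢(E, ℂ)}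
    (hg : g ≠ 0) (F : Lp ℂ 2 (volume : Measure E)) (hF : modulationNorm p p g (lpDist F) ≠ ∞) :
    MemLp F p := by
  have hp : p ≠ ∞ := (hp2.trans_lt ENNReal.ofNat_lt_top).ne
  have hp0 : p ≠ 0 := (zero_lt_one.trans_le hp1).ne'
  have hr : 1 ≤ p.toReal := by
    rw [← ENNReal.toReal_one]; exact ENNReal.toReal_mono hp hp1
  have hr2 : p.toReal ≤ 2 := by
    have := ENNReal.toReal_mono ENNReal.ofNat_ne_top hp2
    simpa using this
  obtain ⟨C, hC⟩ := exists_lintegral_rpow_le hr hr2 hg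
  refine ⟨(Lp.stronglyMeasurable F).aestronglyMeasurable, ?_⟩
  rw [eLpNorm_eq_lintegral_rpow_enorm_toReal hp0 hp]
  refine ENNReal.rpow_lt_top_of_nonneg (by positivity) (ne_top_of_le_ne_top ?_ (hC F))
  refine ENNReal.mul_ne_top ENNReal.coe_ne_top fun h => hF ?_
  rw [modulationNorm_eq hp0 hp, h, ENNReal.top_rpow_of_pos (by positivity)]

end ModulationLp
end

noncomputable section

set_option maxSynthPendingDepth 3

/-! ### Twisted and classical modulation spaces -/

theorem mixedNorm_congr_norm {E : Type*} [NormedAddCommGroup E] [NormedSpace ℝ E] [MeasureSpace E]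
    (p q : ℝ≥0∞) {F G : E → E → ℂ} (h : ∀ x y, ‖F x y‖ = ‖G x y‖) :
    mixedNorm p q F = mixedNorm p q G := by
  unfold mixedNorm
  congr 1
  funext y
  exact eLpNorm_congr_norm_ae (.of_forall fun x => h x y)

/-- An injective linear endomorphism of a finite-dimensional space as an equivalence. -/
def continuousLinearEquivOfInjective {V : Type*} [NormedAddCommGroup V] [NormedSpace ℝ V]
    [FiniteDimensional ℝ V] (L : V →ₗ[ℝ] V) (hL : Function.Injective L) : V ≃L[ℝ] V :=
  (LinearEquiv.ofInjectiveEndo L hL).toContinuousLinearEquiv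

namespace PhaseSpace

variable {n : ℕ}

variable (n) in
/-- `J` as a linear map. -/
def linearJ : PhaseSpace n →ₗ[ℝ] PhaseSpace n where
  toFun := J
  map_add' x y := by
    ext i
    rcases i with i | i <;> simp [J, add_comm]
  map_smul' c x := by
    ext i
    rcases i with i | i <;> simp [J]

theorem linearJ_apply (x : PhaseSpace n) : linearJ n x = J x := rfl

theorem J_J (x : PhaseSpace n) : J (J x) = -x := by
  ext i
  rcases i with i | i <;> simp [J]

theorem J_injective : Function.Injective (J (n := n)) := fun x y h => by
  have := congrArg J h
  rwa [J_J, J_J, neg_inj] at this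

variable (n) in
/-- The map which relates twisted and classical time-frequency shifts. -/
def twistLinearMap (lam : ℝ) :
    (PhaseSpace n × PhaseSpace n) →ₗ[ℝ] (PhaseSpace n × PhaseSpace n) :=
  (LinearMap.fst ℝ _ _ + Real.tanh (lam / 2) • (linearJ n).comp (LinearMap.snd ℝ _ _)).prod
    ((lam / 2) • (linearJ n).comp (LinearMap.fst ℝ _ _) -
      (lam / 2 * (Real.cosh (lam / 2) / Real.sinh (lam / 2))) • LinearMap.snd ℝ _ _)

theorem twistLinearMap_apply (lam : ℝ) (z : PhaseSpace n × PhaseSpace n) :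
    twistLinearMap n lam z = (z.1 + Real.tanh (lam / 2) • J z.2,
      (lam / 2) • J z.1 - (lam / 2 * (Real.cosh (lam / 2) / Real.sinh (lam / 2))) • z.2) := rfl

/-- Since $J^2=-1$, eliminating `ξ` leaves
$\frac\lambda2(\tanh\frac\lambda2-\coth\frac\lambda2)\,\eta=0$, and $\cosh^2-\sinh^2=1$ forbids
$\tanh=\coth$. -/
theorem twistLinearMap_injective {lam : ℝ} (hlam : lam ≠ 0) :
    Function.Injective (twistLinearMap n lam) := by
  rw [← LinearMap.ker_eq_bot, LinearMap.ker_eq_bot']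
  rintro ⟨ξ, η⟩ h
  rw [twistLinearMap_apply, Prod.mk_eq_zero] at h
  obtain ⟨h1, h2⟩ := h
  have hs : Real.sinh (lam / 2) ≠ 0 := by
    rw [Ne, Real.sinh_eq_zero]
    simpa using hlam
  have hc := (Real.cosh_pos (lam / 2)).ne'
  have h3 : ξ = -(Real.tanh (lam / 2) • J η) := eq_neg_of_add_eq_zero_left h1
  have h4 : J ξ = Real.tanh (lam / 2) • η := by
    rw [h3, ← linearJ_apply, map_neg, map_smul, linearJ_apply, J_J, smul_neg, neg_neg]
  rw [h4, smul_smul, ← sub_smul, smul_eq_zero] at h2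
  have h5 : η = 0 := by
    refine h2.resolve_left fun h => ?_
    rw [Real.tanh_eq_sinh_div_cosh] at h
    field_simp at h
    have h6 := Real.cosh_sq (lam / 2)
    rw [h6, mul_zero] at h
    rcases mul_eq_zero.1 h with h7 | h7
    · exact hlam h7
    · linarith
  rw [h5, ← linearJ_apply, map_zero, smul_zero, neg_zero] at h3
  rw [h3, h5]
  rfl

/-- Moving the inner modulation past the outer translation costs a phase, after which translations
and frequencies add up. The prefactor with $\coth\lambda$ is a further phase, invisible to the norm.
-/
theorem exists_twistedRepSchwartz_eq (lam : ℝ) (ξ η : PhaseSpace n) (g : 𝓢(PhaseSpace n, ℂ)) :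
    ∃ c : ℂ, ‖c‖ = 1 ∧
      twistedRepSchwartz lam ξ η g = c • tfShift (twistLinearMap n lam (ξ, η)) g := by
  refine ⟨cexp (I * (lam / 2 * (Real.cosh lam / Real.sinh lam) * inner ℝ ξ η : ℝ)) *
    cexp (I * (-(lam / 2) * inner ℝ (J ξ) (Real.tanh (lam / 2) • J η) : ℝ)), ?_, ?_⟩
  · rw [norm_mul, mul_comm I, mul_comm I, norm_exp_ofReal_mul_I, norm_exp_ofReal_mul_I, one_mul]
  · ext x
    simp only [twistedRepSchwartz, schwartzModulate_apply, schwartzTranslate_apply, smul_apply,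
      innerSL_apply_apply, smul_eq_mul, tfShift_apply, twistLinearMap_apply]
    have h1 : x - Real.tanh (lam / 2) • J η - ξ = x - (ξ + Real.tanh (lam / 2) • J η) := by abel
    rw [h1]
    simp only [← mul_assoc, ← Complex.exp_add]
    congr 2
    simp only [inner_sub_left, inner_sub_right, inner_smul_left, RCLike.conj_to_real]
    push_cast
    ring

theorem norm_matrixCoeff (lam : ℝ) (g : 𝓢(PhaseSpace n, ℂ)) (f : 𝓢'(PhaseSpace n, ℂ))
    (ξ η : PhaseSpace n) : ‖matrixCoeff lam g f ξ η‖ =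
      ‖stft g f (twistLinearMap n lam (ξ, η)).1 (twistLinearMap n lam (ξ, η)).2‖ := by
  obtain ⟨c, hc, h⟩ := exists_twistedRepSchwartz_eq lam ξ η g
  have h1 : schwartzConj (c • tfShift (twistLinearMap n lam (ξ, η)) g) =
      (starRingEnd ℂ) c • schwartzConj (tfShift (twistLinearMap n lam (ξ, η)) g) := by
    ext t
    simp [schwartzConj_apply]
  rw [matrixCoeff, sesqPairing, h, h1, map_smul, norm_smul, RCLike.norm_conj, hc, one_mul, stft_eq]

/-- Twisted and classical modulation norms with the same window are proportional. -/
theorem exists_twistedModulationNorm_eq {lam : ℝ} (hlam : lam ≠ 0) {p : ℝ≥0∞} (hp0 : p ≠ 0)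
    (hp : p ≠ ∞) : ∃ c : NNReal, 0 < c ∧ ∀ (g : 𝓢(PhaseSpace n, ℂ)) (f : 𝓢'(PhaseSpace n, ℂ)),
      twistedModulationNorm lam p p g f = c * modulationNorm p p g f := by
  set L := continuousLinearEquivOfInjective _ (twistLinearMap_injective (n := n) hlam)
  obtain ⟨c, hc, h⟩ := exists_lintegral_comp_linearEquiv volume L
  have hr : 0 < p.toReal := ENNReal.toReal_pos hp0 hp
  refine ⟨c ^ (1 / p.toReal), NNReal.rpow_pos hc, fun g f => ?_⟩
  have h1 : twistedModulationNorm lam p p g f =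
      mixedNorm p p fun ξ η => stft g f (L (ξ, η)).1 (L (ξ, η)).2 :=
    mixedNorm_congr_norm p p (norm_matrixCoeff lam g f)
  have h2 : Continuous fun z : PhaseSpace n × PhaseSpace n =>
      stft g f (L (z.1, z.2)).1 (L (z.1, z.2)).2 :=
    (continuous_stft g f).comp L.continuous
  rw [h1, mixedNorm_self hp0 hp h2, eLpNorm_eq_lintegral_rpow_enorm_toReal hp0 hp,
    modulationNorm_eq hp0 hp, ENNReal.coe_rpow_of_nonneg _ (by positivity),
    ← ENNReal.mul_rpow_of_nonneg _ _ (by positivity)]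
  congr 1
  exact h fun z => ‖stft g f z.1 z.2‖ₑ ^ p.toReal

theorem twistedModulationSpace_eq {lam : ℝ} (hlam : lam ≠ 0) {p : ℝ≥0∞} (hp0 : p ≠ 0)
    (hp : p ≠ ∞) : twistedModulationSpace n lam p p = modulationSpace (PhaseSpace n) p p := by
  obtain ⟨c, hc, h⟩ := exists_twistedModulationNorm_eq (n := n) hlam hp0 hp
  ext f
  simp only [twistedModulationSpace, modulationSpace, Set.mem_ofPred_eq, h]
  refine exists_congr fun g => and_congr_right fun _ => ?_
  rw [ENNReal.mul_lt_top_iff]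
  simp only [ENNReal.coe_lt_top, true_and, ENNReal.coe_eq_zero, hc.ne', false_or]
  exact or_iff_left_of_imp fun h => h ▸ ENNReal.zero_lt_top

theorem exists_modulationNorm_equiv {lam : ℝ} (hlam : lam ≠ 0) {p : ℝ≥0∞} (hp1 : 1 ≤ p)
    (hp : p ≠ ∞) {g h : 𝓢(PhaseSpace n, ℂ)} (hg : g ≠ 0) (hh : h ≠ 0) :
    ∃ C : NNReal, ∀ f : 𝓢'(PhaseSpace n, ℂ),
      modulationNorm p p g f ≤ C * twistedModulationNorm lam p p h f ∧
      twistedModulationNorm lam p p h f ≤ C * modulationNorm p p g f := by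
  obtain ⟨c, hc, h1⟩ := exists_twistedModulationNorm_eq (n := n) hlam
    (zero_lt_one.trans_le hp1).ne' hp
  obtain ⟨C1, h2⟩ := exists_modulationNorm_le hp1 hp hg h
  obtain ⟨C2, h3⟩ := exists_modulationNorm_le hp1 hp hh g
  refine ⟨max (c * C1) (C2 * c⁻¹), fun f => ⟨?_, ?_⟩⟩
  · refine (h3 f).trans ?_
    calc (C2 : ℝ≥0∞) * modulationNorm p p h f
        = (C2 * c⁻¹ : NNReal) * (c * modulationNorm p p h f) := by
          rw [← mul_assoc, ← ENNReal.coe_mul, inv_mul_cancel_right₀ hc.ne']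
      _ ≤ _ := by
          rw [h1]
          gcongr
          exact le_max_right _ _
  · rw [h1]
    calc (c : ℝ≥0∞) * modulationNorm p p h f ≤ c * (C1 * modulationNorm p p g f) := by
          gcongr
          exact h2 f
      _ = (c * C1 : NNReal) * modulationNorm p p g f := by
          rw [← mul_assoc, ← ENNReal.coe_mul]
      _ ≤ _ := by
          gcongr
          exact le_max_left _ _

end PhaseSpace
end

noncomputable section

set_option maxSynthPendingDepth 3

/-! ### The short-time Fourier transform of a twisted convolution -/

/-- Used with `A` the square of a function and `P`, `Q` translated windows, whose integrals do not
depend on the remaining variable. -/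
theorem lintegral_lintegral_lintegral_mul {X : Type*} [MeasurableSpace X] {μ : Measure X}
    [SFinite μ] {A : X → ℝ≥0∞} {P Q : X → X → ℝ≥0∞} (hA : Measurable A)
    (hP : Measurable (Function.uncurry P)) (hQ : Measurable (Function.uncurry Q)) {p q : ℝ≥0∞}
    (hp : ∀ ξ, ∫⁻ γ, P ξ γ ∂μ = p) (hq : ∀ γ, ∫⁻ η, Q η γ ∂μ = q) :
    ∫⁻ ξ, ∫⁻ η, ∫⁻ γ, A ξ * (P ξ γ * Q η γ) ∂μ ∂μ ∂μ = (∫⁻ ξ, A ξ ∂μ) * (p * q) := by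
  rw [← lintegral_mul_const _ hA]
  refine lintegral_congr fun ξ => ?_
  have hPξ : Measurable (P ξ) := hP.comp measurable_prodMk_left
  have hm : Measurable fun z : X × X => A ξ * (P ξ z.2 * Q z.1 z.2) :=
    measurable_const.mul ((hPξ.comp measurable_snd).mul hQ)
  rw [lintegral_lintegral_swap (f := fun η γ => A ξ * (P ξ γ * Q η γ)) hm.aemeasurable]
  have h1 : ∀ γ, ∫⁻ η, A ξ * (P ξ γ * Q η γ) ∂μ = A ξ * (P ξ γ * q) := by
    intro γ
    have hQγ : Measurable fun η => Q η γ := hQ.comp measurable_prodMk_right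
    rw [lintegral_const_mul _ (hQγ.const_mul _), lintegral_const_mul _ hQγ, hq]
  simp_rw [h1]
  rw [lintegral_const_mul _ (hPξ.mul_const _), lintegral_mul_const _ hPξ, hp]

theorem ennreal_mul_le_sq_add_sq (a b : ℝ≥0∞) : a * b ≤ a ^ 2 + b ^ 2 := by
  rcases le_total a b with h | h
  · calc a * b ≤ b * b := by gcongr
      _ ≤ _ := by rw [sq b]; exact le_add_self
  · calc a * b ≤ a * a := by gcongr
      _ ≤ _ := by rw [sq a]; exact le_self_add

namespace PhaseSpace

variable {n : ℕ}

theorem symp_add_left (ξ η ζ : PhaseSpace n) : symp (ξ + η) ζ = symp ξ ζ + symp η ζ := by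
  simp only [symp_eq_inner, inner_add_right, neg_add]

theorem symp_sub_left (ξ η ζ : PhaseSpace n) : symp (ξ - η) ζ = symp ξ ζ - symp η ζ := by
  simp only [symp_eq_inner, inner_sub_right, neg_sub]
  ring

theorem symp_add_right (ξ η ζ : PhaseSpace n) : symp ξ (η + ζ) = symp ξ η + symp ξ ζ := by
  simp only [symp_eq_inner, ← linearJ_apply, map_add, inner_add_left, neg_add]

theorem symp_sub_right (ξ η ζ : PhaseSpace n) : symp ξ (η - ζ) = symp ξ η - symp ξ ζ := by
  simp only [symp_eq_inner, ← linearJ_apply, map_sub, inner_sub_left, neg_sub]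
  ring

theorem symp_swap (ξ η : PhaseSpace n) : symp ξ η = -symp η ξ := by
  simp [symp]

theorem symp_self (ξ : PhaseSpace n) : symp ξ ξ = 0 := by
  simp [symp]

theorem continuous_symp : Continuous fun z : PhaseSpace n × PhaseSpace n => symp z.1 z.2 := by
  unfold symp
  fun_prop

theorem continuous_symp_comp {X : Type*} [TopologicalSpace X] {u v : X → PhaseSpace n}
    (hu : Continuous u) (hv : Continuous v) : Continuous fun x => symp (u x) (v x) :=
  continuous_symp.comp (hu.prodMk hv)

/-- The short-time Fourier transform in coordinates which are adapted to the twisted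
convolution. -/
def twistedStft (lam : ℝ) (φ : 𝓢(PhaseSpace n, ℂ)) (F : PhaseSpace n → ℂ) (α β : PhaseSpace n) :
    ℂ :=
  ∫ ξ, F ξ * ((starRingEnd ℂ) (φ (ξ - α + β)) *
    cexp (I * (lam / 2 * (symp ξ (α + β) - symp α β) : ℝ)))

variable (n) in
-- The position and frequency at which `twistedStft` is, up to a phase, the classical transform. In
-- these coordinates the two arguments act as row and column of an integral kernel.
def twistedStftLinearMap (lam : ℝ) :
    (PhaseSpace n × PhaseSpace n) →ₗ[ℝ] (PhaseSpace n × PhaseSpace n) :=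
  (LinearMap.fst ℝ (PhaseSpace n) (PhaseSpace n) - LinearMap.snd ℝ _ _).prod
    ((lam / 2) • (linearJ n).comp (LinearMap.fst ℝ (PhaseSpace n) (PhaseSpace n) + LinearMap.snd ℝ _ _))

theorem twistedStftLinearMap_apply (lam : ℝ) (z : PhaseSpace n × PhaseSpace n) :
    twistedStftLinearMap n lam z = (z.1 - z.2, (lam / 2) • J (z.1 + z.2)) := rfl

theorem twistedStftLinearMap_injective {lam : ℝ} (hlam : lam ≠ 0) :
    Function.Injective (twistedStftLinearMap n lam) := by
  rw [← LinearMap.ker_eq_bot, LinearMap.ker_eq_bot']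
  rintro ⟨α, β⟩ h
  rw [twistedStftLinearMap_apply, Prod.mk_eq_zero] at h
  obtain ⟨h1, h2⟩ := h
  have h3 : J (α + β) = 0 := (smul_eq_zero.1 h2).resolve_left (by simpa using hlam)
  have h4 : α + β = 0 := J_injective (h3.trans (map_zero (linearJ n)).symm)
  have h5 : α = β := sub_eq_zero.1 h1
  rw [h5, ← two_smul ℝ β, smul_eq_zero] at h4
  have h6 : β = 0 := h4.resolve_left two_ne_zero
  rw [h5, h6]
  rfl

theorem norm_twistedStft (lam : ℝ) (φ : 𝓢(PhaseSpace n, ℂ)) {f : 𝓢'(PhaseSpace n, ℂ)}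
    {F : PhaseSpace n → ℂ} (hF : IsGivenBy f F) (α β : PhaseSpace n) :
    ‖twistedStft lam φ F α β‖ = ‖stft φ f (twistedStftLinearMap n lam (α, β)).1
      (twistedStftLinearMap n lam (α, β)).2‖ := by
  have h : twistedStft lam φ F α β = cexp (((-(lam / 2 * symp α β) : ℝ) : ℂ) * I) *
      stft φ f (twistedStftLinearMap n lam (α, β)).1 (twistedStftLinearMap n lam (α, β)).2 := by
    rw [hF.stft_eq, twistedStft, ← integral_const_mul]
    refine integral_congr_ae (.of_forall fun ξ => ?_)
    simp only [tfShift_apply, twistedStftLinearMap_apply, map_mul, ← Complex.exp_conj,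
      Complex.conj_I, Complex.conj_ofReal, symp_eq_inner ξ, inner_smul_left, RCLike.conj_to_real]
    rw [← sub_add]
    have h2 : ∀ a b c d x : ℂ, a = c * d → x * (b * a) = c * (d * b * x) := by
      intro a b c d x h
      linear_combination x * b * h
    refine h2 _ _ _ _ _ ?_
    rw [← Complex.exp_add]
    congr 1
    push_cast
    ring
  rw [h, norm_mul, norm_exp_ofReal_mul_I, one_mul]

theorem memLp_sub_left {F : PhaseSpace n → ℂ} (hF : MemLp F 2) (ξ : PhaseSpace n) :
    MemLp (fun η => F (ξ - η)) 2 :=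
  hF.comp_measurePreserving (Measure.measurePreserving_sub_left volume ξ)

theorem norm_twistedTranslate (lam : ℝ) (η : PhaseSpace n) (G : PhaseSpace n → ℂ)
    (ξ : PhaseSpace n) : ‖twistedTranslate lam η G ξ‖ = ‖G (ξ - η)‖ := by
  simp [twistedTranslate, Complex.norm_exp]

theorem memLp_twistedTranslate (lam : ℝ) {G : PhaseSpace n → ℂ} (hG : MemLp G 2)
    (ξ : PhaseSpace n) : MemLp (fun η => twistedTranslate lam η G ξ) 2 := by
  have h := memLp_sub_left hG ξ
  refine h.of_le (h.1.mul (Continuous.aestronglyMeasurable ?_))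
    (.of_forall fun η => (norm_twistedTranslate lam η G ξ).le)
  have : Continuous fun η : PhaseSpace n => symp ξ η :=
    continuous_symp_comp continuous_const continuous_id
  fun_prop

theorem integrable_twistedConv (lam : ℝ) {F G : PhaseSpace n → ℂ} (hF : MemLp F 2)
    (hG : MemLp G 2) (ξ : PhaseSpace n) : Integrable fun η => F η * twistedTranslate lam η G ξ :=
  hF.integrable_mul (memLp_twistedTranslate lam hG ξ)

theorem stronglyMeasurable_twistedConv (lam : ℝ) {F G : PhaseSpace n → ℂ}
    (hF : StronglyMeasurable F) (hG : StronglyMeasurable G) :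
    StronglyMeasurable (twistedConv lam F G) := by
  refine StronglyMeasurable.integral_prod_right'
    (f := fun q : PhaseSpace n × PhaseSpace n => F q.2 * twistedTranslate lam q.2 G q.1) ?_
  refine (hF.comp_measurable measurable_snd).mul
    ((hG.comp_measurable (measurable_fst.sub measurable_snd)).mul
      (Continuous.stronglyMeasurable ?_))
  have := continuous_symp (n := n)
  fun_prop

theorem enorm_twistedConv_le (lam : ℝ) {F G : PhaseSpace n → ℂ} (hF : MemLp F 2)
    (hG : MemLp G 2) (ξ : PhaseSpace n) :
    ‖twistedConv lam F G ξ‖ₑ ≤ eLpNorm F 2 volume * eLpNorm G 2 volume := by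
  have h1 : eLpNorm (fun η => twistedTranslate lam η G ξ) 2 volume = eLpNorm G 2 volume := by
    rw [← eLpNorm_comp_measurePreserving hG.1 (Measure.measurePreserving_sub_left volume ξ)]
    exact eLpNorm_congr_norm_ae (.of_forall fun η => norm_twistedTranslate lam η G ξ)
  rw [← h1]
  refine (enorm_integral_le_lintegral_enorm _).trans ?_
  rw [← eLpNorm_one_eq_lintegral_enorm]
  have h2 := eLpNorm_smul_le_mul_eLpNorm (p := 2) (q := 2) (r := 1)
    (memLp_twistedTranslate lam hG ξ).1 hF.1
  exact h2

theorem twistedConv_congr (lam : ℝ) {F F' G G' : PhaseSpace n → ℂ} (hF : F =ᵐ[volume] F')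
    (hG : G =ᵐ[volume] G') : twistedConv lam F G = twistedConv lam F' G' := by
  funext ξ
  refine integral_congr_ae ?_
  filter_upwards [hF, (Measure.measurePreserving_sub_left volume ξ).quasiMeasurePreserving.ae hG]
    with η h1 h2
  simp only [twistedTranslate, h1, h2]

end PhaseSpace
end

noncomputable section

set_option maxSynthPendingDepth 3

theorem integral_integral_mul_integral {X : Type*} [MeasurableSpace X] {μ : Measure X}
    [SFinite μ] {a b : X → X → ℂ}
    (h : Integrable (fun q : (X × X) × X => a q.1.1 q.2 * b q.1.2 q.2) ((μ.prod μ).prod μ)) :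
    ∫ γ, (∫ ξ, a ξ γ ∂μ) * (∫ η, b η γ ∂μ) ∂μ = ∫ ξ, ∫ η, ∫ γ, a ξ γ * b η γ ∂μ ∂μ ∂μ := by
  have h1 : ∀ γ, (∫ ξ, a ξ γ ∂μ) * (∫ η, b η γ ∂μ) =
      ∫ z, a z.1 γ * b z.2 γ ∂(μ.prod μ) := fun γ =>
    (integral_prod_mul (μ := μ) (ν := μ) (fun ξ => a ξ γ) (fun η => b η γ)).symm
  simp_rw [h1]
  rw [← integral_integral_swap (f := fun (z : X × X) γ => a z.1 γ * b z.2 γ) h]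
  exact integral_prod (fun z : X × X => ∫ γ, a z.1 γ * b z.2 γ ∂μ) h.integral_prod_left

namespace PhaseSpace

variable {n : ℕ}

/-- The integrand of the product formula for `twistedStft`. -/
def twistedStftIntegrand (lam : ℝ) (φ ψ : 𝓢(PhaseSpace n, ℂ)) (F G : PhaseSpace n → ℂ)
    (α β ξ η γ : PhaseSpace n) : ℂ :=
  (F ξ * ((starRingEnd ℂ) (φ (ξ - α + γ)) *
    cexp (I * (lam / 2 * (symp ξ (α + γ) - symp α γ) : ℝ)))) *
  (G η * ((starRingEnd ℂ) (ψ (η - γ + β)) *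
    cexp (I * (lam / 2 * (symp η (γ + β) - symp γ β) : ℝ))))

theorem enorm_twistedStftIntegrand (lam : ℝ) (φ ψ : 𝓢(PhaseSpace n, ℂ))
    (F G : PhaseSpace n → ℂ) (α β ξ η γ : PhaseSpace n) :
    ‖twistedStftIntegrand lam φ ψ F G α β ξ η γ‖ₑ =
      (‖F ξ‖ₑ * ‖G η‖ₑ) * (‖φ (ξ - α + γ)‖ₑ * ‖ψ (η - γ + β)‖ₑ) := by
  have h1 : ∀ t : ℝ, ‖cexp (I * t)‖ₑ = 1 := fun t => by
    rw [← ofReal_norm, mul_comm, norm_exp_ofReal_mul_I, ENNReal.ofReal_one]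
  have h2 : ∀ z : ℂ, ‖(starRingEnd ℂ) z‖ₑ = ‖z‖ₑ := fun z => by
    rw [← ofReal_norm, RCLike.norm_conj, ofReal_norm]
  simp only [twistedStftIntegrand, enorm_mul, h1, h2, mul_one]
  ring

theorem measurable_enorm_schwartz_comp (φ : 𝓢(PhaseSpace n, ℂ)) {X : Type*} [MeasurableSpace X]
    {u : X → PhaseSpace n} (hu : Measurable u) : Measurable fun x => ‖φ (u x)‖ₑ :=
  (measurable_enorm_schwartz φ).comp hu

theorem lintegral_enorm_schwartz_ne_top (φ : 𝓢(PhaseSpace n, ℂ)) : ∫⁻ t, ‖φ t‖ₑ ≠ ∞ :=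
  φ.integrable.hasFiniteIntegral.ne

/-- Bound $|F(\xi)G(\eta)|$ by $|F(\xi)|^2+|G(\eta)|^2$. In each term the two windows are integrable
in the two variables left over. -/
theorem integrable_twistedStftIntegrand (lam : ℝ) (φ ψ : 𝓢(PhaseSpace n, ℂ))
    {F G : PhaseSpace n → ℂ} (hF : StronglyMeasurable F) (hF2 : ∫⁻ t, ‖F t‖ₑ ^ 2 ≠ ∞)
    (hG : StronglyMeasurable G) (hG2 : ∫⁻ t, ‖G t‖ₑ ^ 2 ≠ ∞) (α β : PhaseSpace n) :
    Integrable (fun q : (PhaseSpace n × PhaseSpace n) × PhaseSpace n =>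
      twistedStftIntegrand lam φ ψ F G α β q.1.1 q.1.2 q.2) := by
  refine ⟨?_, ?_⟩
  · refine StronglyMeasurable.aestronglyMeasurable ?_
    unfold twistedStftIntegrand
    refine ((hF.comp_measurable (measurable_fst.comp measurable_fst)).mul
      (Continuous.stronglyMeasurable ?_)).mul
      ((hG.comp_measurable (measurable_snd.comp measurable_fst)).mul
      (Continuous.stronglyMeasurable ?_))
    · have h1 := φ.continuous
      have h2 : Continuous fun q : (PhaseSpace n × PhaseSpace n) × PhaseSpace n =>
        symp q.1.1 (α + q.2) := continuous_symp_comp (by fun_prop) (by fun_prop)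
      have h3 : Continuous fun q : (PhaseSpace n × PhaseSpace n) × PhaseSpace n =>
        symp α q.2 := continuous_symp_comp (by fun_prop) (by fun_prop)
      have h4 := Complex.continuous_conj
      fun_prop
    · have h1 := ψ.continuous
      have h2 : Continuous fun q : (PhaseSpace n × PhaseSpace n) × PhaseSpace n =>
        symp q.1.2 (q.2 + β) := continuous_symp_comp (by fun_prop) (by fun_prop)
      have h3 : Continuous fun q : (PhaseSpace n × PhaseSpace n) × PhaseSpace n =>
        symp q.2 β := continuous_symp_comp (by fun_prop) (by fun_prop)
      have h4 := Complex.continuous_conj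
      fun_prop
  · have hFm : Measurable fun t => ‖F t‖ₑ ^ 2 := hF.measurable.enorm.pow_const 2
    have hGm : Measurable fun t => ‖G t‖ₑ ^ 2 := hG.measurable.enorm.pow_const 2
    have hφ : ∀ ξ, ∫⁻ γ, ‖φ (ξ - α + γ)‖ₑ = ∫⁻ t, ‖φ t‖ₑ := fun ξ =>
      lintegral_add_left_eq_self (fun t => ‖φ t‖ₑ) (ξ - α)
    have hφ' : ∀ γ, ∫⁻ ξ, ‖φ (ξ - α + γ)‖ₑ = ∫⁻ t, ‖φ t‖ₑ := fun γ => by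
      simp_rw [sub_add]
      exact lintegral_sub_right_eq_self (fun t => ‖φ t‖ₑ) (α - γ)
    have hψ : ∀ γ, ∫⁻ η, ‖ψ (η - γ + β)‖ₑ = ∫⁻ t, ‖ψ t‖ₑ := fun γ => by
      simp_rw [sub_add]
      exact lintegral_sub_right_eq_self (fun t => ‖ψ t‖ₑ) (γ - β)
    have hψ' : ∀ η, ∫⁻ γ, ‖ψ (η - γ + β)‖ₑ = ∫⁻ t, ‖ψ t‖ₑ := fun η => by
      simp_rw [sub_add_eq_add_sub]
      exact lintegral_sub_left_eq_self (fun t => ‖ψ t‖ₑ) (η + β)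
    have hm1 : Measurable fun q : (PhaseSpace n × PhaseSpace n) × PhaseSpace n =>
        ‖F q.1.1‖ₑ ^ 2 * (‖φ (q.1.1 - α + q.2)‖ₑ * ‖ψ (q.1.2 - q.2 + β)‖ₑ) :=
      (hFm.comp (measurable_fst.comp measurable_fst)).mul
        ((measurable_enorm_schwartz_comp φ (by fun_prop)).mul
          (measurable_enorm_schwartz_comp ψ (by fun_prop)))
    have hm2 : Measurable fun q : (PhaseSpace n × PhaseSpace n) × PhaseSpace n =>
        ‖G q.1.2‖ₑ ^ 2 * (‖ψ (q.1.2 - q.2 + β)‖ₑ * ‖φ (q.1.1 - α + q.2)‖ₑ) :=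
      (hGm.comp (measurable_snd.comp measurable_fst)).mul
        ((measurable_enorm_schwartz_comp ψ (by fun_prop)).mul
          (measurable_enorm_schwartz_comp φ (by fun_prop)))
    have h1 : ∫⁻ q : (PhaseSpace n × PhaseSpace n) × PhaseSpace n,
        ‖F q.1.1‖ₑ ^ 2 * (‖φ (q.1.1 - α + q.2)‖ₑ * ‖ψ (q.1.2 - q.2 + β)‖ₑ) =
          (∫⁻ t, ‖F t‖ₑ ^ 2) * ((∫⁻ t, ‖φ t‖ₑ) * ∫⁻ t, ‖ψ t‖ₑ) := by
      rw [show (volume : Measure ((PhaseSpace n × PhaseSpace n) × PhaseSpace n)) =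
        ((volume.prod volume).prod volume) from rfl, lintegral_prod _ hm1.aemeasurable,
        lintegral_prod _ hm1.lintegral_prod_right'.aemeasurable]
      exact lintegral_lintegral_lintegral_mul (μ := volume)
        (P := fun ξ γ => ‖φ (ξ - α + γ)‖ₑ) (Q := fun η γ => ‖ψ (η - γ + β)‖ₑ) hFm
        (measurable_enorm_schwartz_comp φ (by fun_prop))
        (measurable_enorm_schwartz_comp ψ (by fun_prop)) hφ hψ
    have h2 : ∫⁻ q : (PhaseSpace n × PhaseSpace n) × PhaseSpace n,
        ‖G q.1.2‖ₑ ^ 2 * (‖ψ (q.1.2 - q.2 + β)‖ₑ * ‖φ (q.1.1 - α + q.2)‖ₑ) =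
          (∫⁻ t, ‖G t‖ₑ ^ 2) * ((∫⁻ t, ‖ψ t‖ₑ) * ∫⁻ t, ‖φ t‖ₑ) := by
      rw [show (volume : Measure ((PhaseSpace n × PhaseSpace n) × PhaseSpace n)) =
        ((volume.prod volume).prod volume) from rfl, lintegral_prod _ hm2.aemeasurable,
        lintegral_prod_symm' _ hm2.lintegral_prod_right']
      exact lintegral_lintegral_lintegral_mul (μ := volume)
        (P := fun η γ => ‖ψ (η - γ + β)‖ₑ) (Q := fun ξ γ => ‖φ (ξ - α + γ)‖ₑ) hGm
        (measurable_enorm_schwartz_comp ψ (by fun_prop))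
        (measurable_enorm_schwartz_comp φ (by fun_prop)) hψ' hφ'
    have hφt := lintegral_enorm_schwartz_ne_top φ
    have hψt := lintegral_enorm_schwartz_ne_top ψ
    refine lt_of_le_of_lt (lintegral_mono (g := fun q =>
      ‖F q.1.1‖ₑ ^ 2 * (‖φ (q.1.1 - α + q.2)‖ₑ * ‖ψ (q.1.2 - q.2 + β)‖ₑ) +
      ‖G q.1.2‖ₑ ^ 2 * (‖ψ (q.1.2 - q.2 + β)‖ₑ * ‖φ (q.1.1 - α + q.2)‖ₑ)) fun q => ?_) ?_
    · dsimp only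
      rw [enorm_twistedStftIntegrand, mul_comm ‖ψ (q.1.2 - q.2 + β)‖ₑ ‖φ (q.1.1 - α + q.2)‖ₑ,
        ← add_mul]
      gcongr
      exact ennreal_mul_le_sq_add_sq _ _
    · rw [lintegral_add_left hm1, h1, h2]
      finiteness

/-- The short-time Fourier transform of a twisted convolution is a product of kernels. -/
theorem twistedStft_twistedConv (lam : ℝ) (φ ψ : 𝓢(PhaseSpace n, ℂ)) {θ : 𝓢(PhaseSpace n, ℂ)}
    (hθ : ∀ ζ, θ ζ = twistedConv lam φ ψ ζ)
    {F G : PhaseSpace n → ℂ} (hF : StronglyMeasurable F) (hF2 : ∫⁻ t, ‖F t‖ₑ ^ 2 ≠ ∞)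
    (hG : StronglyMeasurable G) (hG2 : ∫⁻ t, ‖G t‖ₑ ^ 2 ≠ ∞) (α β : PhaseSpace n) :
    twistedStft lam θ (twistedConv lam F G) α β =
      ∫ γ, twistedStft lam φ F α γ * twistedStft lam ψ G γ β := by
  have hint := integrable_twistedStftIntegrand lam φ ψ hF hF2 hG hG2 α β
  set K : PhaseSpace n × PhaseSpace n → ℂ := fun z =>
    ∫ γ, twistedStftIntegrand lam φ ψ F G α β z.1 z.2 γ with hK
  have hKint : Integrable K (volume.prod volume) := Integrable.integral_prod_left
    (f := fun q : (PhaseSpace n × PhaseSpace n) × PhaseSpace n =>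
      twistedStftIntegrand lam φ ψ F G α β q.1.1 q.1.2 q.2) (μ := volume.prod volume) hint
  have hR : ∫ γ, twistedStft lam φ F α γ * twistedStft lam ψ G γ β = ∫ ξ, ∫ η, K (ξ, η) :=
    integral_integral_mul_integral (μ := volume)
      (a := fun ξ γ => F ξ * ((starRingEnd ℂ) (φ (ξ - α + γ)) *
        cexp (I * (lam / 2 * (symp ξ (α + γ) - symp α γ) : ℝ))))
      (b := fun η γ => G η * ((starRingEnd ℂ) (ψ (η - γ + β)) *
        cexp (I * (lam / 2 * (symp η (γ + β) - symp γ β) : ℝ)))) hint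
  -- The second variable of `K` is `η = ζ - ξ`. Shifting the variable in the convolution of the
  -- windows by `ξ - α` makes it play the role of `γ`, and the symplectic phases then agree by
  -- bilinearity and antisymmetry.
  have hL : ∀ ζ, twistedConv lam F G ζ * ((starRingEnd ℂ) (θ (ζ - α + β)) *
      cexp (I * (lam / 2 * (symp ζ (α + β) - symp α β) : ℝ))) = ∫ ξ, K (ξ, ζ - ξ) := by
    intro ζ
    rw [hθ, twistedConv, twistedConv, ← integral_conj, ← integral_mul_const,
      ← integral_mul_const]
    refine integral_congr_ae (.of_forall fun ξ => ?_)
    simp only [hK]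
    rw [← integral_const_mul, ← integral_add_right_eq_self _ (ξ - α)]
    refine integral_congr_ae (.of_forall fun κ => ?_)
    simp only [twistedStftIntegrand, twistedTranslate, map_mul, ← Complex.exp_conj,
      Complex.conj_I, Complex.conj_ofReal, map_neg]
    rw [show κ + (ξ - α) = ξ - α + κ by abel,
      show ζ - α + β - (ξ - α + κ) = ζ - ξ - κ + β by abel]
    have h2 : ∀ a b c d e e1 e2 e3 e4 : ℂ, e * e1 * e2 = e3 * e4 →
        a * (b * e) * (c * (d * e1) * e2) = a * (c * e3) * (b * (d * e4)) := by
      intro a b c d e e1 e2 e3 e4 h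
      linear_combination a * b * c * d * h
    refine h2 _ _ _ _ _ _ _ _ _ ?_
    simp only [← Complex.exp_add]
    congr 1
    simp only [symp_add_left, symp_add_right, symp_sub_left, symp_sub_right, symp_self]
    rw [symp_swap α ξ, symp_swap κ β, symp_swap β ξ, symp_swap β α]
    push_cast
    ring
  rw [hR, twistedStft]
  simp_rw [hL]
  have h3 : Integrable (fun z : PhaseSpace n × PhaseSpace n => K (z.2, z.1 - z.2))
      (volume.prod volume) :=
    (measurePreserving_prod_sub_swap (volume : Measure (PhaseSpace n))
      volume).integrable_comp_of_integrable hKint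
  rw [integral_integral_swap (f := fun ζ ξ => K (ξ, ζ - ξ)) h3]
  refine integral_congr_ae (.of_forall fun ξ => ?_)
  exact integral_sub_right_eq_self (fun η => K (ξ, η)) ξ

/-- The twisted convolution of two Schwartz functions is a Schwartz function. -/
theorem exists_schwartz_twistedConv (lam : ℝ) (φ ψ : 𝓢(PhaseSpace n, ℂ)) :
    ∃ θ : 𝓢(PhaseSpace n, ℂ), ∀ ζ, θ ζ = twistedConv lam φ ψ ζ := by
  set J' : PhaseSpace n →L[ℝ] PhaseSpace n :=
    (lam / 2) • LinearMap.toContinuousLinearMap (linearJ n)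
  -- The twisted translate of `ψ` by `η` is its time-frequency shift by `u η`. Its seminorms grow
  -- polynomially, and the decay of `φ` compensates.
  set u : PhaseSpace n → PhaseSpace n × PhaseSpace n := fun η => (η, J' η)
  have hu : Continuous u := by fun_prop
  set Φ : PhaseSpace n → 𝓢(PhaseSpace n, ℂ) := fun η => φ η • tfShift (u η) ψ with hΦ
  have hcont : Continuous Φ := φ.continuous.smul ((continuous_tfShift ψ).comp hu)
  have hint : ∀ k l, Integrable fun η => SchwartzMap.seminorm ℂ k l (Φ η) := by
    intro k l
    obtain ⟨C, N, hC, h⟩ := polyBounded_tfShift ψ k l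
    refine ((integrable_one_add_norm_pow_mul N φ).const_mul (C * (1 + ‖J'‖) ^ N)).mono'
      ((continuous_schwartz_seminorm k l).comp hcont).aestronglyMeasurable
      (.of_forall fun η => ?_)
    rw [Real.norm_of_nonneg (apply_nonneg _ _), hΦ, map_smul_eq_mul]
    have h1 : 1 + ‖u η‖ ≤ (1 + ‖J'‖) * (1 + ‖η‖) := by
      have h2 := J'.le_opNorm η
      have h3 := norm_nonneg J'
      have h4 := norm_nonneg η
      have h5 : ‖u η‖ ≤ ‖η‖ + ‖J'‖ * ‖η‖ :=
        max_le (by nlinarith) (by exact h2.trans (by linarith))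
      nlinarith
    calc ‖φ η‖ * SchwartzMap.seminorm ℂ k l (tfShift (u η) ψ)
        ≤ ‖φ η‖ * (C * ((1 + ‖J'‖) * (1 + ‖η‖)) ^ N) := by
          gcongr
          refine (h _).trans ?_
          gcongr
      _ = C * (1 + ‖J'‖) ^ N * ((1 + ‖η‖) ^ N * ‖φ η‖) := by
          rw [mul_pow]
          ring
  obtain ⟨θ, hθ, -⟩ := exists_schwartz_integral hcont hint
  refine ⟨θ, fun ζ => (hθ ζ).trans (integral_congr_ae (.of_forall fun η => ?_))⟩
  simp only [hΦ, smul_apply, smul_eq_mul, tfShift_apply, twistedTranslate, symp_eq_inner]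
  rw [mul_comm (ψ _)]
  congr 3
  have h1 : J' η = (lam / 2) • J η := rfl
  simp only [u, h1, inner_smul_left, RCLike.conj_to_real]
  push_cast
  ring

/-- Every non-zero window has a partner for which the twisted convolution does not vanish. -/
theorem exists_schwartz_twistedConv_ne_zero (lam : ℝ) {φ : 𝓢(PhaseSpace n, ℂ)} (hφ : φ ≠ 0) :
    ∃ ψ θ : 𝓢(PhaseSpace n, ℂ), ψ ≠ 0 ∧ θ ≠ 0 ∧ ∀ ζ, θ ζ = twistedConv lam φ ψ ζ := by
  -- With $\psi(t)=\overline{\varphi(-t)}$ the phase vanishes at the origin and the convolution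
  -- there is $\|\varphi\|_2^2$.
  set ψ : 𝓢(PhaseSpace n, ℂ) := schwartzConj
    (SchwartzMap.compCLMOfContinuousLinearEquiv ℂ (ContinuousLinearEquiv.neg ℝ) φ)
  have hψ : ∀ t, ψ t = (starRingEnd ℂ) (φ (-t)) := fun t => rfl
  obtain ⟨θ, hθ⟩ := exists_schwartz_twistedConv lam φ ψ
  have h0 : θ 0 = ((∫ t, ‖φ t‖ ^ 2 : ℝ) : ℂ) := by
    rw [hθ, twistedConv, ← integral_complex_ofReal]
    refine integral_congr_ae (.of_forall fun η => ?_)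
    simp only [twistedTranslate, symp_eq_inner, inner_zero_right, hψ, zero_sub, neg_neg, neg_zero,
      mul_zero, Complex.ofReal_zero, Complex.exp_zero, mul_one]
    rw [Complex.mul_conj', Complex.ofReal_pow]
  have h1 := (integral_norm_sq_pos hφ).ne'
  have hθ0 : θ ≠ 0 := by
    rintro rfl
    exact h1 (Complex.ofReal_injective h0.symm)
  refine ⟨ψ, θ, ?_, hθ0, hθ⟩
  intro h
  refine hθ0 (DFunLike.ext _ _ fun ζ => ?_)
  rw [hθ, h]
  simp [twistedConv, twistedTranslate]

end PhaseSpace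
end

/-! ### Submultiplicativity of modulation norms under twisted convolution -/

noncomputable section

set_option maxSynthPendingDepth 3

section Mixed

variable {E : Type*} [NormedAddCommGroup E] [InnerProductSpace ℝ E] [FiniteDimensional ℝ E]
  [MeasurableSpace E] [BorelSpace E]

theorem exists_lintegral_mixed_stft_comp_le {r : ℝ} (hr : 1 ≤ r) (hr2 : r ≤ 2) {g : 𝓢(E, ℂ)}
    (hg : g ≠ 0) (L : (E × E) ≃L[ℝ] (E × E)) : ∃ C : NNReal, ∀ f : 𝓢'(E, ℂ),
      ∫⁻ x, (∫⁻ y, ‖stft g f (L (x, y)).1 (L (x, y)).2‖ₑ ^ 2) ^ (r / 2) ≤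
        C * ∫⁻ z : E × E, ‖stft g f z.1 z.2‖ₑ ^ r := by
  obtain ⟨C, hC⟩ := exists_decayDominated_stft hg g
  obtain ⟨C', hC'⟩ := exists_decayDominated_comp (μ := (volume : Measure (E × E)))
    (decayOrder E) C L
  obtain ⟨c, -, hc⟩ := exists_lintegral_comp_linearEquiv (volume : Measure (E × E)) L
  set B := ∫⁻ z : E × E, decayKernel (decayOrder E) z
  set B' := ∫⁻ z : E, decayKernel (decayOrder E) z
  have hB : B ≠ ∞ := lintegral_decayKernel_prod_ne_top
  have hB' : B' ≠ ∞ := lintegral_decayKernel_ne_top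
  set K : ℝ≥0∞ := (C' : ℝ≥0∞) ^ r * B ^ (r - 1) * B' + 1
  have hKt : K ≠ ∞ := by
    refine ENNReal.add_ne_top.2 ⟨ENNReal.mul_ne_top (ENNReal.mul_ne_top ?_ ?_) hB', by simp⟩
    · exact ENNReal.rpow_ne_top_of_nonneg (by linarith) ENNReal.coe_ne_top
    · exact ENNReal.rpow_ne_top_of_nonneg (by linarith) hB
  refine ⟨K.toNNReal * c, fun f => ?_⟩
  have hm : Measurable ((fun z : E × E => ‖stft g f z.1 z.2‖ₑ) ∘ L) :=
    (measurable_enorm_stft g f).comp L.continuous.measurable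
  rw [ENNReal.coe_mul, ENNReal.coe_toNNReal hKt, mul_assoc,
    ← hc fun z => ‖stft g f z.1 z.2‖ₑ ^ r]
  exact (hC' _ _ (hC f)).lintegral_mixed_le (μ := (volume : Measure E))
    (ν := (volume : Measure E)) hm hr hr2

end Mixed

theorem lintegral_mul_sq_le {X : Type*} [MeasurableSpace X] {μ : Measure X} {u v : X → ℝ≥0∞}
    (hu : AEMeasurable u μ) (hv : AEMeasurable v μ) :
    (∫⁻ x, u x * v x ∂μ) ^ 2 ≤ (∫⁻ x, u x ^ 2 ∂μ) * ∫⁻ x, v x ^ 2 ∂μ := by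
  have h := ENNReal.lintegral_mul_le_Lp_mul_Lq μ Real.HolderConjugate.two_two hu hv
  simp only [ENNReal.rpow_two, Pi.mul_apply] at h
  calc (∫⁻ x, u x * v x ∂μ) ^ 2 ≤ ((∫⁻ x, u x ^ 2 ∂μ) ^ (1 / 2 : ℝ) *
        (∫⁻ x, v x ^ 2 ∂μ) ^ (1 / 2 : ℝ)) ^ 2 := by gcongr
    _ = _ := by
        rw [mul_pow, ← ENNReal.rpow_natCast, ← ENNReal.rpow_natCast, ← ENNReal.rpow_mul,
          ← ENNReal.rpow_mul]
        norm_num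

namespace PhaseSpace

variable {n : ℕ}

theorem lintegral_enorm_lp_sq_ne_top (F : Lp ℂ 2 (volume : Measure (PhaseSpace n))) :
    ∫⁻ t, ‖F t‖ₑ ^ 2 ≠ ∞ := by
  rw [← lp_enorm_sq]
  finiteness

variable (n) in
/-- `twistedStftLinearMap` as an equivalence. -/
def twistedStftEquiv {lam : ℝ} (hlam : lam ≠ 0) :
    (PhaseSpace n × PhaseSpace n) ≃L[ℝ] (PhaseSpace n × PhaseSpace n) :=
  continuousLinearEquivOfInjective _ (twistedStftLinearMap_injective hlam)

theorem enorm_twistedStft {lam : ℝ} (hlam : lam ≠ 0) (φ : 𝓢(PhaseSpace n, ℂ))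
    {f : 𝓢'(PhaseSpace n, ℂ)} {F : PhaseSpace n → ℂ} (hF : IsGivenBy f F) (α β : PhaseSpace n) :
    ‖twistedStft lam φ F α β‖ₑ = ‖stft φ f (twistedStftEquiv n hlam (α, β)).1
      (twistedStftEquiv n hlam (α, β)).2‖ₑ := by
  rw [← ofReal_norm, norm_twistedStft lam φ hF, ofReal_norm]
  rfl

/-- The basic estimate for the short-time Fourier transform of a twisted convolution. -/
theorem exists_lintegral_stft_twistedConv_le {lam : ℝ} (hlam : lam ≠ 0) {r : ℝ} (hr : 1 ≤ r)
    (hr2 : r ≤ 2) {φ ψ θ : 𝓢(PhaseSpace n, ℂ)} (hφ : φ ≠ 0) (hψ : ψ ≠ 0)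
    (hθ : ∀ ζ, θ ζ = twistedConv lam φ ψ ζ) :
    ∃ C : NNReal, ∀ (F G : Lp ℂ 2 (volume : Measure (PhaseSpace n))) (f : 𝓢'(PhaseSpace n, ℂ)),
      IsGivenBy f (twistedConv lam F G) →
      ∫⁻ z : PhaseSpace n × PhaseSpace n, ‖stft θ f z.1 z.2‖ₑ ^ r ≤
        C * (∫⁻ z : PhaseSpace n × PhaseSpace n, ‖stft φ (lpDist F) z.1 z.2‖ₑ ^ r) *
          ∫⁻ z : PhaseSpace n × PhaseSpace n, ‖stft ψ (lpDist G) z.1 z.2‖ₑ ^ r := by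
  set L := twistedStftEquiv n hlam
  obtain ⟨C1, h1⟩ := exists_lintegral_mixed_stft_comp_le hr hr2 hφ L
  -- The coordinates are swapped because `γ` is the first argument of the kernel of `G`.
  obtain ⟨C2, h2⟩ := exists_lintegral_mixed_stft_comp_le hr hr2 hψ
    ((ContinuousLinearEquiv.prodComm ℝ (PhaseSpace n) (PhaseSpace n)).trans L)
  obtain ⟨c, hc0, hc⟩ := exists_lintegral_comp_linearEquiv
    (volume : Measure (PhaseSpace n × PhaseSpace n)) L
  refine ⟨c⁻¹ * (C1 * C2), fun F G f hf => ?_⟩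
  set A : PhaseSpace n → ℝ≥0∞ := fun α =>
    ∫⁻ γ, ‖stft φ (lpDist F) (L (α, γ)).1 (L (α, γ)).2‖ₑ ^ 2 with hA
  set B : PhaseSpace n → ℝ≥0∞ := fun β =>
    ∫⁻ γ, ‖stft ψ (lpDist G) (L (γ, β)).1 (L (γ, β)).2‖ₑ ^ 2 with hB
  have hmφ : Measurable fun z : PhaseSpace n × PhaseSpace n =>
      ‖stft φ (lpDist F) (L z).1 (L z).2‖ₑ :=
    (measurable_enorm_stft φ (lpDist F)).comp L.continuous.measurable
  have hmψ : Measurable fun z : PhaseSpace n × PhaseSpace n =>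
      ‖stft ψ (lpDist G) (L z).1 (L z).2‖ₑ :=
    (measurable_enorm_stft ψ (lpDist G)).comp L.continuous.measurable
  have hAm : Measurable A := (hmφ.pow_const 2).lintegral_prod_right'
  have hBm : Measurable B := (hmψ.pow_const 2).lintegral_prod_left'
  -- Cauchy–Schwarz in `γ` bounds the kernel product by a function of `α` times a function of `β`,
  -- so that the double integral factors.
  have key : ∀ α β, ‖stft θ f (L (α, β)).1 (L (α, β)).2‖ₑ ^ r ≤ A α ^ (r / 2) * B β ^ (r / 2) := by
    intro α β
    have h3 : ‖stft θ f (L (α, β)).1 (L (α, β)).2‖ₑ ^ 2 ≤ A α * B β := by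
      rw [← enorm_twistedStft hlam θ hf, twistedStft_twistedConv lam φ ψ hθ
        (Lp.stronglyMeasurable F) (lintegral_enorm_lp_sq_ne_top F) (Lp.stronglyMeasurable G)
        (lintegral_enorm_lp_sq_ne_top G)]
      refine le_trans ?_ (lintegral_mul_sq_le (hmφ.comp measurable_prodMk_left).aemeasurable
        (hmψ.comp measurable_prodMk_right).aemeasurable)
      gcongr
      refine (enorm_integral_le_lintegral_enorm _).trans (le_of_eq (lintegral_congr fun γ => ?_))
      rw [enorm_mul, enorm_twistedStft hlam φ (isGivenBy_lpDist F),
        enorm_twistedStft hlam ψ (isGivenBy_lpDist G)]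
    rw [← ENNReal.mul_rpow_of_nonneg _ _ (by positivity)]
    refine le_trans (le_of_eq ?_) (ENNReal.rpow_le_rpow h3 (by positivity))
    rw [← ENNReal.rpow_two, ← ENNReal.rpow_mul]
    congr 1
    ring
  have h4 : (c : ℝ≥0∞) * ∫⁻ z : PhaseSpace n × PhaseSpace n, ‖stft θ f z.1 z.2‖ₑ ^ r ≤
      (∫⁻ α, A α ^ (r / 2)) * ∫⁻ β, B β ^ (r / 2) := by
    rw [← hc fun z => ‖stft θ f z.1 z.2‖ₑ ^ r,
      ← lintegral_prod_mul (hAm.pow_const _).aemeasurable (hBm.pow_const _).aemeasurable]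
    exact lintegral_mono fun z => key z.1 z.2
  have hc0' : (c : ℝ≥0∞) ≠ 0 := by simpa using hc0.ne'
  calc ∫⁻ z : PhaseSpace n × PhaseSpace n, ‖stft θ f z.1 z.2‖ₑ ^ r
      = (c : ℝ≥0∞)⁻¹ * (c * ∫⁻ z : PhaseSpace n × PhaseSpace n, ‖stft θ f z.1 z.2‖ₑ ^ r) := by
        rw [← mul_assoc, ENNReal.inv_mul_cancel hc0' ENNReal.coe_ne_top, one_mul]
    _ ≤ (c : ℝ≥0∞)⁻¹ * ((C1 * ∫⁻ z : PhaseSpace n × PhaseSpace n,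
          ‖stft φ (lpDist F) z.1 z.2‖ₑ ^ r) *
          (C2 * ∫⁻ z : PhaseSpace n × PhaseSpace n, ‖stft ψ (lpDist G) z.1 z.2‖ₑ ^ r)) := by
        exact mul_le_mul' le_rfl (h4.trans (mul_le_mul' (h1 (lpDist F)) (h2 (lpDist G))))
    _ = _ := by
        rw [ENNReal.coe_mul, ENNReal.coe_mul, ENNReal.coe_inv hc0.ne']
        ring

/-- The tempered distribution which is given by the twisted convolution of `L^2` functions. -/
theorem exists_isGivenBy_twistedConv (lam : ℝ)
    (F G : Lp ℂ 2 (volume : Measure (PhaseSpace n))) :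
    ∃ f : 𝓢'(PhaseSpace n, ℂ), IsGivenBy f (twistedConv lam F G) := by
  -- At this stage only boundedness is known, which is enough to define a distribution.
  have h1 : MemLp (twistedConv lam F G) ∞ (volume : Measure (PhaseSpace n)) := by
    refine ⟨(stronglyMeasurable_twistedConv lam (Lp.stronglyMeasurable F)
      (Lp.stronglyMeasurable G)).aestronglyMeasurable, ?_⟩
    rw [eLpNorm_exponent_top]
    refine lt_of_le_of_lt (eLpNormEssSup_le_of_ae_enorm_bound (.of_forall
      (enorm_twistedConv_le lam (Lp.memLp F) (Lp.memLp G)))) ?_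
    exact ENNReal.mul_lt_top (Lp.eLpNorm_lt_top F) (Lp.eLpNorm_lt_top G)
  refine ⟨Lp.toTemperedDistribution (h1.toLp _), h1.locallyIntegrable le_top, fun φ =>
    ⟨integrable_schwartz_mul_of_memLp le_top h1 φ, ?_⟩⟩
  rw [Lp.toTemperedDistribution_apply]
  refine integral_congr_ae ?_
  filter_upwards [h1.coeFn_toLp] with t ht
  rw [ht, smul_eq_mul]

/-- Twisted convolution is submultiplicative up to a constant. -/
theorem exists_modulationNorm_twistedConv_le {lam : ℝ} (hlam : lam ≠ 0) {p : ℝ≥0∞} (hp1 : 1 ≤ p)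
    (hp2 : p ≤ 2) {h : 𝓢(PhaseSpace n, ℂ)} (hh : h ≠ 0) : ∃ C : NNReal,
      ∀ (F G : Lp ℂ 2 (volume : Measure (PhaseSpace n))) (f : 𝓢'(PhaseSpace n, ℂ)),
        IsGivenBy f (twistedConv lam F G) → modulationNorm p p h f ≤
          C * modulationNorm p p h (lpDist F) * modulationNorm p p h (lpDist G) := by
  have hp : p ≠ ∞ := (hp2.trans_lt ENNReal.ofNat_lt_top).ne
  have hp0 : p ≠ 0 := (zero_lt_one.trans_le hp1).ne'
  have hr : 1 ≤ p.toReal := by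
    rw [← ENNReal.toReal_one]; exact ENNReal.toReal_mono hp hp1
  have hr2 : p.toReal ≤ 2 := by
    have := ENNReal.toReal_mono ENNReal.ofNat_ne_top hp2
    simpa using this
  have hr0 : 0 ≤ 1 / p.toReal := by positivity
  -- The product formula involves the three windows `h`, `ψ` and `θ`; as `θ ≠ 0`, changes of window
  -- bring the estimate back to `h` alone.
  obtain ⟨ψ, θ, hψ, hθ0, hθ⟩ := exists_schwartz_twistedConv_ne_zero lam hh
  obtain ⟨C1, h1⟩ := exists_lintegral_stft_twistedConv_le hlam hr hr2 hh hψ hθ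
  obtain ⟨C2, h2⟩ := exists_modulationNorm_le hp1 hp hθ0 h
  obtain ⟨C3, h3⟩ := exists_modulationNorm_le hp1 hp hh ψ
  refine ⟨C2 * (C1 ^ (1 / p.toReal) * C3), fun F G f hf => ?_⟩
  have h4 : modulationNorm p p θ f ≤ (C1 ^ (1 / p.toReal) : NNReal) *
      modulationNorm p p h (lpDist F) * modulationNorm p p ψ (lpDist G) := by
    rw [modulationNorm_eq hp0 hp, modulationNorm_eq hp0 hp, modulationNorm_eq hp0 hp,
      ENNReal.coe_rpow_of_nonneg _ hr0, ← ENNReal.mul_rpow_of_nonneg _ _ hr0,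
      ← ENNReal.mul_rpow_of_nonneg _ _ hr0]
    exact ENNReal.rpow_le_rpow (h1 F G f hf) hr0
  calc modulationNorm p p h f ≤ C2 * ((C1 ^ (1 / p.toReal) : NNReal) *
        modulationNorm p p h (lpDist F) * (C3 * modulationNorm p p h (lpDist G))) := by
        refine (h2 f).trans ?_
        gcongr
        refine h4.trans ?_
        gcongr
        exact h3 _
    _ = _ := by
        rw [ENNReal.coe_mul, ENNReal.coe_mul]
        ring

end PhaseSpace
end

noncomputable section

set_option maxSynthPendingDepth 3

/-! ### Twisted convolution on `L^2` -/

namespace PhaseSpace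

variable {n : ℕ}

/-- The case $p=2$ of the product estimate, read through $M^{2,2}=L^2$ with equivalent norms; `h` is
an auxiliary window. -/
theorem exists_lp_twistedConv {lam : ℝ} (hlam : lam ≠ 0) {h : 𝓢(PhaseSpace n, ℂ)} (hh : h ≠ 0) :
    ∃ C : NNReal, ∀ F G : Lp ℂ 2 (volume : Measure (PhaseSpace n)),
      ∃ H : Lp ℂ 2 (volume : Measure (PhaseSpace n)),
        H =ᵐ[volume] twistedConv lam F G ∧ ‖H‖ ≤ C * ‖F‖ * ‖G‖ := by
  obtain ⟨C1, h1⟩ := exists_modulationNorm_twistedConv_le (n := n) hlam one_le_two le_rfl hh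
  obtain ⟨C2, h2⟩ := exists_lintegral_stft_sq_le h
  obtain ⟨C3, h3⟩ := exists_lpDist_eq_of_modulationNorm (p := 2) one_le_two le_rfl hh
  set D : NNReal := C2 ^ (1 / 2 : ℝ)
  have h4 : ∀ F : Lp ℂ 2 (volume : Measure (PhaseSpace n)),
      modulationNorm 2 2 h (lpDist F) ≤ D * ‖F‖ₑ := by
    intro F
    rw [modulationNorm_eq two_ne_zero ENNReal.ofNat_ne_top]
    simp only [ENNReal.toReal_ofNat, ENNReal.rpow_two]
    refine (ENNReal.rpow_le_rpow (h2 F) (by positivity)).trans (le_of_eq ?_)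
    rw [ENNReal.mul_rpow_of_nonneg _ _ (by positivity), ENNReal.coe_rpow_of_nonneg _ (by positivity),
      ← ENNReal.rpow_two, ← ENNReal.rpow_mul]
    norm_num
  refine ⟨C3 * (C1 * D * D), fun F G => ?_⟩
  obtain ⟨f, hf⟩ := exists_isGivenBy_twistedConv lam F G
  have h5 : modulationNorm 2 2 h f ≤ C1 * (D * ‖F‖ₑ) * (D * ‖G‖ₑ) := by
    refine (h1 F G f hf).trans ?_
    gcongr
    · exact h4 F
    · exact h4 G
  obtain ⟨H, hH, hHn⟩ := h3 f (ne_top_of_le_ne_top (by finiteness) h5)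
  have h6 : IsGivenBy f H := hH ▸ isGivenBy_lpDist H
  refine ⟨H, h6.ae_eq hf, ?_⟩
  have h7 : ‖H‖ₑ ≤ ((C3 * (C1 * D * D) * ‖F‖₊ * ‖G‖₊ : NNReal) : ℝ≥0∞) := by
    refine hHn.trans ?_
    calc (C3 : ℝ≥0∞) * modulationNorm 2 2 h f ≤ C3 * (C1 * (D * ‖F‖ₑ) * (D * ‖G‖ₑ)) := by gcongr
      _ = _ := by
        simp only [ENNReal.coe_mul, ← enorm_eq_nnnorm]
        ring
  rw [enorm_eq_nnnorm, ENNReal.coe_le_coe] at h7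
  exact_mod_cast h7

theorem twistedTranslate_add (lam : ℝ) (η : PhaseSpace n) (G G' : PhaseSpace n → ℂ)
    (ξ : PhaseSpace n) : twistedTranslate lam η (G + G') ξ =
      twistedTranslate lam η G ξ + twistedTranslate lam η G' ξ := by
  simp only [twistedTranslate, Pi.add_apply, add_mul]

theorem twistedConv_add_left (lam : ℝ) {F F' G : PhaseSpace n → ℂ} (hF : MemLp F 2)
    (hF' : MemLp F' 2) (hG : MemLp G 2) :
    twistedConv lam (F + F') G = twistedConv lam F G + twistedConv lam F' G := by
  funext ξ
  simp only [twistedConv, Pi.add_apply, add_mul]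
  exact integral_add (integrable_twistedConv lam hF hG ξ) (integrable_twistedConv lam hF' hG ξ)

theorem twistedConv_add_right (lam : ℝ) {F G G' : PhaseSpace n → ℂ} (hF : MemLp F 2)
    (hG : MemLp G 2) (hG' : MemLp G' 2) :
    twistedConv lam F (G + G') = twistedConv lam F G + twistedConv lam F G' := by
  funext ξ
  simp only [twistedConv, Pi.add_apply, twistedTranslate_add, mul_add]
  exact integral_add (integrable_twistedConv lam hF hG ξ) (integrable_twistedConv lam hF hG' ξ)

theorem twistedConv_smul_left (lam : ℝ) (c : ℂ) (F G : PhaseSpace n → ℂ) :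
    twistedConv lam (c • F) G = c • twistedConv lam F G := by
  funext ξ
  simp only [twistedConv, Pi.smul_apply, smul_eq_mul, mul_assoc]
  exact integral_const_mul _ _

theorem twistedConv_smul_right (lam : ℝ) (c : ℂ) (F G : PhaseSpace n → ℂ) :
    twistedConv lam F (c • G) = c • twistedConv lam F G := by
  funext ξ
  simp only [twistedConv, twistedTranslate, Pi.smul_apply, smul_eq_mul]
  rw [← integral_const_mul]
  exact integral_congr_ae (.of_forall fun η => by ring)

/-- Twisted convolution is a bounded bilinear map on `L^2`. -/
theorem exists_twistedMul {lam : ℝ} (hlam : lam ≠ 0) {h : 𝓢(PhaseSpace n, ℂ)} (hh : h ≠ 0) :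
    ∃ B : Lp ℂ 2 (volume : Measure (PhaseSpace n)) →L[ℂ]
        Lp ℂ 2 (volume : Measure (PhaseSpace n)) →L[ℂ] Lp ℂ 2 (volume : Measure (PhaseSpace n)),
      ∀ F G, B F G =ᵐ[volume] twistedConv lam F G := by
  obtain ⟨C, hC⟩ := exists_lp_twistedConv (n := n) hlam hh
  choose m hm hmn using hC
  refine ⟨(LinearMap.mk₂ ℂ m ?_ ?_ ?_ ?_).mkContinuous₂ C hmn, hm⟩
  · intro F F' G
    refine Lp.ext ((hm _ _).trans ?_)
    rw [twistedConv_congr lam (Lp.coeFn_add F F') (Filter.EventuallyEq.refl _ G),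
      twistedConv_add_left lam (Lp.memLp F) (Lp.memLp F') (Lp.memLp G)]
    exact ((hm F G).add (hm F' G)).symm.trans (Lp.coeFn_add _ _).symm
  · intro c F G
    refine Lp.ext ((hm _ _).trans ?_)
    rw [twistedConv_congr lam (Lp.coeFn_smul c F) (Filter.EventuallyEq.refl _ G),
      twistedConv_smul_left]
    exact ((hm F G).const_smul c).symm.trans (Lp.coeFn_smul _ _).symm
  · intro F G G'
    refine Lp.ext ((hm _ _).trans ?_)
    rw [twistedConv_congr lam (Filter.EventuallyEq.refl _ F) (Lp.coeFn_add G G'),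
      twistedConv_add_right lam (Lp.memLp F) (Lp.memLp G) (Lp.memLp G')]
    exact ((hm F G).add (hm F G')).symm.trans (Lp.coeFn_add _ _).symm
  · intro c F G
    refine Lp.ext ((hm _ _).trans ?_)
    rw [twistedConv_congr lam (Filter.EventuallyEq.refl _ F) (Lp.coeFn_smul c G),
      twistedConv_smul_right]
    exact ((hm F G).const_smul c).symm.trans (Lp.coeFn_smul _ _).symm

/-- Fubini, with absolute convergence because `φ` is integrable while $|GH|\le|G|^2+|H|^2$. The
phases match by the cocycle identity of the symplectic form. -/
theorem twistedConv_assoc_of_schwartz (lam : ℝ) (φ : 𝓢(PhaseSpace n, ℂ)) {G H : PhaseSpace n → ℂ}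
    (hG : StronglyMeasurable G) (hG2 : ∫⁻ t, ‖G t‖ₑ ^ 2 ≠ ∞)
    (hH : StronglyMeasurable H) (hH2 : ∫⁻ t, ‖H t‖ₑ ^ 2 ≠ ∞) :
    twistedConv lam (twistedConv lam φ G) H = twistedConv lam φ (twistedConv lam G H) := by
  funext ξ
  have hint : Integrable (fun q : PhaseSpace n × PhaseSpace n =>
      φ q.2 * twistedTranslate lam q.2 G q.1 * twistedTranslate lam q.1 H ξ)
      (volume.prod volume) := by
    refine ⟨?_, ?_⟩
    · refine StronglyMeasurable.aestronglyMeasurable ?_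
      refine ((φ.continuous.comp continuous_snd).stronglyMeasurable.mul
        ((hG.comp_measurable (measurable_fst.sub measurable_snd)).mul
          (Continuous.stronglyMeasurable ?_))).mul
        ((hH.comp_measurable (measurable_const.sub measurable_fst)).mul
          (Continuous.stronglyMeasurable ?_))
      · have := continuous_symp (n := n)
        fun_prop
      · have : Continuous fun q : PhaseSpace n × PhaseSpace n => symp ξ q.1 :=
          continuous_symp_comp continuous_const continuous_fst
        fun_prop
    · have hGm : Measurable fun t => ‖G t‖ₑ ^ 2 := hG.measurable.enorm.pow_const 2
      have hHm : Measurable fun t => ‖H t‖ₑ ^ 2 := hH.measurable.enorm.pow_const 2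
      have hGm' : Measurable fun q : PhaseSpace n × PhaseSpace n => ‖G (q.1 - q.2)‖ₑ ^ 2 :=
        hGm.comp (measurable_fst.sub measurable_snd)
      have hHm' : Measurable fun q : PhaseSpace n × PhaseSpace n => ‖H (ξ - q.1)‖ₑ ^ 2 :=
        hHm.comp (measurable_const.sub measurable_fst)
      have hm : Measurable fun q : PhaseSpace n × PhaseSpace n =>
          ‖φ q.2‖ₑ * (‖G (q.1 - q.2)‖ₑ ^ 2 + ‖H (ξ - q.1)‖ₑ ^ 2) :=
        (measurable_enorm_schwartz_comp φ measurable_snd).mul (hGm'.add hHm')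
      have h1 : ∀ (η : PhaseSpace n) (K : PhaseSpace n → ℂ) (ζ : PhaseSpace n),
          ‖twistedTranslate lam η K ζ‖ₑ = ‖K (ζ - η)‖ₑ := fun η K ζ => by
        rw [← ofReal_norm, norm_twistedTranslate, ofReal_norm]
      have hφt := lintegral_enorm_schwartz_ne_top φ
      calc ∫⁻ q : PhaseSpace n × PhaseSpace n,
            ‖φ q.2 * twistedTranslate lam q.2 G q.1 * twistedTranslate lam q.1 H ξ‖ₑ
              ∂(volume.prod volume)
          ≤ ∫⁻ q : PhaseSpace n × PhaseSpace n,
            ‖φ q.2‖ₑ * (‖G (q.1 - q.2)‖ₑ ^ 2 + ‖H (ξ - q.1)‖ₑ ^ 2) ∂(volume.prod volume) := by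
            refine lintegral_mono fun q => ?_
            simp only [enorm_mul, h1, mul_assoc]
            gcongr
            exact ennreal_mul_le_sq_add_sq _ _
        _ = ∫⁻ ζ, ‖φ ζ‖ₑ * ((∫⁻ t, ‖G t‖ₑ ^ 2) + ∫⁻ t, ‖H t‖ₑ ^ 2) := by
            rw [lintegral_prod_symm' _ hm]
            refine lintegral_congr fun ζ => ?_
            have hGζ : Measurable fun η => ‖G (η - ζ)‖ₑ ^ 2 :=
              hGm.comp (measurable_id.sub measurable_const)
            have hHζ : Measurable fun η => ‖H (ξ - η)‖ₑ ^ 2 :=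
              hHm.comp (measurable_const.sub measurable_id)
            dsimp only
            rw [lintegral_const_mul _ (by exact hGζ.add hHζ), lintegral_add_left hGζ,
              lintegral_sub_right_eq_self (fun t => ‖G t‖ₑ ^ 2),
              lintegral_sub_left_eq_self (fun t => ‖H t‖ₑ ^ 2)]
        _ = (∫⁻ ζ, ‖φ ζ‖ₑ) * ((∫⁻ t, ‖G t‖ₑ ^ 2) + ∫⁻ t, ‖H t‖ₑ ^ 2) :=
            lintegral_mul_const _ (measurable_enorm_schwartz φ)
        _ < ∞ := by finiteness
  have h2 : twistedConv lam (twistedConv lam φ G) H ξ =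
      ∫ η, ∫ ζ, φ ζ * twistedTranslate lam ζ G η * twistedTranslate lam η H ξ := by
    refine integral_congr_ae (.of_forall fun η => ?_)
    exact (integral_mul_const _ _).symm
  rw [h2, integral_integral_swap
    (f := fun η ζ => φ ζ * twistedTranslate lam ζ G η * twistedTranslate lam η H ξ) hint]
  refine integral_congr_ae (.of_forall fun ζ => ?_)
  simp only [twistedTranslate, twistedConv]
  rw [← integral_mul_const, ← integral_const_mul, ← integral_add_right_eq_self _ ζ]
  refine integral_congr_ae (.of_forall fun κ => ?_)
  simp only
  rw [add_sub_cancel_right, show ξ - (κ + ζ) = ξ - ζ - κ by abel]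
  have h3 : ∀ a b c e1 e2 e3 e4 : ℂ, e1 * e2 = e3 * e4 →
      a * (b * e1) * (c * e2) = a * (b * (c * e3) * e4) := by
    intro a b c e1 e2 e3 e4 h
    linear_combination a * b * c * h
  refine h3 _ _ _ _ _ _ _ ?_
  rw [← Complex.exp_add, ← Complex.exp_add]
  congr 1
  simp only [symp_add_left, symp_add_right, symp_sub_left, symp_self]
  rw [symp_swap ζ κ]
  push_cast
  ring

/-- Both sides are continuous in `F` for the $L^2$ norm, so Schwartz functions `F` suffice. -/
theorem twistedMul_assoc {lam : ℝ}
    {B : Lp ℂ 2 (volume : Measure (PhaseSpace n)) →L[ℂ]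
      Lp ℂ 2 (volume : Measure (PhaseSpace n)) →L[ℂ] Lp ℂ 2 (volume : Measure (PhaseSpace n))}
    (hB : ∀ F G, B F G =ᵐ[volume] twistedConv lam F G)
    (F G H : Lp ℂ 2 (volume : Measure (PhaseSpace n))) : B (B F G) H = B F (B G H) := by
  refine DenseRange.induction_on (p := fun F => B (B F G) H = B F (B G H))
    (SchwartzMap.denseRange_toLpCLM (E := PhaseSpace n) (F := ℂ) (μ := volume) (p := 2)
      ENNReal.ofNat_ne_top) F ?_ fun φ => ?_
  · refine isClosed_eq ?_ ?_ <;> fun_prop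
  · refine Lp.ext ?_
    set Φ : Lp ℂ 2 (volume : Measure (PhaseSpace n)) := SchwartzMap.toLpCLM ℝ ℂ 2 volume φ
    have hΦ : Φ =ᵐ[volume] φ := φ.coeFn_toLp 2 volume
    refine (hB _ _).trans (Filter.EventuallyEq.trans ?_ (hB _ _).symm)
    rw [twistedConv_congr lam (hB Φ G) (Filter.EventuallyEq.refl _ H),
      twistedConv_congr lam (Filter.EventuallyEq.refl _ Φ) (hB G H),
      twistedConv_congr lam hΦ (Filter.EventuallyEq.refl _ G),
      twistedConv_congr lam hΦ (Filter.EventuallyEq.refl _ (twistedConv lam G H)),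
      twistedConv_assoc_of_schwartz lam φ (Lp.stronglyMeasurable G)
        (lintegral_enorm_lp_sq_ne_top G) (Lp.stronglyMeasurable H)
        (lintegral_enorm_lp_sq_ne_top H)]

end PhaseSpace
end

/-! ### Construction of the Banach algebra -/

noncomputable section

set_option maxSynthPendingDepth 3

/-- A product on a vector space which is submultiplicative for the norm induced by an injective
map with closed range defines a Banach algebra. -/
theorem exists_banachAlgebra {V : Type} [AddCommGroup V] [Module ℂ V] {X : Type*}
    [NormedAddCommGroup X] [NormedSpace ℂ X] [CompleteSpace X] (mul : V →ₗ[ℂ] V →ₗ[ℂ] V)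
    (hassoc : ∀ a b c, mul (mul a b) c = mul a (mul b c)) (T : V →ₗ[ℂ] X)
    (hT : Function.Injective T) (hcl : IsClosed (Set.range T))
    (hmul : ∀ a b, ‖T (mul a b)‖ ≤ ‖T a‖ * ‖T b‖) :
    ∃ (A : Type) (_ : NonUnitalNormedRing A) (_ : NormedSpace ℂ A) (_ : IsScalarTower ℂ A A)
      (_ : SMulCommClass ℂ A A) (_ : CompleteSpace A) (e : A ≃ₗ[ℂ] V),
      (∀ a, ‖a‖ = ‖T (e a)‖) ∧ ∀ a b, e (a * b) = mul (e a) (e b) := by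
  let i1 : NormedAddCommGroup V := NormedAddCommGroup.induced V X T hT
  let i2 : NormedSpace ℂ V := NormedSpace.induced ℂ V X T
  let i3 : NonUnitalNormedRing V :=
    { i1 with
      mul := fun a b => mul a b
      left_distrib := fun a b c => map_add (mul a) b c
      right_distrib := fun a b c => by
        change mul (a + b) c = mul a c + mul b c
        rw [map_add, LinearMap.add_apply]
      zero_mul := fun a => by
        change mul 0 a = 0
        rw [map_zero, LinearMap.zero_apply]
      mul_zero := fun a => map_zero (mul a)
      mul_assoc := hassoc
      norm_mul_le := hmul }
  have hiso : Isometry T := AddMonoidHomClass.isometry_of_norm T fun a => rfl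
  refine ⟨V, i3, i2, ⟨fun c a b => ?_⟩, ⟨fun c a b => ?_⟩, ?_, LinearEquiv.refl ℂ V, fun a => rfl,
    fun a b => rfl⟩
  · change mul (c • a) b = c • mul a b
    rw [map_smul, LinearMap.smul_apply]
  · change c • mul a b = mul a (c • b)
    rw [map_smul]
  · exact (completeSpace_iff_isComplete_range hiso.isUniformInducing).2 hcl.isComplete


/-- Multiplying the norm by a constant at least `K` absorbs `K`. The choice `K + 1` keeps the factor
nonzero even when `K = 0`. -/
theorem exists_banachAlgebra_of_le {V : Type} [AddCommGroup V] [Module ℂ V] {X : Type*}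
    [NormedAddCommGroup X] [NormedSpace ℂ X] [CompleteSpace X] (mul : V →ₗ[ℂ] V →ₗ[ℂ] V)
    (hassoc : ∀ a b c, mul (mul a b) c = mul a (mul b c)) (T : V →ₗ[ℂ] X)
    (hT : Function.Injective T) (hcl : IsClosed (Set.range T)) (K : NNReal)
    (hmul : ∀ a b, ‖T (mul a b)‖ ≤ K * ‖T a‖ * ‖T b‖) :
    ∃ (A : Type) (_ : NonUnitalNormedRing A) (_ : NormedSpace ℂ A) (_ : IsScalarTower ℂ A A)
      (_ : SMulCommClass ℂ A A) (_ : CompleteSpace A) (e : A ≃ₗ[ℂ] V),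
      (∀ a, ‖a‖ = (K + 1) * ‖T (e a)‖) ∧ ∀ a b, e (a * b) = mul (e a) (e b) := by
  set k : ℂ := ((K + 1 : ℝ) : ℂ)
  have hk0 : k ≠ 0 := by
    have : (0 : ℝ) < K + 1 := by positivity
    exact Complex.ofReal_ne_zero.2 this.ne'
  have hn : ∀ a, ‖(k • T) a‖ = (K + 1) * ‖T a‖ := fun a => by
    rw [LinearMap.smul_apply, norm_smul, Complex.norm_real, Real.norm_of_nonneg (by positivity)]
  have hr : Set.range (k • T) = Set.range T := by
    ext U
    constructor
    · rintro ⟨a, rfl⟩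
      exact ⟨k • a, map_smul _ _ _⟩
    · rintro ⟨a, rfl⟩
      refine ⟨k⁻¹ • a, ?_⟩
      rw [LinearMap.smul_apply, map_smul, smul_inv_smul₀ hk0]
  obtain ⟨A, i1, i2, i3, i4, i5, e, he, hem⟩ := exists_banachAlgebra mul hassoc (k • T)
    (fun a b hab => hT (smul_right_injective X hk0 hab)) (hr ▸ hcl) fun a b => by
      rw [hn, hn, hn]
      calc (K + 1) * ‖T (mul a b)‖ ≤ (K + 1) * ((K + 1) * ‖T a‖ * ‖T b‖) := by
            gcongr
            refine (hmul a b).trans ?_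
            gcongr
            linarith
        _ = _ := by ring
  exact ⟨A, i1, i2, i3, i4, i5, e, fun a => (he a).trans (hn _), hem⟩

/-- The restriction of a bilinear map to a submodule. -/
def restrictBilinear {V : Type*} [NormedAddCommGroup V] [NormedSpace ℂ V] (B : V →L[ℂ] V →L[ℂ] V)
    (S : Submodule ℂ V) (hS : ∀ F ∈ S, ∀ G ∈ S, B F G ∈ S) : S →ₗ[ℂ] S →ₗ[ℂ] S :=
  LinearMap.mk₂ ℂ (fun F G => ⟨B F.1 G.1, hS F.1 F.2 G.1 G.2⟩)
    (fun F F' G => Subtype.ext (by simp)) (fun a F G => Subtype.ext (by simp))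
    (fun F G G' => Subtype.ext (by simp)) (fun a F G => Subtype.ext (by simp))

theorem restrictBilinear_apply {V : Type*} [NormedAddCommGroup V] [NormedSpace ℂ V]
    (B : V →L[ℂ] V →L[ℂ] V) (S : Submodule ℂ V) (hS : ∀ F ∈ S, ∀ G ∈ S, B F G ∈ S) (F G : S) :
    (restrictBilinear B S hS F G).1 = B F.1 G.1 := rfl

/-! ### Modulation spaces as subspaces of `L^2` -/

section ModulationSubmodule

open Filter Topology

variable {E : Type*} [NormedAddCommGroup E] [InnerProductSpace ℝ E] [FiniteDimensional ℝ E]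
  [MeasurableSpace E] [BorelSpace E]

theorem IsGivenBy.congr_ae {f : 𝓢'(E, ℂ)} {F G : E → ℂ} (hF : IsGivenBy f F)
    (h : F =ᵐ[volume] G) : IsGivenBy f G := by
  have h1 : ∀ φ : 𝓢(E, ℂ), (fun x => φ x * F x) =ᵐ[volume] fun x => φ x * G x := fun φ => by
    filter_upwards [h] with x hx
    rw [hx]
  refine ⟨?_, fun φ => ⟨(hF.2 φ).1.congr (h1 φ), (hF.2 φ).2.trans (integral_congr_ae (h1 φ))⟩⟩
  intro x
  obtain ⟨s, hs, hi⟩ := hF.1 x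
  exact ⟨s, hs, hi.congr (ae_restrict_of_ae h)⟩

theorem lpDist_injective : Function.Injective (lpDist (E := E)) := fun F G h =>
  Lp.ext ((isGivenBy_lpDist F).ae_eq (h ▸ isGivenBy_lpDist G))

/-- The value of the short-time Fourier transform at a point, as a functional on `L^2`. -/
def stftAt (h : 𝓢(E, ℂ)) (z : E × E) : Lp ℂ 2 (volume : Measure E) →L[ℂ] ℂ :=
  (PointwiseConvergenceCLM.evalCLM (RingHom.id ℂ) ℂ (schwartzConj (tfShift z h))).comp
    (Lp.toTemperedDistributionCLM ℂ volume 2)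

theorem stft_lpDist_add (h : 𝓢(E, ℂ)) (F G : Lp ℂ 2 (volume : Measure E)) :
    (fun z : E × E => stft h (lpDist (F + G)) z.1 z.2) =
      (fun z : E × E => stft h (lpDist F) z.1 z.2) + fun z => stft h (lpDist G) z.1 z.2 :=
  funext fun z => map_add (stftAt h z) F G

theorem stft_lpDist_smul (h : 𝓢(E, ℂ)) (c : ℂ) (F : Lp ℂ 2 (volume : Measure E)) :
    (fun z : E × E => stft h (lpDist (c • F)) z.1 z.2) =
      c • fun z : E × E => stft h (lpDist F) z.1 z.2 :=
  funext fun z => map_smul (stftAt h z) c F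

/-- The `L^2` functions in the modulation space `M^{p,p}`. -/
def modulationSubmodule (p : ℝ≥0∞) (h : 𝓢(E, ℂ)) :
    Submodule ℂ (Lp ℂ 2 (volume : Measure E)) where
  carrier := {F | MemLp (fun z : E × E => stft h (lpDist F) z.1 z.2) p}
  add_mem' {F G} hF hG := by
    rw [Set.mem_ofPred_eq, stft_lpDist_add]
    exact hF.add hG
  zero_mem' := by
    have h1 : (fun z : E × E => stft h (lpDist (0 : Lp ℂ 2 (volume : Measure E))) z.1 z.2) = 0 :=
      funext fun z => map_zero (stftAt h z)
    rw [Set.mem_ofPred_eq, h1]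
    exact MemLp.zero
  smul_mem' c F hF := by
    rw [Set.mem_ofPred_eq, stft_lpDist_smul]
    exact hF.const_smul c

theorem memLp_stft {p : ℝ≥0∞} {h : 𝓢(E, ℂ)} (F : modulationSubmodule (E := E) p h) :
    MemLp (fun z : E × E => stft h (lpDist F.1) z.1 z.2) p volume := F.2

theorem mem_modulationSubmodule_iff {p : ℝ≥0∞} (hp0 : p ≠ 0) (hp : p ≠ ∞) {h : 𝓢(E, ℂ)}
    {F : Lp ℂ 2 (volume : Measure E)} :
    F ∈ modulationSubmodule p h ↔ modulationNorm p p h (lpDist F) ≠ ∞ := by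
  rw [modulationNorm, mixedNorm_self hp0 hp (continuous_stft h _), ← lt_top_iff_ne_top]
  exact ⟨fun hF => hF.2, fun hF => ⟨(continuous_stft h _).aestronglyMeasurable, hF⟩⟩

/-- The short-time Fourier transform on `M^{p,p}`. -/
def modulationMap (p : ℝ≥0∞) [Fact (1 ≤ p)] (h : 𝓢(E, ℂ)) :
    modulationSubmodule p h →ₗ[ℂ] Lp ℂ p (volume : Measure (E × E)) where
  toFun F := (memLp_stft F).toLp
  map_add' F G := by
    refine ((memLp_stft (F + G)).toLp_congr ((memLp_stft F).add (memLp_stft G))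
      (.of_eq (stft_lpDist_add h F.1 G.1))).trans ?_
    exact MemLp.toLp_add _ _
  map_smul' c F := by
    refine ((memLp_stft (c • F)).toLp_congr ((memLp_stft F).const_smul c)
      (.of_eq (stft_lpDist_smul h c F.1))).trans ?_
    exact MemLp.toLp_const_smul _ _

theorem coeFn_modulationMap (p : ℝ≥0∞) [Fact (1 ≤ p)] (h : 𝓢(E, ℂ))
    (F : modulationSubmodule p h) : modulationMap p h F =ᵐ[volume]
      fun z : E × E => stft h (lpDist F.1) z.1 z.2 :=
  MemLp.coeFn_toLp (memLp_stft F)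

theorem enorm_modulationMap {p : ℝ≥0∞} [Fact (1 ≤ p)] (hp : p ≠ ∞) (h : 𝓢(E, ℂ))
    (F : modulationSubmodule p h) :
    ‖modulationMap p h F‖ₑ = modulationNorm p p h (lpDist F.1) := by
  have hp0 : p ≠ 0 := (zero_lt_one.trans_le Fact.out).ne'
  rw [Lp.enorm_def, eLpNorm_congr_ae (coeFn_modulationMap p h F), modulationNorm,
    mixedNorm_self hp0 hp (continuous_stft h _)]

/-- This control of the $L^2$ norm gives injectivity and turns Cauchy sequences of transforms into
Cauchy sequences in $L^2$. -/
theorem exists_norm_le_modulationMap {p : ℝ≥0∞} [Fact (1 ≤ p)] (hp2 : p ≤ 2) {h : 𝓢(E, ℂ)}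
    (hh : h ≠ 0) : ∃ C : NNReal, ∀ F : modulationSubmodule p h,
      ‖(F : Lp ℂ 2 (volume : Measure E))‖ ≤ C * ‖modulationMap p h F‖ := by
  have hp : p ≠ ∞ := (hp2.trans_lt ENNReal.ofNat_lt_top).ne
  have hp0 : p ≠ 0 := (zero_lt_one.trans_le Fact.out).ne'
  obtain ⟨C, hC⟩ := exists_lpDist_eq_of_modulationNorm Fact.out hp2 hh
  refine ⟨C, fun F => ?_⟩
  obtain ⟨G, hG, hn⟩ := hC _ ((mem_modulationSubmodule_iff hp0 hp).1 F.2)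
  rw [lpDist_injective hG, ← enorm_modulationMap hp, enorm_eq_nnnorm, enorm_eq_nnnorm,
    ← ENNReal.coe_mul, ENNReal.coe_le_coe] at hn
  exact_mod_cast hn

theorem modulationMap_injective {p : ℝ≥0∞} [Fact (1 ≤ p)] (hp2 : p ≤ 2) {h : 𝓢(E, ℂ)}
    (hh : h ≠ 0) : Function.Injective (modulationMap p h) := by
  obtain ⟨C, hC⟩ := exists_norm_le_modulationMap hp2 hh
  rw [injective_iff_map_eq_zero]
  intro F hF
  have h1 := hC F
  rw [hF, norm_zero, mul_zero, norm_le_zero_iff] at h1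
  exact Subtype.ext h1

theorem isClosed_range_modulationMap {p : ℝ≥0∞} [Fact (1 ≤ p)] (hp2 : p ≤ 2) {h : 𝓢(E, ℂ)}
    (hh : h ≠ 0) : IsClosed (Set.range (modulationMap p h)) := by
  obtain ⟨C, hC⟩ := exists_norm_le_modulationMap hp2 hh
  refine IsSeqClosed.isClosed fun u U hu hU => ?_
  choose x hx using hu
  have hcs : CauchySeq fun k => (x k : Lp ℂ 2 (volume : Measure E)) := by
    rw [Metric.cauchySeq_iff]
    intro ε hε
    obtain ⟨N, hN⟩ := Metric.cauchySeq_iff.1 hU.cauchySeq (ε / (C + 1)) (by positivity)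
    refine ⟨N, fun k hk l hl => ?_⟩
    have h1 := hN k hk l hl
    rw [← hx, ← hx, dist_eq_norm, ← map_sub, lt_div_iff₀ (by positivity)] at h1
    have h2 := hC (x k - x l)
    rw [dist_eq_norm]
    rw [Submodule.coe_sub] at h2
    nlinarith [norm_nonneg (modulationMap p h (x k - x l))]
  obtain ⟨F, hF⟩ := cauchySeq_tendsto_of_complete hcs
  obtain ⟨ns, hns, hae⟩ := (tendstoInMeasure_of_tendsto_Lp hU).exists_seq_tendsto_ae
  have hcoe : ∀ᵐ z : E × E, ∀ k, u k z =
      stft h (lpDist (x k).1) z.1 z.2 := by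
    rw [ae_all_iff]
    intro k
    rw [← hx k]
    exact coeFn_modulationMap p h (x k)
  -- Along a subsequence the transforms tend almost everywhere to the $L^p$ limit `U`, and $L^2$
  -- convergence gives their limit at every point.
  have hUF : U =ᵐ[volume] fun z : E × E => stft h (lpDist F) z.1 z.2 := by
    filter_upwards [hae, hcoe] with z h1 h2
    refine tendsto_nhds_unique h1 ?_
    simp_rw [h2]
    exact ((stftAt h z).continuous.tendsto F).comp (hF.comp hns.tendsto_atTop)
  have hFm : F ∈ modulationSubmodule p h := (Lp.memLp U).ae_eq hUF
  exact ⟨⟨F, hFm⟩, Lp.ext ((coeFn_modulationMap p h ⟨F, hFm⟩).trans hUF.symm)⟩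

end ModulationSubmodule

/-- A bounded associative product on `L^2` which is bounded for the norm of `M^{p,p}` makes this
space a Banach algebra. -/
theorem exists_banachAlgebra_modulation {E : Type} [NormedAddCommGroup E] [InnerProductSpace ℝ E]
    [FiniteDimensional ℝ E] [MeasurableSpace E] [BorelSpace E] {p : ℝ≥0∞} [Fact (1 ≤ p)]
    (hp2 : p ≤ 2) {h : 𝓢(E, ℂ)} (hh : h ≠ 0)
    (B : Lp ℂ 2 (volume : Measure E) →L[ℂ] Lp ℂ 2 (volume : Measure E) →L[ℂ]
      Lp ℂ 2 (volume : Measure E))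
    (hB : ∀ F G H, B (B F G) H = B F (B G H)) (K : NNReal)
    (hK : ∀ F G, modulationNorm p p h (lpDist (B F G)) ≤
      K * modulationNorm p p h (lpDist F) * modulationNorm p p h (lpDist G)) :
    ∃ (A : Type) (_ : NonUnitalNormedRing A) (_ : NormedSpace ℂ A) (_ : IsScalarTower ℂ A A)
      (_ : SMulCommClass ℂ A A) (_ : CompleteSpace A)
      (ι : A →ₗ[ℂ] Lp ℂ 2 (volume : Measure E)), Function.Injective ι ∧
      (∀ F, F ∈ Set.range ι ↔ modulationNorm p p h (lpDist F) ≠ ∞) ∧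
      (∀ a, ‖a‖ₑ = ((K + 1 : NNReal) : ℝ≥0∞) * modulationNorm p p h (lpDist (ι a))) ∧
      ∀ a b, ι (a * b) = B (ι a) (ι b) := by
  have hp : p ≠ ∞ := (hp2.trans_lt ENNReal.ofNat_lt_top).ne
  have hp0 : p ≠ 0 := (zero_lt_one.trans_le Fact.out).ne'
  have hmem : ∀ F ∈ modulationSubmodule p h, ∀ G ∈ modulationSubmodule p h,
      B F G ∈ modulationSubmodule p h := fun F hF G hG => by
    refine (mem_modulationSubmodule_iff hp0 hp).2 (ne_top_of_le_ne_top ?_ (hK F G))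
    exact ENNReal.mul_ne_top (ENNReal.mul_ne_top ENNReal.coe_ne_top
      ((mem_modulationSubmodule_iff hp0 hp).1 hF)) ((mem_modulationSubmodule_iff hp0 hp).1 hG)
  have hmul : ∀ F G, ‖modulationMap p h (restrictBilinear B _ hmem F G)‖ ≤
      K * ‖modulationMap p h F‖ * ‖modulationMap p h G‖ := fun F G => by
    have h2 : ‖modulationMap p h (restrictBilinear B _ hmem F G)‖ₑ ≤
        K * ‖modulationMap p h F‖ₑ * ‖modulationMap p h G‖ₑ := by
      rw [enorm_modulationMap hp, enorm_modulationMap hp, enorm_modulationMap hp,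
        restrictBilinear_apply]
      exact hK F.1 G.1
    rw [enorm_eq_nnnorm, enorm_eq_nnnorm, enorm_eq_nnnorm, ← ENNReal.coe_mul, ← ENNReal.coe_mul,
      ENNReal.coe_le_coe] at h2
    exact_mod_cast h2
  obtain ⟨A, i1, i2, i3, i4, i5, e, he, hem⟩ := exists_banachAlgebra_of_le
    (restrictBilinear B _ hmem) (fun F G H => Subtype.ext (hB F.1 G.1 H.1))
    (modulationMap p h) (modulationMap_injective hp2 hh) (isClosed_range_modulationMap hp2 hh)
    K hmul
  refine ⟨A, i1, i2, i3, i4, i5, (modulationSubmodule p h).subtype ∘ₗ e.toLinearMap,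
    Subtype.val_injective.comp e.injective, fun F => ⟨?_, fun hF => ?_⟩, fun a => ?_,
    fun a b => congrArg Subtype.val (hem a b)⟩
  · rintro ⟨a, rfl⟩
    exact (mem_modulationSubmodule_iff hp0 hp).1 (e a).2
  · exact ⟨e.symm ⟨F, (mem_modulationSubmodule_iff hp0 hp).2 hF⟩, by simp⟩
  · have h1 : ‖a‖ₑ = ((K + 1 : NNReal) : ℝ≥0∞) * ‖modulationMap p h (e a)‖ₑ := by
      rw [enorm_eq_nnnorm, enorm_eq_nnnorm, ← ENNReal.coe_mul, ENNReal.coe_inj]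
      exact NNReal.eq (he a)
    rw [h1, enorm_modulationMap hp]
    rfl

namespace PhaseSpace

variable {n : ℕ}

/-- The twisted modulation space is a Banach algebra for the twisted convolution. -/
theorem exists_twistedBanachAlgebra {lam : ℝ} (hlam : lam ≠ 0) {p : ℝ≥0∞} (hp1 : 1 ≤ p)
    (hp2 : p ≤ 2) {h : 𝓢(PhaseSpace n, ℂ)} (hh : h ≠ 0) : ∃ C : ℝ, 0 < C ∧
      ∃ (A : Type) (_ : NonUnitalNormedRing A) (_ : NormedSpace ℂ A) (_ : IsScalarTower ℂ A A)
        (_ : SMulCommClass ℂ A A) (_ : CompleteSpace A) (ι : A →ₗ[ℂ] 𝓢'(PhaseSpace n, ℂ)),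
        Function.Injective ι ∧
        Set.range ι = twistedModulationSpace n lam p p ∧
        (∀ a : A, ‖a‖ₑ = ENNReal.ofReal C * twistedModulationNorm lam p p h (ι a)) ∧
        ∀ (a b : A) (F G : PhaseSpace n → ℂ), IsGivenBy (ι a) F → IsGivenBy (ι b) G →
          (∀ ξ, Integrable (fun η => F η * twistedTranslate lam η G ξ)) ∧
          IsGivenBy (ι (a * b)) (twistedConv lam F G) := by
  have hp : p ≠ ∞ := (hp2.trans_lt ENNReal.ofNat_lt_top).ne
  have hp0 : p ≠ 0 := (zero_lt_one.trans_le hp1).ne'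
  have : Fact (1 ≤ p) := ⟨hp1⟩
  obtain ⟨B, hB⟩ := exists_twistedMul (n := n) hlam hh
  obtain ⟨K, hK⟩ := exists_modulationNorm_twistedConv_le (n := n) hlam hp1 hp2 hh
  obtain ⟨c, hc, hceq⟩ := exists_twistedModulationNorm_eq (n := n) hlam hp0 hp
  have hgiven : ∀ F G, IsGivenBy (lpDist (B F G)) (twistedConv lam F G) := fun F G =>
    (isGivenBy_lpDist _).congr_ae (hB F G)
  obtain ⟨A, i1, i2, i3, i4, i5, j, hj, hr, hn, hm⟩ := exists_banachAlgebra_modulation hp2 hh B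
    (twistedMul_assoc hB) K fun F G => hK F G _ (hgiven F G)
  -- `K + 1` makes the classical norm submultiplicative; `c` is the ratio of the twisted norm to the
  -- classical one.
  refine ⟨(K + 1) / c, by positivity, A, i1, i2, i3, i4, i5,
    (Lp.toTemperedDistributionCLM ℂ (volume : Measure (PhaseSpace n)) 2).toLinearMap ∘ₗ j,
    lpDist_injective.comp hj, ?_, ?_, ?_⟩
  · rw [twistedModulationSpace_eq hlam hp0 hp]
    ext f
    constructor
    · rintro ⟨a, rfl⟩
      exact ⟨h, hh, lt_top_iff_ne_top.2 ((hr (j a)).1 ⟨a, rfl⟩)⟩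
    · rintro ⟨g, hg, hf⟩
      -- Membership is witnessed by some window `g`, whereas the algebra is built with `h`.
      obtain ⟨C1, h1⟩ := exists_modulationNorm_le hp1 hp hg h
      obtain ⟨C2, h2⟩ := exists_lpDist_eq_of_modulationNorm hp1 hp2 hh
      have h3 : modulationNorm p p h f ≠ ∞ :=
        ne_top_of_le_ne_top (ENNReal.mul_ne_top ENNReal.coe_ne_top hf.ne) (h1 f)
      obtain ⟨F, rfl, -⟩ := h2 f h3
      obtain ⟨a, rfl⟩ := (hr F).2 h3
      exact ⟨a, rfl⟩
  · intro a
    have h1 : ENNReal.ofReal ((K + 1) / c) * c = ((K + 1 : NNReal) : ℝ≥0∞) := by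
      rw [← ENNReal.ofReal_coe_nnreal, ← ENNReal.ofReal_coe_nnreal,
        ← ENNReal.ofReal_mul (by positivity), div_mul_cancel₀ _ (by exact_mod_cast hc.ne')]
      rfl
    rw [hn, hceq, ← mul_assoc, h1]
    rfl
  · intro a b F G hF hG
    -- Arbitrary representing functions agree almost everywhere with the $L^2$ ones, and twisted
    -- convolution does not see null sets at any point.
    have h1 : F =ᵐ[volume] j a := hF.ae_eq (isGivenBy_lpDist _)
    have h2 : G =ᵐ[volume] j b := hG.ae_eq (isGivenBy_lpDist _)
    refine ⟨integrable_twistedConv lam ((Lp.memLp _).ae_eq h1.symm)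
      ((Lp.memLp _).ae_eq h2.symm), ?_⟩
    rw [twistedConv_congr lam h1 h2, LinearMap.comp_apply, hm]
    exact hgiven (j a) (j b)

/-- The elements of the twisted modulation space are `L^p` functions. -/
theorem exists_memLp_isGivenBy {lam : ℝ} (hlam : lam ≠ 0) {p : ℝ≥0∞} (hp1 : 1 ≤ p) (hp2 : p ≤ 2)
    {f : 𝓢'(PhaseSpace n, ℂ)} (hf : f ∈ twistedModulationSpace n lam p p) :
    ∃ F : PhaseSpace n → ℂ, MemLp F p ∧ IsGivenBy f F := by
  have hp : p ≠ ∞ := (hp2.trans_lt ENNReal.ofNat_lt_top).ne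
  rw [twistedModulationSpace_eq hlam (zero_lt_one.trans_le hp1).ne' hp] at hf
  obtain ⟨g, hg, hfg⟩ := hf
  obtain ⟨C, hC⟩ := exists_lpDist_eq_of_modulationNorm hp1 hp2 hg
  obtain ⟨F, rfl, -⟩ := hC f hfg.ne
  exact ⟨F, memLp_of_modulationNorm hp1 hp2 hg F hfg.ne, isGivenBy_lpDist F⟩

end PhaseSpace

end

theorem mainTheorem7 (n : ℕ) (lam : ℝ) (hlam : lam ≠ 0) (p : ℝ≥0∞) (hp1 : 1 ≤ p) (hp2 : p ≤ 2) :
    -- the two spaces coincide, with equivalent norms for all windows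
    PhaseSpace.twistedModulationSpace n lam p p = modulationSpace (PhaseSpace n) p p ∧
    (∀ g h : 𝓢(PhaseSpace n, ℂ), g ≠ 0 → h ≠ 0 → ∃ C : NNReal, ∀ f : 𝓢'(PhaseSpace n, ℂ),
      modulationNorm p p g f ≤ C * PhaseSpace.twistedModulationNorm lam p p h f ∧
      PhaseSpace.twistedModulationNorm lam p p h f ≤ C * modulationNorm p p g f) ∧
    -- the elements of the space are functions, so that twisted convolution makes sense for them
    (∀ f ∈ PhaseSpace.twistedModulationSpace n lam p p,
      ∃ F : PhaseSpace n → ℂ, MemLp F p ∧ IsGivenBy f F) ∧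
    -- for every window, a multiple of the norm makes the space a Banach algebra `A`
    -- whose product is the twisted convolution
    (∀ h : 𝓢(PhaseSpace n, ℂ), h ≠ 0 → ∃ C : ℝ, 0 < C ∧
      ∃ (A : Type) (_ : NonUnitalNormedRing A) (_ : NormedSpace ℂ A) (_ : IsScalarTower ℂ A A)
        (_ : SMulCommClass ℂ A A) (_ : CompleteSpace A) (ι : A →ₗ[ℂ] 𝓢'(PhaseSpace n, ℂ)),
        Function.Injective ι ∧
        Set.range ι = PhaseSpace.twistedModulationSpace n lam p p ∧
        (∀ a : A, ‖a‖ₑ = ENNReal.ofReal C * PhaseSpace.twistedModulationNorm lam p p h (ι a)) ∧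
        ∀ (a b : A) (F G : PhaseSpace n → ℂ), IsGivenBy (ι a) F → IsGivenBy (ι b) G →
          (∀ ξ, Integrable (fun η => F η * PhaseSpace.twistedTranslate lam η G ξ)) ∧
          IsGivenBy (ι (a * b)) (PhaseSpace.twistedConv lam F G)) := by
  have hp : p ≠ ∞ := (hp2.trans_lt ENNReal.ofNat_lt_top).ne
  exact ⟨PhaseSpace.twistedModulationSpace_eq hlam (zero_lt_one.trans_le hp1).ne' hp,
    fun _ _ hg hh => PhaseSpace.exists_modulationNorm_equiv hlam hp1 hp hg hh,
    fun _ hf => PhaseSpace.exists_memLp_isGivenBy hlam hp1 hp2 hf,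
    fun _ hh => PhaseSpace.exists_twistedBanachAlgebra hlam hp1 hp2 hh⟩
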